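/- **Setting.** Let $1<p<\infty$, $A\in\mathbb R^{n\times d}$, $b\in\mathbb R^n$, $c\in\ker(A)^\perp$, and $s(x)=Ax-b$. For $t>0$ let $f_t(s)=\frac p2t^{p-2}s^2$ if $|s|\le t$ and $f_t(s)=|s|^p+(\frac p2-1)t^p$ otherwise, and let $x(t)$ be the minimizer of $c\cdot x+\sum_i f_t(s_i(x))$ over $x\in\ker(A)^\perp$ (it exists and is unique). Put $h=\frac1{2p}$, $t_k=(1-h)^kt_0$, and write $s^{q}$ for the signed power $\mathrm{sign}(s)|s|^q$. For $s\in\mathbb R^n$ let $\mathcal N_s(\gamma)=\{s':\forall i,\ |(s'_i)^{p/2}-(s_i)^{p/2}|\le\gamma\}$ (a box), $\gamma_t=\bigl(1+\frac{p^3}{p-1}\sqrt n\,h\bigr)t^{p/2}$ and $\kappa=\frac{4p^2}{p-1}\bigl(3+\frac{2p^3}{p-1}\sqrt n\,h\bigr)^{|2-4/p|}$. **Method.** One phase takes a parameter $t$ and a point $x$ (an approximation of $x(t)$). Let $D_t$ be the diagonal matrix with entries $\frac{p-1}2\max\bigl(t^{p/2},|s_i(x)|^{p/2}-\mathrm{sign}(p-2)\gamma_t\bigr)^{2-4/p}$,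 and let $P$ be either $P_t=((A^\top D_tA)^\dagger)^{1/2}$ or $P_t'=(A^\top D_tA)^\dagger A^\top\sqrt{D_t}$. Let $g_t(y)=c\cdot Py+\sum_i\tilde f_i\bigl((APy-b)_i\bigr)$, where $\tilde f_i$ equals $f_{(1-h)t}$ on the $i$-th side $[\ell_i,u_i]$ of the box $\mathcal N_{s(x)}(\gamma_t)$ and is continued outside by its second-order Taylor polynomials at $u_i$ and $\ell_i$ (at the corners $|s|=t$ of $f_t'$ the value $f_t''=pt^{p-2}$ is used). The phase runs $T$ steps of Nesterov's accelerated gradient descent (AGD) on $g_t$ with strong convexity constant $1$ and smoothness constant $\kappa$, i.e. $y_{j+1}=z_j-\frac1\kappa\nabla g_t(z_j)$, $z_{j+1}=y_{j+1}+\frac{\sqrt\kappa-1}{\sqrt\kappa+1}(y_{j+1}-y_j)$, from $y_0=z_0=P^\top A^\top D_tAx$, and returns $Py_T$. The homotopy method starts from $\hat x_0=x(t_0)$ and obtains $\hat x_{k+1}$ from $\hat x_k$ by one phase with parameter $t_k$. **Theorem.** There are absolute constants $C>0$ and $a\in\mathbb N$ such that the following holds for all $p,n,d,A,b,c$ as above.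 1. (Initial point.) If $t_0=\max\bigl((2\sqrt{c^\top(A^\top A)^\dagger c})^{1/(p-1)},2\|b\|_2\bigr)>0$, then $x(t_0)=(A^\top A)^\dagger A^\top b-\frac1pt_0^{2-p}(A^\top A)^\dagger c$. The same formula holds for $t_0=\max\bigl((2c^\top(A^\top A)^\dagger c)^{1/(p-1)},2\|b\|_2\bigr)>0$ if $p^2c^\top(A^\top A)^\dagger c\ge1$. 2. (Phases and iterations.) Let $t_0>0$ be arbitrary, in particular one of the two values in 1, and let the number $T$ of AGD iterations per phase satisfy $T\ge C\bigl(\frac{p^2}{p-1}\bigr)^an^{|1/2-1/p|}\log(n+1)$. Then, with either choice of the preconditioner, $s(\hat x_k)\in\mathcal N_{s(x(t_k))}(\gamma_{t_k})$ for all $k\ge 0$, and for every $\varepsilon>0$ and every integer $K\ge0$ with $K\ge C\log\bigl(\frac{np}{\varepsilon}t_0^p\bigr)$ both $x(t_K)$ and the computed point $\hat x_K$ are $\varepsilon$-optimal: $$c\cdot\hat x_K+\|A\hat x_K-b\|_p^p\le\varepsilon+\min_{x\in\mathbb R^d}\bigl(c\cdot x+\|Ax-b\|_p^p\bigr).$$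 (For $n=0$ the last condition on $K$ is void.) Hence $O(\log(\frac{np}{\varepsilon}t_0^p))$ phases of $O_p(n^{|1/2-1/p|}\log n)$ AGD iterations suffice, where $O_p$ hides a polynomial in $\frac{p^2}{p-1}$. 3. (Cost of an iteration.) For all $n,d,m$ and all $S\subseteq[n]\times[d]$ there is a straight-line program over the reals that performs one AGD step $(y_j,z_j)\mapsto(y_{j+1},z_{j+1})$ in place, in every phase, for every $A$ whose nonzero entries lie in $S$, for all $b,c,p$ and every preconditioner $P\in\mathbb R^{d\times m}$. It reads the entries of $A,b,c$, the numbers $p,\ (1-h)t,\ \kappa,\ \ell_i,\ u_i$ and the state from memory, and uses at most $C$ multiplications of a vector by $P$ or $P^\top$ and at most $C(|S|+n+d+m+1)$ elementary operations (rational constants, $+,-,\times,/$, real powers, comparisons). Here $m=d$ for $P_t$ and $m=n$ for $P_t'$, so the work is linear in the size of the input. -/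

import Mathlib

open Matrix

noncomputable section

namespace LpHomotopy

/-! ### The regression problem, the smoothing family and the homotopy path -/

/-- The residual `s(x) = A x - b`. -/
def residual {n d : ℕ} (A : Matrix (Fin n) (Fin d) ℝ) (b : Fin n → ℝ) (x : Fin d → ℝ) :
    Fin n → ℝ :=
  A *ᵥ x - b

/-- The `ℓ_p` regression objective `c · x + ‖A x - b‖_p ^ p`. -/
def objective {n d : ℕ} (A : Matrix (Fin n) (Fin d) ℝ) (b : Fin n → ℝ) (c : Fin d → ℝ) (p : ℝ)
    (x : Fin d → ℝ) : ℝ :=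
  c ⬝ᵥ x + ∑ i, |residual A b x i| ^ p

/-- `x` is an `ε`-optimal solution of the `ℓ_p` regression problem. -/
def IsEpsOptimal {n d : ℕ} (A : Matrix (Fin n) (Fin d) ℝ) (b : Fin n → ℝ) (c : Fin d → ℝ) (p : ℝ)
    (ε : ℝ) (x : Fin d → ℝ) : Prop :=
  ∀ x' : Fin d → ℝ, objective A b c p x ≤ ε + objective A b c p x'

/-- `v` is orthogonal to the kernel of `A`. -/
def KerOrth {n d : ℕ} (A : Matrix (Fin n) (Fin d) ℝ) (v : Fin d → ℝ) : Prop :=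
  ∀ w : Fin d → ℝ, A *ᵥ w = 0 → v ⬝ᵥ w = 0

/-- The smoothing `f_t` of `|s| ^ p`, quadratic on `[-t, t]`. -/
def smooth (p t s : ℝ) : ℝ :=
  if |s| ≤ t then p / 2 * t ^ (p - 2) * s ^ 2 else |s| ^ p + (p / 2 - 1) * t ^ p

/-- The derivative `f_t'`. -/
def smooth' (p t s : ℝ) : ℝ :=
  if |s| ≤ t then p * t ^ (p - 2) * s else p * |s| ^ (p - 2) * s

/-- The second derivative `f_t''`, with the inner value at the two points `|s| = t` where `f_t'`
has a corner. -/
def smooth'' (p t s : ℝ) : ℝ :=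
  if |s| ≤ t then p * t ^ (p - 2) else p * (p - 1) * |s| ^ (p - 2)

/-- The smoothed objective `c · x + ∑ i, f_t (s_i(x))`. -/
def smoothObjective {n d : ℕ} (A : Matrix (Fin n) (Fin d) ℝ) (b : Fin n → ℝ) (c : Fin d → ℝ)
    (p t : ℝ) (x : Fin d → ℝ) : ℝ :=
  c ⬝ᵥ x + ∑ i, smooth p t (residual A b x i)

/-- `x` is the point `x(t)` of the homotopy path: it minimizes the smoothed objective over
`ker(A)ᗮ`. -/
def IsPathPoint {n d : ℕ} (A : Matrix (Fin n) (Fin d) ℝ) (b : Fin n → ℝ) (c : Fin d → ℝ)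
    (p t : ℝ) (x : Fin d → ℝ) : Prop :=
  KerOrth A x ∧
    ∀ x' : Fin d → ℝ, KerOrth A x' → smoothObjective A b c p t x ≤ smoothObjective A b c p t x'

/-! ### The neighbourhood and the quadratic extension -/

/-- The signed power `sign(s) |s| ^ q`. -/
def spow (s q : ℝ) : ℝ :=
  SignType.sign s * |s| ^ q

/-- The relative decrease of the smoothing parameter in one phase. -/
def stepH (p : ℝ) : ℝ := 1 / (2 * p)

/-- The radius `γ` of the neighbourhood. -/
def radius (p : ℝ) (n : ℕ) (t : ℝ) : ℝ :=
  (1 + p ^ 3 / (p - 1) * √(n : ℝ) * stepH p) * t ^ (p / 2)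

/-- The neighbourhood `𝒩_s(γ)`; powers of real numbers of either sign are signed powers. -/
def Nbhd {n : ℕ} (p : ℝ) (s : Fin n → ℝ) (γ : ℝ) : Set (Fin n → ℝ) :=
  {s' | ∀ i, |spow (s' i) (p / 2) - spow (s i) (p / 2)| ≤ γ}

/-- The endpoints of the `i`-th side of the box `𝒩_s(γ)`, as functions of `s_i`. -/
def lower (p γ s : ℝ) : ℝ := spow (spow s (p / 2) - γ) (2 / p)

def upper (p γ s : ℝ) : ℝ := spow (spow s (p / 2) + γ) (2 / p)

/-- The quadratic extension of `f_t` outside `[l, u]`. -/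
def extend (p t l u s : ℝ) : ℝ :=
  if l ≤ s ∧ s ≤ u then smooth p t s
  else if u ≤ s then
    smooth p t u + smooth' p t u * (s - u) + 1 / 2 * smooth'' p t u * (s - u) ^ 2
  else smooth p t l + smooth' p t l * (s - l) + 1 / 2 * smooth'' p t l * (s - l) ^ 2

/-! ### The preconditioners -/

/-- The Moore-Penrose inverse `M†` of a symmetric matrix `M`: the nonzero eigenvalues are inverted,
the eigenvalue `0` is kept. -/
def pinv {d : ℕ} (M : Matrix (Fin d) (Fin d) ℝ) : Matrix (Fin d) (Fin d) ℝ :=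
  cfc (fun x : ℝ => x⁻¹) M

/-- `(M†)^{1/2}` for a positive semidefinite matrix `M`. -/
def pinvSqrt {d : ℕ} (M : Matrix (Fin d) (Fin d) ℝ) : Matrix (Fin d) (Fin d) ℝ :=
  cfc (fun x : ℝ => √(x⁻¹)) M

/-- The diagonal of the matrix `D_t`, for the residual vector `s`. -/
def weight {n : ℕ} (p t : ℝ) (s : Fin n → ℝ) (i : Fin n) : ℝ :=
  (p - 1) / 2 *
    max (t ^ (p / 2)) (|s i| ^ (p / 2) - SignType.sign (p - 2) * radius p n t) ^ (2 - 4 / p)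

/-- The matrix `Aᵀ D_t A`, where `D_t` is built at the point `x`. -/
def gram {n d : ℕ} (A : Matrix (Fin n) (Fin d) ℝ) (b : Fin n → ℝ) (p t : ℝ) (x : Fin d → ℝ) :
    Matrix (Fin d) (Fin d) ℝ :=
  Aᵀ * Matrix.diagonal (weight p t (residual A b x)) * A

/-- The preconditioner `P_t = ((Aᵀ D_t A)†)^{1/2}`, built at the point `x`. -/
def precond {n d : ℕ} (A : Matrix (Fin n) (Fin d) ℝ) (b : Fin n → ℝ) (p t : ℝ) (x : Fin d → ℝ) :
    Matrix (Fin d) (Fin d) ℝ :=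
  pinvSqrt (gram A b p t x)

/-- The preconditioner `P_t' = (Aᵀ D_t A)† Aᵀ √D_t`, built at the point `x`. -/
def precond' {n d : ℕ} (A : Matrix (Fin n) (Fin d) ℝ) (b : Fin n → ℝ) (p t : ℝ) (x : Fin d → ℝ) :
    Matrix (Fin d) (Fin n) ℝ :=
  pinv (gram A b p t x) * Aᵀ * Matrix.diagonal (fun i => √(weight p t (residual A b x) i))

/-! ### Accelerated gradient descent and the homotopy method -/

/-- One step of Nesterov's accelerated gradient descent, with constant step size and momentum, for
a function with strong convexity constant `1` and smoothness constant `κ`. -/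
def agdStep {E : Type*} [NormedAddCommGroup E] [InnerProductSpace ℝ E] [CompleteSpace E]
    (g : E → ℝ) (κ : ℝ) (yz : E × E) : E × E :=
  let y' := yz.2 - (1 / κ) • gradient g yz.2
  (y', y' + ((√κ - 1) / (√κ + 1)) • (y' - yz.1))

/-- `T` steps of accelerated gradient descent from `y₀`. -/
def agd {E : Type*} [NormedAddCommGroup E] [InnerProductSpace ℝ E] [CompleteSpace E]
    (g : E → ℝ) (κ : ℝ) (T : ℕ) (y₀ : E) : E :=
  ((agdStep g κ)^[T] (y₀, y₀)).1

/-- The condition number with which accelerated gradient descent is run. -/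
def kappa (p : ℝ) (n : ℕ) : ℝ :=
  4 * p ^ 2 / (p - 1) * (3 + 2 * p ^ 3 / (p - 1) * √(n : ℝ) * stepH p) ^ |2 - 4 / p|

/-- The function `g_t(y) = c · P y + f̃_t(A P y - b)`, where `f̃_t` is the quadratic extension of
`f_{(1-h)t}` outside the box `𝒩_{s(x)}(γ)`. -/
def precondObjective {n d m : ℕ} (A : Matrix (Fin n) (Fin d) ℝ) (b : Fin n → ℝ) (c : Fin d → ℝ)
    (p t : ℝ) (x : Fin d → ℝ) (P : Matrix (Fin d) (Fin m) ℝ) (y : EuclideanSpace ℝ (Fin m)) : ℝ :=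
  c ⬝ᵥ (P *ᵥ y.ofLp) +
    ∑ i, extend p ((1 - stepH p) * t)
      (lower p (radius p n t) (residual A b x i)) (upper p (radius p n t) (residual A b x i))
      (residual A b (P *ᵥ y.ofLp) i)

/-- One phase: from the current approximation `x` of `x(t)`, run `T` steps of accelerated gradient
descent on `g_t` and return the resulting approximation of `x((1-h)t)`. The argument `P` is the
preconditioner built at `x`; the run starts at `y₀ = Pᵀ Aᵀ D_t A x`, which for both preconditioners
is the preimage of `x`: `P y₀ = x` for `x ∈ ker(A)ᗮ`. -/
def phase {n d m : ℕ} (A : Matrix (Fin n) (Fin d) ℝ) (b : Fin n → ℝ) (c : Fin d → ℝ)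
    (p t : ℝ) (T : ℕ) (P : Matrix (Fin d) (Fin m) ℝ) (x : Fin d → ℝ) : Fin d → ℝ :=
  P *ᵥ (agd (precondObjective A b c p t x P) (kappa p n) T
    (WithLp.toLp 2 (Pᵀ *ᵥ (gram A b p t x *ᵥ x)))).ofLp

/-- The smoothing parameters `t_k = (1-h)^k t₀`. -/
def tSeq (p t₀ : ℝ) (k : ℕ) : ℝ := (1 - stepH p) ^ k * t₀

/-- The point computed by the homotopy method after `k` phases of `T` steps of accelerated gradient
descent each, started at `x₀`; `pre t x` is the preconditioner built at parameter `t` and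
point `x`. -/
def homotopy {n d m : ℕ} (A : Matrix (Fin n) (Fin d) ℝ) (b : Fin n → ℝ) (c : Fin d → ℝ) (p t₀ : ℝ)
    (pre : ℝ → (Fin d → ℝ) → Matrix (Fin d) (Fin m) ℝ) (T : ℕ) (x₀ : Fin d → ℝ) :
    ℕ → (Fin d → ℝ)
  | 0 => x₀
  | k + 1 =>
    phase A b c p (tSeq p t₀ k) T (pre (tSeq p t₀ k) (homotopy A b c p t₀ pre T x₀ k))
      (homotopy A b c p t₀ pre T x₀ k)

/-! ### The initial point -/

/-- The number `cᵀ (Aᵀ A)† c`. -/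
def costEnergy {n d : ℕ} (A : Matrix (Fin n) (Fin d) ℝ) (c : Fin d → ℝ) : ℝ :=
  c ⬝ᵥ (pinv (Aᵀ * A) *ᵥ c)

/-- The closed form `(Aᵀ A)† Aᵀ b - (1/p) t^{2-p} (Aᵀ A)† c` of the initial point. -/
def initialPoint {n d : ℕ} (A : Matrix (Fin n) (Fin d) ℝ) (b : Fin n → ℝ) (c : Fin d → ℝ)
    (p t : ℝ) : Fin d → ℝ :=
  pinv (Aᵀ * A) *ᵥ (Aᵀ *ᵥ b) - (1 / p * t ^ (2 - p)) • (pinv (Aᵀ * A) *ᵥ c)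

/-! ### Cost of one step: straight-line programs over the reals with preconditioner calls -/

/-- Memory cells. The data of a phase sit in named cells, `y` and `z` hold the state of accelerated
gradient descent, and `work r i` is the `i`-th entry of the `r`-th work array. -/
inductive Cell (n d m : ℕ) : Type
  | matA (i : Fin n) (j : Fin d)
  | vecB (i : Fin n)
  | vecC (j : Fin d)
  | lo (i : Fin n)
  | hi (i : Fin n)
  | expo
  | smoothing
  | cond
  | y (k : Fin m)
  | z (k : Fin m)
  | work (r i : ℕ)
  deriving DecidableEq

inductive BinOp : Type
  | add
  | sub
  | mul
  | div
  | pow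

def BinOp.eval : BinOp → ℝ → ℝ → ℝ
  | .add, a, b => a + b
  | .sub, a, b => a - b
  | .mul, a, b => a * b
  | .div, a, b => a / b
  | .pow, a, b => a ^ b

/-- Instructions. `const`, `op` and `select` are elementary: each writes one cell. `applyP` and
`applyPT` multiply the vector in a work array by the preconditioner `P`, respectively by its
transpose, and write the result into a work array. -/
inductive Instr (n d m : ℕ) : Type
  | const (dst : Cell n d m) (q : ℚ)
  | op (o : BinOp) (dst a b : Cell n d m)
  /-- `dst := if a ≤ b then u else v` -/
  | select (dst a b u v : Cell n d m)
  | applyP (dst src : ℕ)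
  | applyPT (dst src : ℕ)

/-- Write the vector `v` into the work array `dst`. -/
def writeArray {n d m k : ℕ} (mem : Cell n d m → ℝ) (dst : ℕ) (v : Fin k → ℝ) :
    Cell n d m → ℝ
  | .work r i => if h : r = dst ∧ i < k then v ⟨i, h.2⟩ else mem (.work r i)
  | cell => mem cell

/-- The effect of an instruction on the memory. -/
def Instr.exec {n d m : ℕ} (P : Matrix (Fin d) (Fin m) ℝ) (mem : Cell n d m → ℝ) :
    Instr n d m → (Cell n d m → ℝ)
  | .const dst q => Function.update mem dst (q : ℝ)
  | .op o dst a b => Function.update mem dst (o.eval (mem a) (mem b))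
  | .select dst a b u v => Function.update mem dst (if mem a ≤ mem b then mem u else mem v)
  | .applyP dst src => writeArray mem dst (P *ᵥ fun k : Fin m => mem (.work src k))
  | .applyPT dst src => writeArray mem dst (Pᵀ *ᵥ fun j : Fin d => mem (.work src j))

/-- Whether an instruction is a preconditioner application. -/
def Instr.isApply {n d m : ℕ} : Instr n d m → Bool
  | .applyP _ _ => true
  | .applyPT _ _ => true
  | _ => false

/-- Run a straight-line program. -/
def run {n d m : ℕ} (P : Matrix (Fin d) (Fin m) ℝ) (prog : List (Instr n d m))
    (mem : Cell n d m → ℝ) : Cell n d m → ℝ :=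
  prog.foldl (fun mem' instr => instr.exec P mem') mem

/-- The number of preconditioner applications of a program. -/
def applyCount {n d m : ℕ} (prog : List (Instr n d m)) : ℕ :=
  prog.countP fun instr => instr.isApply

/-- The number of elementary operations of a program. -/
def elemCount {n d m : ℕ} (prog : List (Instr n d m)) : ℕ :=
  prog.countP fun instr => !instr.isApply

/-- The memory holds the data of the phase with parameter `t` and point `x`, and the state `yz` of
accelerated gradient descent; the work arrays are arbitrary. -/
structure Holds {n d m : ℕ} (A : Matrix (Fin n) (Fin d) ℝ) (b : Fin n → ℝ) (c : Fin d → ℝ)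
    (p t : ℝ) (x : Fin d → ℝ) (yz : EuclideanSpace ℝ (Fin m) × EuclideanSpace ℝ (Fin m))
    (mem : Cell n d m → ℝ) : Prop where
  matA : ∀ i j, mem (.matA i j) = A i j
  vecB : ∀ i, mem (.vecB i) = b i
  vecC : ∀ j, mem (.vecC j) = c j
  lo : ∀ i, mem (.lo i) = lower p (radius p n t) (residual A b x i)
  hi : ∀ i, mem (.hi i) = upper p (radius p n t) (residual A b x i)
  expo : mem .expo = p
  smoothing : mem .smoothing = (1 - stepH p) * t
  cond : mem .cond = kappa p n
  y : ∀ k, mem (.y k) = yz.1 k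
  z : ∀ k, mem (.z k) = yz.2 k

/-- The program performs one step of accelerated gradient descent on `g_t`, in place, for every
matrix `A` whose nonzero entries have positions in `S`, for all other data and in every phase. -/
def ImplementsStep {n d m : ℕ} (S : Finset (Fin n × Fin d)) (prog : List (Instr n d m)) : Prop :=
  ∀ (A : Matrix (Fin n) (Fin d) ℝ), (∀ i j, A i j ≠ 0 → (i, j) ∈ S) →
  ∀ (b : Fin n → ℝ) (c : Fin d → ℝ) (p t : ℝ), 1 < p → 0 < t →
  ∀ (x : Fin d → ℝ) (P : Matrix (Fin d) (Fin m) ℝ)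
    (yz : EuclideanSpace ℝ (Fin m) × EuclideanSpace ℝ (Fin m)) (mem : Cell n d m → ℝ),
    Holds A b c p t x yz mem →
    Holds A b c p t x (agdStep (precondObjective A b c p t x P) (kappa p n) yz) (run P prog mem)

end LpHomotopy

end

noncomputable section

namespace LpHomotopy

/-! ### Calculus of the smoothing -/

/-! By convexity, a point of `ker(A)ᗮ` is `x(t)` exactly when `c + Aᵀ f_t'(s(x)) = 0`. Subtracting
this equation at `t` and at `t' = (1-h)t` shows that the change of `f'` is orthogonal to the change
of the residual. In that sum of products, no coordinate contributes less than `-O_p(h² t^p)`, and a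
coordinate with `|s_i| ≥ t` or `|s'_i| ≥ t` contributes at least a multiple of `M^{p-2}(s'_i -
s_i)²`, where `M = max(|s_i|, |s'_i|)`. Up to constants this is the squared difference of the signed
`p/2`-th powers. Hence every coordinate moves by `O_p(√n h t^{p/2})` in these powers
(`IsPathPoint.drift`), and this is why the box `𝒩` is the right neighbourhood.

On the box the slopes of `f_{t'}'` lie between `w_i` and `κ w_i`, where `w` is the diagonal of `D_t`
(`weight_le_of_box`, `le_kappa_mul_weight_of_box`); the quadratic extension carries these bounds to
the whole line. Both preconditioners satisfy `P Pᵀ = (Aᵀ D_t A)†`, so on the range of `Pᵀ` the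
Euclidean norm is `Σ w_i (A P y)_i²`, and `g_t` is `1`-strongly convex and `κ`-smooth there. Since
`√κ = O_p(n^{|1/2-1/p|})` and accelerated gradient descent contracts a Lyapunov function by `1 -
1/√κ` per step, `O_p(n^{|1/2-1/p|} log n)` steps gain the polynomial factor in `n` and `p²/(p-1)`
that is needed. Because `x(t')` lies in the box, its preimage minimizes `g_t`; a small gap puts the
output within `t'^{p/2}/2` of `x(t')` in every coordinate, and the next phase can start
(`phase_spec`, `homotopy_invariant`).

Finally, `f_t - |·|^p` oscillates by at most `(p/2) t^p`, so near-minimizers of the smoothed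
objective are `n p t^p`-optimal, and `t_K^p ≤ e^{-K/2} t₀^p` since `h p = 1/2`. For the cost, a step
of the descent is written as loops of assignments over the coordinates and over `S`, compiled to
straight-line code with two preconditioner calls. -/

lemma hasDerivAt_of_glue {f f₁ f₂ : ℝ → ℝ} {c d : ℝ} (h₁ : ∀ s ≤ c, f s = f₁ s)
    (h₂ : ∀ s, c ≤ s → f s = f₂ s) (hf₁ : HasDerivAt f₁ d c) (hf₂ : HasDerivAt f₂ d c) :
    HasDerivAt f d c := by
  have hl : HasDerivWithinAt f d (Set.Iic c) c :=
    hf₁.hasDerivWithinAt.congr (fun s hs => h₁ s hs) (h₁ c le_rfl)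
  have hr : HasDerivWithinAt f d (Set.Ici c) c :=
    hf₂.hasDerivWithinAt.congr (fun s hs => h₂ s hs) (h₂ c le_rfl)
  have := hl.union hr
  rwa [Set.Iic_union_Ici, hasDerivWithinAt_univ] at this

lemma smooth'_eq {p t : ℝ} (s : ℝ) : smooth' p t s = p * max t |s| ^ (p - 2) * s := by
  unfold smooth'
  split_ifs with h
  · rw [max_eq_left h]
  · rw [max_eq_right (not_le.1 h).le]

lemma smooth_of_le {p t s : ℝ} (ht : 0 < t) (h : t ≤ |s|) :
    smooth p t s = |s| ^ p + (p / 2 - 1) * t ^ p := by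
  unfold smooth
  split_ifs with h'
  · have : |s| = t := le_antisymm h' h
    rw [← sq_abs s, this, Real.rpow_sub ht]
    have := ht.ne'
    norm_num
    field_simp
    ring
  · rfl

lemma smooth'_of_le {p t s : ℝ} (h : t ≤ |s|) :
    smooth' p t s = p * |s| ^ (p - 2) * s := by
  rw [smooth'_eq, max_eq_right h]

lemma hasDerivAt_smooth {p t : ℝ} (hp : 1 < p) (ht : 0 < t) (s : ℝ) :
    HasDerivAt (smooth p t) (smooth' p t s) s := by
  have hin : ∀ x, HasDerivAt (fun s => p / 2 * t ^ (p - 2) * s ^ 2) (p * t ^ (p - 2) * x) x := by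
    intro x
    exact ((hasDerivAt_pow 2 x).const_mul (p / 2 * t ^ (p - 2))).congr_deriv (by norm_num; ring)
  have hout : ∀ x, HasDerivAt (fun s => |s| ^ p + (p / 2 - 1) * t ^ p)
      (p * |x| ^ (p - 2) * x) x := fun x => (hasDerivAt_abs_rpow x hp).add_const _
  rcases lt_trichotomy |s| t with h | h | h
  · have hev : smooth p t =ᶠ[nhds s] fun s => p / 2 * t ^ (p - 2) * s ^ 2 := by
      filter_upwards [continuous_abs.continuousAt.eventually_lt continuousAt_const h] with x hx
      exact if_pos hx.le
    have hd : smooth' p t s = p * t ^ (p - 2) * s := if_pos h.le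
    rw [hd]
    exact (hin s).congr_of_eventuallyEq hev
  · have hd : smooth' p t s = p * t ^ (p - 2) * s := if_pos h.le
    have h0 : (0 : ℝ) < |s| := h ▸ ht
    -- At a gluing point the outer formula holds on the outer half-line, the quadratic one only on
    -- the compact interval up to the opposite gluing point. The union is still a neighbourhood of
    -- `s`.
    rcases (abs_pos.1 h0).lt_or_gt with hs | hs
    · rw [abs_of_neg hs] at h
      have hl : HasDerivWithinAt (smooth p t) (smooth' p t s) (Set.Iic s) s := by
        rw [smooth'_of_le (by rw [abs_of_neg hs]; exact h.ge)]
        refine (hout s).hasDerivWithinAt.congr (fun x hx => ?_) ?_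
        · exact smooth_of_le ht (by
            rw [abs_of_neg (lt_of_le_of_lt hx hs)]; linarith [Set.mem_Iic.1 hx])
        · exact smooth_of_le ht (by rw [abs_of_neg hs]; exact h.ge)
      have hr : HasDerivWithinAt (smooth p t) (smooth' p t s) (Set.Icc s t) s := by
        rw [hd]
        refine (hin s).hasDerivWithinAt.congr (fun x hx => ?_) ?_
        · exact if_pos (abs_le.2 ⟨by linarith [hx.1], hx.2⟩)
        · exact if_pos (by rw [abs_of_neg hs]; exact h.le)
      refine (hl.union hr).hasDerivAt ?_
      rw [Set.Iic_union_Icc_eq_Iic (by linarith)]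
      exact Iic_mem_nhds (by linarith)
    · rw [abs_of_pos hs] at h
      have hr : HasDerivWithinAt (smooth p t) (smooth' p t s) (Set.Ici s) s := by
        rw [smooth'_of_le (by rw [abs_of_pos hs]; exact h.ge)]
        refine (hout s).hasDerivWithinAt.congr (fun x hx => ?_) ?_
        · exact smooth_of_le ht (by
            rw [abs_of_pos (lt_of_lt_of_le hs hx)]; linarith [Set.mem_Ici.1 hx])
        · exact smooth_of_le ht (by rw [abs_of_pos hs]; exact h.ge)
      have hl : HasDerivWithinAt (smooth p t) (smooth' p t s) (Set.Icc (-t) s) s := by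
        rw [hd]
        refine (hin s).hasDerivWithinAt.congr (fun x hx => ?_) ?_
        · exact if_pos (abs_le.2 ⟨hx.1, by linarith [hx.2]⟩)
        · exact if_pos (by rw [abs_of_pos hs]; exact h.le)
      refine (hl.union hr).hasDerivAt ?_
      rw [Set.Icc_union_Ici_eq_Ici (by linarith)]
      exact Ici_mem_nhds (by linarith)
  · have hev : smooth p t =ᶠ[nhds s] fun s => |s| ^ p + (p / 2 - 1) * t ^ p := by
      filter_upwards [continuousAt_const.eventually_lt continuous_abs.continuousAt h] with x hx
      exact if_neg (not_le.2 hx)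
    rw [smooth'_of_le h.le]
    exact (hout s).congr_of_eventuallyEq hev

lemma continuous_smooth' {p t : ℝ} (ht : 0 < t) : Continuous (smooth' p t) := by
  have : smooth' p t = fun s => p * max t |s| ^ (p - 2) * s := funext smooth'_eq
  rw [this]
  refine (continuous_const.mul (Continuous.rpow_const (by fun_prop) fun s => Or.inl ?_)).mul
    continuous_id
  exact ne_of_gt (lt_max_of_lt_left ht)

/-- The right derivative of `f_t'`. -/
def smoothRight (p t s : ℝ) : ℝ :=
  if -t ≤ s ∧ s < t then p * t ^ (p - 2) else p * (p - 1) * |s| ^ (p - 2)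

/-- `f_t'` has corners at `±t`, but a right derivative exists everywhere: the inner slope at `-t`,
the outer one at `t`. One-sided derivatives suffice for the mean value inequalities below. -/
lemma hasDerivWithinAt_smooth' {p t : ℝ} (ht : 0 < t) (s : ℝ) :
    HasDerivWithinAt (smooth' p t) (smoothRight p t s) (Set.Ici s) s := by
  have hrp : ∀ x : ℝ, 0 < x →
      HasDerivAt (fun s : ℝ => p * s ^ (p - 1)) (p * (p - 1) * x ^ (p - 2)) x := by
    intro x hx
    refine ((Real.hasDerivAt_rpow_const (x := x) (p := p - 1) (Or.inl hx.ne')).const_mul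
      p).congr_deriv ?_
    rw [show p - 1 - 1 = p - 2 by ring]; ring
  have hmul : ∀ x : ℝ, 0 < x → x ^ (p - 2) * x = x ^ (p - 1) := by
    intro x hx
    rw [show p - 1 = p - 2 + 1 by ring, Real.rpow_add_one hx.ne']
  unfold smoothRight
  split_ifs with h
  · have h1 : HasDerivWithinAt (smooth' p t) (p * t ^ (p - 2)) (Set.Icc s t) s := by
      have : HasDerivAt (fun s => p * t ^ (p - 2) * s) (p * t ^ (p - 2)) s := by
        simpa using (hasDerivAt_id s).const_mul (p * t ^ (p - 2))
      refine this.hasDerivWithinAt.congr (fun x hx => ?_) ?_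
      · exact if_pos (abs_le.2 ⟨by linarith [hx.1, h.1], hx.2⟩)
      · exact if_pos (abs_le.2 ⟨h.1, h.2.le⟩)
    exact h1.mono_of_mem_nhdsWithin (Icc_mem_nhdsGE h.2)
  · rw [not_and_or, not_le, not_lt] at h
    rcases h with h | h
    · have hs : s < 0 := by linarith
      have : HasDerivAt (fun s : ℝ => -(p * (-s) ^ (p - 1))) (p * (p - 1) * |s| ^ (p - 2)) s := by
        have := (HasDerivAt.comp s (hrp (-s) (by linarith)) (hasDerivAt_neg s)).neg
        rw [abs_of_neg hs]
        exact this.congr_deriv (by ring)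
      refine (this.congr_of_eventuallyEq ?_).hasDerivWithinAt
      filter_upwards [Iio_mem_nhds h] with x hx
      have hx' : x < 0 := by linarith [Set.mem_Iio.1 hx]
      rw [smooth'_of_le (by rw [abs_of_neg hx']; linarith [Set.mem_Iio.1 hx]), abs_of_neg hx',
        ← hmul (-x) (by linarith)]
      ring
    · have hs : 0 < s := by linarith
      rw [abs_of_pos hs]
      refine (hrp s hs).hasDerivWithinAt.congr (fun x hx => ?_) ?_
      · have hx' : 0 < x := by linarith [Set.mem_Ici.1 hx]
        rw [smooth'_of_le (by rw [abs_of_pos hx']; linarith [Set.mem_Ici.1 hx]), abs_of_pos hx',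
          ← hmul x hx']
        ring
      · rw [smooth'_of_le (by rw [abs_of_pos hs]; exact h), abs_of_pos hs, ← hmul s hs]
        ring

/-- Relative to `max t |s| ^ (p - 2)` the slope is `p` inside and `p (p - 1)` outside, so the common
bounds are `p` times the minimum and the maximum of `1` and `p - 1`. -/
lemma smoothRight_bounds {p t : ℝ} (hp : 1 < p) (ht : 0 < t) (s : ℝ) :
    p * min 1 (p - 1) * max t |s| ^ (p - 2) ≤ smoothRight p t s ∧
      smoothRight p t s ≤ p * max 1 (p - 1) * max t |s| ^ (p - 2) := by
  have hm : 0 < max t |s| ^ (p - 2) := Real.rpow_pos_of_pos (lt_max_of_lt_left ht) _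
  unfold smoothRight
  split_ifs with h
  · have : |s| ≤ t := abs_le.2 ⟨h.1, h.2.le⟩
    rw [max_eq_left this] at hm ⊢
    constructor
    · gcongr
      nlinarith [min_le_left 1 (p - 1)]
    · gcongr
      nlinarith [le_max_left 1 (p - 1)]
  · have : t ≤ |s| := by
      rw [not_and_or, not_le, not_lt] at h
      rcases h with h | h
      · rw [abs_of_neg (by linarith)]; linarith
      · exact h.trans (le_abs_self s)
    rw [max_eq_right this] at hm ⊢
    constructor
    · gcongr
      exact min_le_right _ _
    · gcongr
      exact le_max_right _ _

lemma smooth''_bounds {p t : ℝ} (hp : 1 < p) (s : ℝ) (ht : 0 < t) :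
    p * min 1 (p - 1) * max t |s| ^ (p - 2) ≤ smooth'' p t s ∧
      smooth'' p t s ≤ p * max 1 (p - 1) * max t |s| ^ (p - 2) := by
  have hm : 0 < max t |s| ^ (p - 2) := Real.rpow_pos_of_pos (lt_max_of_lt_left ht) _
  unfold smooth''
  split_ifs with h
  · rw [max_eq_left h] at hm ⊢
    constructor
    · gcongr
      nlinarith [min_le_left 1 (p - 1)]
    · gcongr
      nlinarith [le_max_left 1 (p - 1)]
  · rw [max_eq_right (not_le.1 h).le] at hm ⊢
    constructor
    · gcongr
      exact min_le_right _ _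
    · gcongr
      exact le_max_right _ _

lemma le_smooth'_sub {p t m a b : ℝ} (hp : 1 < p) (ht : 0 < t) (hab : a ≤ b)
    (h : ∀ x ∈ Set.Icc a b, m ≤ p * min 1 (p - 1) * max t |x| ^ (p - 2)) :
    m * (b - a) ≤ smooth' p t b - smooth' p t a := by
  have := image_le_of_deriv_right_le_deriv_boundary (f := fun x => m * (x - a)) (f' := fun _ => m)
    (B := fun x => smooth' p t x - smooth' p t a) (B' := smoothRight p t) (a := a) (b := b)
    (by fun_prop) (fun x _ => by
      simpa using (((hasDerivAt_id x).sub_const a).const_mul m).hasDerivWithinAt) (by simp)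
    ((continuous_smooth' ht).sub continuous_const).continuousOn
    (fun x _ => (hasDerivWithinAt_smooth' ht x).sub_const _)
    (fun x hx => (h x ⟨hx.1, hx.2.le⟩).trans (smoothRight_bounds hp ht x).1)
  exact this ⟨hab, le_rfl⟩

lemma smooth'_sub_le {p t L a b : ℝ} (hp : 1 < p) (ht : 0 < t) (hab : a ≤ b)
    (h : ∀ x ∈ Set.Icc a b, p * max 1 (p - 1) * max t |x| ^ (p - 2) ≤ L) :
    smooth' p t b - smooth' p t a ≤ L * (b - a) := by
  have := image_le_of_deriv_right_le_deriv_boundary (B := fun x => L * (x - a)) (B' := fun _ => L)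
    (f := fun x => smooth' p t x - smooth' p t a) (f' := smoothRight p t) (a := a) (b := b)
    ((continuous_smooth' ht).sub continuous_const).continuousOn
    (fun x _ => (hasDerivWithinAt_smooth' ht x).sub_const _) (by simp)
    (by fun_prop) (fun x _ => by
      simpa using (((hasDerivAt_id x).sub_const a).const_mul L).hasDerivWithinAt)
    (fun x hx => (smoothRight_bounds hp ht x).2.trans (h x ⟨hx.1, hx.2.le⟩))
  exact this ⟨hab, le_rfl⟩

/-- A function whose derivative has slopes at least `μ` lies above its quadratic minorants. -/
lemma quadratic_le {F e : ℝ → ℝ} {μ : ℝ} (hF : ∀ s, HasDerivAt F (e s) s)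
    (he : ∀ a b, a ≤ b → μ * (b - a) ≤ e b - e a) (a b : ℝ) :
    F a + e a * (b - a) + μ / 2 * (b - a) ^ 2 ≤ F b := by
  have hG : ∀ s, HasDerivAt (fun s => F s - e a * (s - a) - μ / 2 * (s - a) ^ 2)
      (e s - e a - μ * (s - a)) s := by
    intro s
    have h1 := ((hasDerivAt_id s).sub_const a).const_mul (e a)
    have h2 := (((hasDerivAt_id s).sub_const a).pow 2).const_mul (μ / 2)
    exact (((hF s).sub h1).sub h2).congr_deriv (by simp; ring)
  have hc : Continuous (fun s => F s - e a * (s - a) - μ / 2 * (s - a) ^ 2) :=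
    continuous_iff_continuousAt.2 fun s => (hG s).continuousAt
  rcases lt_trichotomy a b with h | h | h
  · obtain ⟨ξ, hξ, h'⟩ := exists_hasDerivAt_eq_slope _ _ h hc.continuousOn fun x _ => hG x
    rw [eq_div_iff (by linarith)] at h'
    have := he a ξ hξ.1.le
    nlinarith
  · simp [h]
  · obtain ⟨ξ, hξ, h'⟩ := exists_hasDerivAt_eq_slope _ _ h hc.continuousOn fun x _ => hG x
    rw [eq_div_iff (by linarith)] at h'
    have := he ξ a hξ.2.le
    nlinarith

lemma le_quadratic {F e : ℝ → ℝ} {L : ℝ} (hF : ∀ s, HasDerivAt F (e s) s)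
    (he : ∀ a b, a ≤ b → e b - e a ≤ L * (b - a)) (a b : ℝ) :
    F b ≤ F a + e a * (b - a) + L / 2 * (b - a) ^ 2 := by
  have := quadratic_le (F := fun s => -F s) (e := fun s => -e s) (μ := -L) (fun s => (hF s).neg)
    (fun a b h => by linarith [he a b h]) a b
  linarith

lemma smooth'_mono {p t a b : ℝ} (hp : 1 < p) (ht : 0 < t) (hab : a ≤ b) :
    0 ≤ smooth' p t b - smooth' p t a := by
  have := le_smooth'_sub (m := 0) hp ht hab fun x _ => by
    have : 0 < max t |x| ^ (p - 2) := Real.rpow_pos_of_pos (lt_max_of_lt_left ht) _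
    have : 0 < min 1 (p - 1) := lt_min one_pos (by linarith)
    positivity
  simpa using this

lemma smooth_convex {p t : ℝ} (hp : 1 < p) (ht : 0 < t) (a b : ℝ) :
    smooth p t a + smooth' p t a * (b - a) ≤ smooth p t b := by
  have := quadratic_le (μ := 0) (hasDerivAt_smooth hp ht)
    (fun a b h => by simpa using smooth'_mono hp ht h) a b
  linarith

/-! ### Signed powers -/

lemma spow_of_nonneg {s q : ℝ} (hq : q ≠ 0) (hs : 0 ≤ s) : spow s q = s ^ q := by
  unfold spow
  rcases hs.eq_or_lt with rfl | h
  · simp [Real.zero_rpow hq]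
  · rw [sign_pos h, abs_of_pos h]; simp

lemma spow_neg (s q : ℝ) : spow (-s) q = -spow s q := by
  unfold spow
  rw [Left.sign_neg, abs_neg]
  simp

lemma abs_spow {s q : ℝ} (hq : q ≠ 0) : |spow s q| = |s| ^ q := by
  rcases le_total 0 s with h | h
  · rw [spow_of_nonneg hq h, abs_of_nonneg (Real.rpow_nonneg h _), abs_of_nonneg h]
  · have : s = -(-s) := by ring
    rw [this, spow_neg, abs_neg, spow_of_nonneg hq (by linarith), abs_neg,
      abs_of_nonneg (Real.rpow_nonneg (by linarith) _), abs_of_nonneg (a := -s) (by linarith)]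

lemma spow_mono {q a b : ℝ} (hq : 0 < q) (hab : a ≤ b) : spow a q ≤ spow b q := by
  rcases le_total 0 a with ha | ha
  · rw [spow_of_nonneg hq.ne' ha, spow_of_nonneg hq.ne' (ha.trans hab)]
    gcongr
  · have ha' : spow a q = -((-a) ^ q) := by
      rw [← spow_of_nonneg hq.ne' (by linarith), spow_neg, neg_neg]
    have h1 : (0 : ℝ) ≤ (-a) ^ q := Real.rpow_nonneg (by linarith) _
    rcases le_total 0 b with hb | hb
    · rw [ha', spow_of_nonneg hq.ne' hb]
      linarith [Real.rpow_nonneg hb q]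
    · have hb' : spow b q = -((-b) ^ q) := by
        rw [← spow_of_nonneg hq.ne' (by linarith), spow_neg, neg_neg]
      rw [ha', hb']
      have : (-b) ^ q ≤ (-a) ^ q := Real.rpow_le_rpow (by linarith) (by linarith) hq.le
      linarith

lemma spow_spow {q q' : ℝ} (hq : 0 < q) (hqq : q * q' = 1) (s : ℝ) : spow (spow s q) q' = s := by
  have hq' : 0 < q' := by
    by_contra h
    nlinarith [not_lt.1 h]
  have key : ∀ s : ℝ, 0 ≤ s → spow (spow s q) q' = s := by
    intro s hs
    rw [spow_of_nonneg hq.ne' hs, spow_of_nonneg hq'.ne' (Real.rpow_nonneg hs _),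
      ← Real.rpow_mul hs, hqq, Real.rpow_one]
  rcases le_total 0 s with h | h
  · exact key s h
  · have := key (-s) (by linarith)
    rw [spow_neg, spow_neg] at this
    linarith

lemma lower_le_iff {p γ s x : ℝ} (hp : 1 < p) :
    lower p γ s ≤ x ↔ spow s (p / 2) - γ ≤ spow x (p / 2) := by
  unfold lower
  have h1 : p / 2 * (2 / p) = 1 := by field_simp
  have h2 : 2 / p * (p / 2) = 1 := by field_simp
  constructor
  · intro h
    have := spow_mono (show 0 < p / 2 by linarith) h
    rwa [spow_spow (by positivity) h2] at this
  · intro h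
    have := spow_mono (show 0 < 2 / p by positivity) h
    rwa [spow_spow (by positivity) h1] at this

lemma le_upper_iff {p γ s x : ℝ} (hp : 1 < p) :
    x ≤ upper p γ s ↔ spow x (p / 2) ≤ spow s (p / 2) + γ := by
  unfold upper
  have h1 : p / 2 * (2 / p) = 1 := by field_simp
  have h2 : 2 / p * (p / 2) = 1 := by field_simp
  constructor
  · intro h
    have := spow_mono (show 0 < p / 2 by linarith) h
    rwa [spow_spow (by positivity) h2] at this
  · intro h
    have := spow_mono (show 0 < 2 / p by positivity) h
    rwa [spow_spow (by positivity) h1] at this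

lemma mem_box_iff {p γ s x : ℝ} (hp : 1 < p) :
    lower p γ s ≤ x ∧ x ≤ upper p γ s ↔ |spow x (p / 2) - spow s (p / 2)| ≤ γ := by
  rw [lower_le_iff hp, le_upper_iff hp, abs_le]
  constructor <;> rintro ⟨h1, h2⟩ <;> constructor <;> linarith

lemma lower_le_upper {p γ s : ℝ} (hp : 1 < p) (hγ : 0 ≤ γ) : lower p γ s ≤ upper p γ s :=
  spow_mono (show 0 < 2 / p by positivity) (by linarith)

/-- Reduction of symmetric statements about pairs of reals to `|b| ≤ a`. -/
lemma pair_induction {Q : ℝ → ℝ → Prop} (hsymm : ∀ a b, Q a b → Q b a)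
    (hneg : ∀ a b, Q a b → Q (-a) (-b)) (hmain : ∀ a b, |b| ≤ a → Q a b) (a b : ℝ) : Q a b := by
  have key : ∀ a b, |b| ≤ |a| → Q a b := by
    intro a b h
    rcases le_total 0 a with ha | ha
    · exact hmain a b (by rwa [abs_of_nonneg ha] at h)
    · have := hneg _ _ (hmain (-a) (-b) (by rwa [abs_neg, ← abs_of_nonpos ha]))
      simpa using this
  rcases le_total |b| |a| with h | h
  · exact key a b h
  · exact hsymm _ _ (key b a h)

lemma rpow_sub_one_mul {r a : ℝ} (hr : 0 < r) (ha : 0 ≤ a) : a ^ (r - 1) * a = a ^ r := by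
  rcases ha.eq_or_lt with rfl | ha
  · simp [Real.zero_rpow hr.ne']
  · rw [← Real.rpow_add_one ha.ne', sub_add_cancel]

/-- By symmetry `|b| ≤ a`. For equal signs use the mean value theorem if `r ≥ 1` and `a^{r-1} b ≤
b^r` if `r ≤ 1`. For opposite signs each power is at most `a^r ≤ a^{r-1}(a - b)`, which costs the
factor `2`. With `r = p/2` this and the next lemma compare differences of `p/2`-th powers with the
energy `M^{p-2}(a-b)²`. -/
lemma abs_spow_sub_le {r : ℝ} (hr : 0 < r) (a b : ℝ) :
    |spow a r - spow b r| ≤ max 2 r * max |a| |b| ^ (r - 1) * |a - b| := by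
  revert a b
  refine pair_induction (fun a b h => ?_) (fun a b h => ?_) fun a b h => ?_
  · rwa [abs_sub_comm, max_comm |b|, abs_sub_comm b]
  · rw [spow_neg, spow_neg, abs_neg, abs_neg, ← abs_neg (-a - -b)]
    rw [← abs_neg] at h
    convert h using 2 <;> ring_nf
  · have ha : 0 ≤ a := (abs_nonneg b).trans h
    rw [abs_of_nonneg ha, max_eq_left h]
    have hba := abs_le.1 h
    have h0 : 0 ≤ a ^ (r - 1) := Real.rpow_nonneg ha _
    have hsub : 0 ≤ a - b := by linarith
    rw [abs_of_nonneg hsub, abs_of_nonneg (sub_nonneg.2 (spow_mono hr hba.2)),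
      spow_of_nonneg hr.ne' ha]
    have hmulr := rpow_sub_one_mul hr ha
    rcases le_total 0 b with hb | hb
    · rw [spow_of_nonneg hr.ne' hb]
      rcases le_total r 1 with hr1 | hr1
      · have : a ^ r - b ^ r ≤ a ^ (r - 1) * (a - b) := by
          have : a ^ (r - 1) * b ≤ b ^ r := by
            rcases hb.eq_or_lt with rfl | hb'
            · simp [Real.zero_rpow hr.ne']
            rw [← rpow_sub_one_mul hr hb]
            have := Real.rpow_le_rpow_of_nonpos hb' hba.2 (show r - 1 ≤ 0 by linarith)
            gcongr
          linarith
        refine this.trans ?_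
        rw [mul_assoc]
        have := le_max_left 2 r
        nlinarith [mul_nonneg h0 hsub]
      · have : a ^ r - b ^ r ≤ r * a ^ (r - 1) * (a - b) := by
          have hF : ∀ s, 0 ≤ s → HasDerivAt (fun s : ℝ => s ^ r) (r * s ^ (r - 1)) s :=
            fun s _ => Real.hasDerivAt_rpow_const (Or.inr hr1)
          rcases hba.2.eq_or_lt with rfl | hlt
          · simp
          have hc : Continuous fun s : ℝ => s ^ r := Real.continuous_rpow_const hr.le
          obtain ⟨ξ, hξ, h'⟩ := exists_hasDerivAt_eq_slope _ _ hlt hc.continuousOn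
            fun x hx => hF x (hb.trans hx.1.le)
          rw [eq_div_iff (by linarith)] at h'
          rw [← h']
          have : ξ ^ (r - 1) ≤ a ^ (r - 1) :=
            Real.rpow_le_rpow (hb.trans hξ.1.le) hξ.2.le (by linarith)
          gcongr
        refine this.trans ?_
        rw [mul_assoc, mul_assoc]
        have := le_max_right 2 r
        gcongr
    · have hb' : spow b r = -((-b) ^ r) := by
        rw [← spow_of_nonneg hr.ne' (by linarith), spow_neg, neg_neg]
      have h1 : (-b) ^ r ≤ a ^ r := Real.rpow_le_rpow (by linarith) (by linarith) hr.le
      rw [hb', mul_assoc]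
      have h2 : a ^ r ≤ a ^ (r - 1) * (a - b) := by nlinarith
      have := le_max_left 2 r
      nlinarith [mul_nonneg h0 hsub]

/-- The factor `1/2` is needed twice: the mean value theorem gives `r ≥ 1/2` when `r ≤ 1`, and for
opposite signs `a - b ≤ 2a`. The condition on `r = p/2` is guaranteed by `p > 1`. -/
lemma le_abs_spow_sub {r : ℝ} (hr : 1 / 2 ≤ r) (a b : ℝ) :
    1 / 2 * max |a| |b| ^ (r - 1) * |a - b| ≤ |spow a r - spow b r| := by
  have hr0 : 0 < r := by linarith
  revert a b
  refine pair_induction (fun a b h => ?_) (fun a b h => ?_) fun a b h => ?_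
  · rwa [abs_sub_comm, max_comm |b|, abs_sub_comm (spow b r)]
  · rw [spow_neg, spow_neg, abs_neg, abs_neg, ← abs_neg (-a - -b)]
    rw [← abs_neg (spow a r - spow b r)] at h
    convert h using 2 <;> ring_nf
  · have ha : 0 ≤ a := (abs_nonneg b).trans h
    rw [abs_of_nonneg ha, max_eq_left h]
    have hba := abs_le.1 h
    have h0 : 0 ≤ a ^ (r - 1) := Real.rpow_nonneg ha _
    have hsub : 0 ≤ a - b := by linarith
    rw [abs_of_nonneg hsub, abs_of_nonneg (sub_nonneg.2 (spow_mono hr0 hba.2)),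
      spow_of_nonneg hr0.ne' ha]
    have hmulr := rpow_sub_one_mul hr0 ha
    rcases le_total 0 b with hb | hb
    · rw [spow_of_nonneg hr0.ne' hb]
      rcases le_total r 1 with hr1 | hr1
      · have : r * a ^ (r - 1) * (a - b) ≤ a ^ r - b ^ r := by
          rcases hba.2.eq_or_lt with rfl | hlt
          · simp
          have hc : Continuous fun s : ℝ => s ^ r := Real.continuous_rpow_const hr0.le
          obtain ⟨ξ, hξ, h'⟩ := exists_hasDerivAt_eq_slope _ _ hlt hc.continuousOn
            fun x hx => Real.hasDerivAt_rpow_const (p := r) (Or.inl (hb.trans_lt hx.1).ne')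
          rw [eq_div_iff (by linarith)] at h'
          rw [← h']
          have : a ^ (r - 1) ≤ ξ ^ (r - 1) :=
            Real.rpow_le_rpow_of_nonpos (hb.trans_lt hξ.1) hξ.2.le (by linarith)
          gcongr
        refine le_trans ?_ this
        gcongr
      · have : b ^ r ≤ a ^ (r - 1) * b := by
          rw [← rpow_sub_one_mul hr0 hb]
          have := Real.rpow_le_rpow hb hba.2 (show 0 ≤ r - 1 by linarith)
          gcongr
        nlinarith [mul_nonneg h0 hsub]
    · have hb' : spow b r = -((-b) ^ r) := by
        rw [← spow_of_nonneg hr0.ne' (by linarith), spow_neg, neg_neg]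
      have h1 : 0 ≤ (-b) ^ r := Real.rpow_nonneg (by linarith) _
      rw [hb', mul_assoc]
      have h2 : a ^ (r - 1) * (a - b) ≤ 2 * a ^ r := by nlinarith
      linarith

/-! ### Convergence of accelerated gradient descent -/

section AGD

variable {E : Type*} [NormedAddCommGroup E] [InnerProductSpace ℝ E] [CompleteSpace E]

/-- The Lyapunov function of accelerated gradient descent relative to a comparison point `w`. -/
def lyapunov (g : E → ℝ) (κ : ℝ) (w : E) (yz : E × E) : ℝ :=
  g yz.1 - g w + 1 / 2 * ‖yz.2 + √κ • (yz.2 - yz.1) - w‖ ^ 2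

/-- Put `θ = 1/√κ` and `v = z + (z - y)/θ`. After the step, `v - w` becomes a convex combination of
`v - w` and `z - w`, shifted by `-θ G`. Its squared norm is bounded by convexity; the cross term
with `G` cancels against `(1-θ)` times the inequality at `y` plus `θ` times the one at `w`, and the
term `θ² ‖G‖²/2` against the decrease of `g`. -/
lemma lyapunov_agdStep_le {g : E → ℝ} {κ : ℝ} (hκ : 1 ≤ κ) {w y z : E}
    (hy : g z + inner ℝ (gradient g z) (y - z) ≤ g y)
    (hw : g z + inner ℝ (gradient g z) (w - z) + 1 / 2 * ‖w - z‖ ^ 2 ≤ g w)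
    (hstep : g (z - (1 / κ) • gradient g z) ≤ g z - 1 / (2 * κ) * ‖gradient g z‖ ^ 2) :
    lyapunov g κ w (agdStep g κ (y, z)) ≤ (1 - 1 / √κ) * lyapunov g κ w (y, z) := by
  set G := gradient g z with hG
  obtain ⟨θ, hθ0, hθ1, hθ⟩ : ∃ θ : ℝ, 0 < θ ∧ θ ≤ 1 ∧ √κ = 1 / θ := by
    have h1 : 1 ≤ √κ := Real.one_le_sqrt.2 hκ
    exact ⟨1 / √κ, by positivity, by rw [div_le_one (by linarith)]; exact h1, by simp⟩
  have hκθ : κ = 1 / θ ^ 2 := by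
    rw [← Real.sq_sqrt (show 0 ≤ κ by linarith), hθ]; field_simp
  have e1 : (1 / κ) = θ ^ 2 := by rw [hκθ]; field_simp
  have e2 : 1 / (2 * κ) = θ ^ 2 / 2 := by rw [hκθ]; field_simp
  have e3 : (√κ - 1) / (√κ + 1) = (1 - θ) / (1 + θ) := by rw [hθ]; field_simp
  rw [e1, e2] at hstep
  unfold lyapunov agdStep
  simp only [← hG]
  rw [e3, e1, hθ]
  set v := z + (1 / θ) • (z - y) with hv
  have hvnew : z - θ ^ 2 • G + ((1 - θ) / (1 + θ)) • (z - θ ^ 2 • G - y) +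
      (1 / θ) • (z - θ ^ 2 • G + ((1 - θ) / (1 + θ)) • (z - θ ^ 2 • G - y) - (z - θ ^ 2 • G)) - w =
      ((1 - θ) • (v - w) + θ • (z - w)) - θ • G := by
    rw [hv]
    match_scalars <;> field_simp <;> ring
  rw [hvnew]
  have hcomb : ‖(1 - θ) • (v - w) + θ • (z - w)‖ ^ 2 ≤ (1 - θ) * ‖v - w‖ ^ 2 + θ * ‖z - w‖ ^ 2 := by
    rw [norm_add_sq_real, norm_smul, norm_smul, inner_smul_left, inner_smul_right]
    have := norm_sub_sq_real (v - w) (z - w)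
    simp only [Real.norm_eq_abs, mul_pow, sq_abs, RCLike.conj_to_real]
    nlinarith [sq_nonneg ‖(v - w) - (z - w)‖, mul_nonneg hθ0.le (sub_nonneg.2 hθ1)]
  rw [norm_sub_sq_real, norm_smul, inner_smul_right]
  -- All terms linear in `G` cancel because the vectors paired with it sum to zero; the momentum
  -- coefficient is chosen for this.
  have hlin : (1 - θ) * inner ℝ G (y - z) + θ * inner ℝ G (w - z) +
      θ * inner ℝ ((1 - θ) • (v - w) + θ • (z - w)) G = 0 := by
    rw [real_inner_comm G, ← inner_smul_right, ← inner_smul_right, ← inner_smul_right,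
      ← inner_add_right, ← inner_add_right]
    have : (1 - θ) • (y - z) + θ • (w - z) + θ • ((1 - θ) • (v - w) + θ • (z - w)) = 0 := by
      rw [hv]
      match_scalars <;> field_simp <;> ring
    rw [this, inner_zero_right]
  rw [norm_sub_rev w z] at hw
  have hn : ‖θ‖ = θ := abs_of_pos hθ0
  have h1θ : 1 - 1 / (1 / θ) = 1 - θ := by field_simp
  rw [hn, h1θ]
  have hy' := mul_le_mul_of_nonneg_left hy (sub_nonneg.2 hθ1)
  have hw' := mul_le_mul_of_nonneg_left hw hθ0.le
  nlinarith

/-- Linear convergence of accelerated gradient descent for a function that is `1`-strongly convex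
and `κ`-smooth on a subspace containing the iterates. -/
lemma agd_sub_le {g : E → ℝ} {κ : ℝ} (hκ : 1 ≤ κ) (V : Submodule ℝ E)
    (hV : ∀ z ∈ V, gradient g z ∈ V)
    (hlow : ∀ z ∈ V, ∀ u ∈ V, g z + inner ℝ (gradient g z) (u - z) + 1 / 2 * ‖u - z‖ ^ 2 ≤ g u)
    (hup : ∀ z ∈ V, ∀ u ∈ V, g u ≤ g z + inner ℝ (gradient g z) (u - z) + κ / 2 * ‖u - z‖ ^ 2)
    {w y₀ : E} (hw : w ∈ V) (hy₀ : y₀ ∈ V)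
    (hmin : g w ≤ g y₀) (T : ℕ) :
    agd g κ T y₀ ∈ V ∧ g (agd g κ T y₀) - g w ≤
      Real.exp (-(T / √κ)) * (g y₀ - g w + 1 / 2 * ‖y₀ - w‖ ^ 2) := by
  have hsq : 1 ≤ √κ := Real.one_le_sqrt.2 hκ
  have hρ : 0 ≤ 1 - 1 / √κ := by
    rw [sub_nonneg, div_le_one (by linarith)]; exact hsq
  have key : ∀ T : ℕ, ((agdStep g κ)^[T] (y₀, y₀)).1 ∈ V ∧ ((agdStep g κ)^[T] (y₀, y₀)).2 ∈ V ∧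
      lyapunov g κ w ((agdStep g κ)^[T] (y₀, y₀)) ≤
        (1 - 1 / √κ) ^ T * (g y₀ - g w + 1 / 2 * ‖y₀ - w‖ ^ 2) := by
    intro T
    induction T with
    | zero => simp [lyapunov, hy₀]
    | succ k ih =>
      rw [Function.iterate_succ_apply']
      obtain ⟨h1, h2, h3⟩ := ih
      set yz := (agdStep g κ)^[k] (y₀, y₀)
      have hG := hV _ h2
      have hy' : yz.2 - (1 / κ) • gradient g yz.2 ∈ V := V.sub_mem h2 (V.smul_mem _ hG)
      refine ⟨hy', V.add_mem hy' (V.smul_mem _ (V.sub_mem hy' h1)), ?_⟩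
      have := lyapunov_agdStep_le (g := g) hκ (w := w) (y := yz.1) (z := yz.2)
        (by nlinarith [hlow _ h2 _ h1, sq_nonneg ‖yz.1 - yz.2‖]) (hlow _ h2 _ hw) (by
          refine (hup _ h2 _ hy').trans (le_of_eq ?_)
          rw [sub_sub_cancel_left, inner_neg_right, inner_smul_right, norm_neg, norm_smul,
            real_inner_self_eq_norm_sq, Real.norm_of_nonneg (by positivity)]
          field_simp; ring)
      refine this.trans ?_
      rw [pow_succ', mul_assoc]
      exact mul_le_mul_of_nonneg_left h3 hρ
  obtain ⟨h1, -, h3⟩ := key T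
  refine ⟨h1, ?_⟩
  have hle : g (agd g κ T y₀) - g w ≤
      (1 - 1 / √κ) ^ T * (g y₀ - g w + 1 / 2 * ‖y₀ - w‖ ^ 2) := by
    refine le_trans ?_ h3
    unfold lyapunov agd
    have := sq_nonneg ‖((agdStep g κ)^[T] (y₀, y₀)).2 +
      √κ • (((agdStep g κ)^[T] (y₀, y₀)).2 - ((agdStep g κ)^[T] (y₀, y₀)).1) - w‖
    linarith
  have hexp : (1 - 1 / √κ) ^ T ≤ Real.exp (-(T / √κ)) := by
    have : 1 - 1 / √κ ≤ Real.exp (-(1 / √κ)) := by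
      have := Real.add_one_le_exp (-(1 / √κ)); linarith
    calc (1 - 1 / √κ) ^ T ≤ Real.exp (-(1 / √κ)) ^ T := pow_le_pow_left₀ hρ this T
      _ = _ := by rw [← Real.exp_nat_mul]; congr 1; ring
  refine hle.trans (mul_le_mul_of_nonneg_right hexp ?_)
  have := sq_nonneg ‖y₀ - w‖
  linarith

end AGD

/-! ### The quadratic extension -/

lemma hasDerivAt_piecewise {f f₁ f₂ f₁' f₂' : ℝ → ℝ} {c : ℝ} (h₁ : ∀ s ≤ c, f s = f₁ s)
    (h₂ : ∀ s, c ≤ s → f s = f₂ s) (hf₁ : ∀ s, HasDerivAt f₁ (f₁' s) s)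
    (hf₂ : ∀ s, HasDerivAt f₂ (f₂' s) s) (hc : f₁' c = f₂' c) (s : ℝ) :
    (s ≤ c → HasDerivAt f (f₁' s) s) ∧ (c ≤ s → HasDerivAt f (f₂' s) s) := by
  have heq : HasDerivAt f (f₁' c) c := hasDerivAt_of_glue h₁ h₂ (hf₁ c) (hc ▸ hf₂ c)
  constructor
  · intro h
    rcases h.eq_or_lt with rfl | h
    · exact heq
    · refine (hf₁ s).congr_of_eventuallyEq ?_
      filter_upwards [Iio_mem_nhds h] with x hx using h₁ x (le_of_lt hx)
  · intro h
    rcases h.eq_or_lt with rfl | h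
    · exact hc ▸ heq
    · refine (hf₂ s).congr_of_eventuallyEq ?_
      filter_upwards [Ioi_mem_nhds h] with x hx using h₂ x (le_of_lt hx)

/-- The nearest point of `[l, u]`. -/
def clamp (l u s : ℝ) : ℝ := if s ≤ l then l else if u ≤ s then u else s

/-- The derivative of the quadratic extension. -/
def extend' (p t l u s : ℝ) : ℝ :=
  smooth' p t (clamp l u s) + smooth'' p t (clamp l u s) * (s - clamp l u s)

lemma hasDerivAt_taylor (p t u s : ℝ) :
    HasDerivAt (fun s => smooth p t u + smooth' p t u * (s - u) +
      1 / 2 * smooth'' p t u * (s - u) ^ 2) (smooth' p t u + smooth'' p t u * (s - u)) s := by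
  have h1 := ((hasDerivAt_id s).sub_const u).const_mul (smooth' p t u)
  have h2 := (((hasDerivAt_id s).sub_const u).pow 2).const_mul (1 / 2 * smooth'' p t u)
  exact ((h1.const_add (smooth p t u)).add h2).congr_deriv (by simp; ring)

lemma clamp_of_le {l u s : ℝ} (h : s ≤ l) : clamp l u s = l := if_pos h

lemma clamp_of_ge {l u s : ℝ} (hlu : l ≤ u) (h : u ≤ s) : clamp l u s = u := by
  unfold clamp
  split_ifs with h'
  · linarith
  · rfl

lemma clamp_of_mem {l u s : ℝ} (h1 : l ≤ s) (h2 : s ≤ u) : clamp l u s = s := by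
  unfold clamp
  split_ifs <;> linarith

lemma hasDerivAt_extend {p t l u : ℝ} (hp : 1 < p) (ht : 0 < t) (hlu : l ≤ u) (s : ℝ) :
    HasDerivAt (extend p t l u) (extend' p t l u s) s := by
  -- Two gluings: first `f_t` with its Taylor polynomial at `u`, then the result with the Taylor
  -- polynomial at `l`.
  have key := hasDerivAt_piecewise (c := u)
    (f := fun s => if s ≤ u then smooth p t s else
      smooth p t u + smooth' p t u * (s - u) + 1 / 2 * smooth'' p t u * (s - u) ^ 2)
    (fun s hs => if_pos hs) (fun s hs => by
      rcases hs.eq_or_lt with rfl | hs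
      · simp
      · exact if_neg (not_le.2 hs))
    (hasDerivAt_smooth hp ht) (hasDerivAt_taylor p t u) (by simp)
  have key2 := hasDerivAt_piecewise (c := l) (f := extend p t l u)
    (f₂ := fun s => if s ≤ u then smooth p t s else
      smooth p t u + smooth' p t u * (s - u) + 1 / 2 * smooth'' p t u * (s - u) ^ 2)
    (f₂' := fun s => if s ≤ u then smooth' p t s else
      smooth' p t u + smooth'' p t u * (s - u))
    (fun s hs => by
      rcases hs.eq_or_lt with rfl | hs
      · simp [extend, hlu]
      · unfold extend
        rw [if_neg (fun h => by linarith [h.1]), if_neg (by linarith)])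
    (fun s hs => by
      unfold extend
      by_cases h : s ≤ u
      · simp [h, hs]
      · have h' : u ≤ s := le_of_not_ge h
        simp [h, h'])
    (hasDerivAt_taylor p t l) (fun s => by
      by_cases h : s ≤ u
      · simpa only [if_pos h] using (key s).1 h
      · simpa only [if_neg h] using (key s).2 (le_of_not_ge h)) (by simp [hlu])
  unfold extend'
  rcases le_total s l with h | h
  · rw [clamp_of_le h]
    exact (key2 s).1 h
  · have := (key2 s).2 h
    rcases le_total s u with h' | h'
    · rw [if_pos h'] at this
      rw [clamp_of_mem h h']
      simpa using this
    · rw [clamp_of_ge hlu h']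
      convert this using 1
      split_ifs with h''
      · rw [le_antisymm h'' h']; simp
      · rfl

lemma extend_of_mem {p t l u s : ℝ} (h : l ≤ s ∧ s ≤ u) : extend p t l u s = smooth p t s :=
  if_pos h

lemma extend'_of_mem {p t l u s : ℝ} (h : l ≤ s ∧ s ≤ u) : extend' p t l u s = smooth' p t s := by
  unfold extend'
  rw [clamp_of_mem h.1 h.2]
  simp

/-- Outside `[l, u]` the slope is `f_t''(l)` or `f_t''(u)`, which obeys the same bounds as the right
derivative. Thus a bound known on the box alone becomes global, which is the purpose of the
extension. -/
lemma le_extend'_sub {p t l u m : ℝ} (hp : 1 < p) (ht : 0 < t) (hlu : l ≤ u)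
    (hm : ∀ x ∈ Set.Icc l u, m ≤ p * min 1 (p - 1) * max t |x| ^ (p - 2)) (a b : ℝ) (hab : a ≤ b) :
    m * (b - a) ≤ extend' p t l u b - extend' p t l u a := by
  have hl := (hm l ⟨le_rfl, hlu⟩).trans (smooth''_bounds hp l ht).1
  have hu := (hm u ⟨hlu, le_rfl⟩).trans (smooth''_bounds hp u ht).1
  have key : ∀ a b, l ≤ a → a ≤ b → b ≤ u → m * (b - a) ≤ smooth' p t b - smooth' p t a :=
    fun a b h1 h2 h3 => le_smooth'_sub hp ht h2 fun x hx => hm x ⟨h1.trans hx.1, hx.2.trans h3⟩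
  unfold extend'
  rcases le_total b l with hb | hb
  · rw [clamp_of_le hb, clamp_of_le (hab.trans hb)]
    nlinarith
  rcases le_total u a with ha | ha
  · rw [clamp_of_ge hlu ha, clamp_of_ge hlu (ha.trans hab)]
    nlinarith
  rcases le_total a l with ha' | ha' <;> rcases le_total b u with hb' | hb'
  · rw [clamp_of_le ha', clamp_of_mem hb hb']
    nlinarith [key l b le_rfl hb hb']
  · rw [clamp_of_le ha', clamp_of_ge hlu hb']
    nlinarith [key l u le_rfl hlu le_rfl]
  · rw [clamp_of_mem ha' ha, clamp_of_mem hb hb']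
    nlinarith [key a b ha' hab hb']
  · rw [clamp_of_mem ha' ha, clamp_of_ge hlu hb']
    nlinarith [key a u ha' ha le_rfl]

lemma extend'_sub_le {p t l u L : ℝ} (hp : 1 < p) (ht : 0 < t) (hlu : l ≤ u)
    (hL : ∀ x ∈ Set.Icc l u, p * max 1 (p - 1) * max t |x| ^ (p - 2) ≤ L) (a b : ℝ) (hab : a ≤ b) :
    extend' p t l u b - extend' p t l u a ≤ L * (b - a) := by
  have hl := (smooth''_bounds hp l ht).2.trans (hL l ⟨le_rfl, hlu⟩)
  have hu := (smooth''_bounds hp u ht).2.trans (hL u ⟨hlu, le_rfl⟩)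
  have key : ∀ a b, l ≤ a → a ≤ b → b ≤ u → smooth' p t b - smooth' p t a ≤ L * (b - a) :=
    fun a b h1 h2 h3 => smooth'_sub_le hp ht h2 fun x hx => hL x ⟨h1.trans hx.1, hx.2.trans h3⟩
  unfold extend'
  rcases le_total b l with hb | hb
  · rw [clamp_of_le hb, clamp_of_le (hab.trans hb)]
    nlinarith
  rcases le_total u a with ha | ha
  · rw [clamp_of_ge hlu ha, clamp_of_ge hlu (ha.trans hab)]
    nlinarith
  rcases le_total a l with ha' | ha' <;> rcases le_total b u with hb' | hb'
  · rw [clamp_of_le ha', clamp_of_mem hb hb']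
    nlinarith [key l b le_rfl hb hb']
  · rw [clamp_of_le ha', clamp_of_ge hlu hb']
    nlinarith [key l u le_rfl hlu le_rfl]
  · rw [clamp_of_mem ha' ha, clamp_of_mem hb hb']
    nlinarith [key a b ha' hab hb']
  · rw [clamp_of_mem ha' ha, clamp_of_ge hlu hb']
    nlinarith [key a u ha' ha le_rfl]

/-! ### The weights -/

lemma stepH_pos {p : ℝ} (hp : 1 < p) : 0 < stepH p := by unfold stepH; positivity

lemma stepH_le {p : ℝ} (hp : 1 < p) : stepH p ≤ 1 / 2 := by
  unfold stepH
  rw [div_le_div_iff₀ (by linarith) (by norm_num)]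
  linarith

/-- Bernoulli with `h p = 1/2`: one phase shrinks `t^p` by no more than a factor `2`. -/
lemma half_le_rpow {p : ℝ} (hp : 1 < p) : 1 / 2 ≤ (1 - stepH p) ^ p := by
  have := one_add_mul_self_le_rpow_one_add (s := -stepH p) (p := p)
    (by linarith [stepH_le hp]) hp.le
  have h : p * -stepH p = -(1 / 2) := by unfold stepH; field_simp
  rw [h, ← sub_eq_add_neg, ← sub_eq_add_neg] at this
  linarith

lemma half_mul_rpow_le {p t : ℝ} (hp : 1 < p) (ht : 0 < t) :
    1 / 2 * t ^ p ≤ ((1 - stepH p) * t) ^ p := by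
  have h1 := stepH_le hp
  rw [Real.mul_rpow (by linarith) ht.le]
  have := half_le_rpow hp
  have : 0 < t ^ p := Real.rpow_pos_of_pos ht _
  gcongr

lemma shrink_pos {p t : ℝ} (hp : 1 < p) (ht : 0 < t) : 0 < (1 - stepH p) * t :=
  mul_pos (by linarith [stepH_le hp]) ht

lemma shrink_le {p t : ℝ} (hp : 1 < p) (ht : 0 < t) : (1 - stepH p) * t ≤ t := by
  nlinarith [stepH_pos hp]

/-- The second summand is the bound for the movement of the path in one phase (`IsPathPoint.drift`);
the first leaves room for the error of the points before and after the phase. -/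
lemma radius_eq (p : ℝ) (n : ℕ) (t : ℝ) :
    radius p n t = t ^ (p / 2) + p ^ 3 / (p - 1) * √(n : ℝ) * stepH p * t ^ (p / 2) := by
  unfold radius; ring

lemma drift_nonneg {p : ℝ} (hp : 1 < p) (n : ℕ) : 0 ≤ p ^ 3 / (p - 1) * √(n : ℝ) * stepH p := by
  have := stepH_pos hp
  have : 0 < p - 1 := by linarith
  positivity

lemma le_radius {p : ℝ} (hp : 1 < p) (n : ℕ) {t : ℝ} (ht : 0 < t) :
    t ^ (p / 2) ≤ radius p n t := by
  rw [radius_eq]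
  have := drift_nonneg hp n
  have : 0 < t ^ (p / 2) := Real.rpow_pos_of_pos ht _
  nlinarith [mul_nonneg (drift_nonneg hp n) this.le]

lemma radius_pos {p : ℝ} (hp : 1 < p) (n : ℕ) {t : ℝ} (ht : 0 < t) : 0 < radius p n t :=
  (Real.rpow_pos_of_pos ht _).trans_le (le_radius hp n ht)

lemma weight_of_two_le {n : ℕ} {p t : ℝ} (hp : 2 ≤ p) (s : Fin n → ℝ) (i : Fin n) :
    weight p t s i =
      (p - 1) / 2 * max (t ^ (p / 2)) (|s i| ^ (p / 2) - radius p n t) ^ (2 - 4 / p) := by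
  unfold weight
  rcases hp.eq_or_lt with rfl | h
  · norm_num
  · rw [sign_pos (by linarith)]; simp

lemma weight_of_le_two {n : ℕ} {p t : ℝ} (hp1 : 1 < p) (ht : 0 < t) (hp : p ≤ 2) (s : Fin n → ℝ)
    (i : Fin n) :
    weight p t s i = (p - 1) / 2 * (|s i| ^ (p / 2) + radius p n t) ^ (2 - 4 / p) := by
  unfold weight
  -- At `p = 2` the sign is `0` rather than `-1`, but the exponent `2 - 4/p` vanishes, so the base
  -- is irrelevant.
  rcases hp.eq_or_lt with rfl | h
  · norm_num
  · rw [sign_neg (by linarith)]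
    simp only [SignType.coe_neg_one, neg_mul, one_mul, sub_neg_eq_add]
    rw [max_eq_right]
    have := le_radius hp1 n ht
    have := Real.rpow_nonneg (abs_nonneg (s i)) (p / 2)
    linarith

lemma weight_pos {n : ℕ} {p t : ℝ} (hp : 1 < p) (ht : 0 < t) (s : Fin n → ℝ) (i : Fin n) :
    0 < weight p t s i := by
  unfold weight
  have : 0 < t ^ (p / 2) := Real.rpow_pos_of_pos ht _
  exact mul_pos (by linarith) (Real.rpow_pos_of_pos (lt_max_of_lt_left this) _)

lemma rpow_half_rpow {p x : ℝ} (hp : 1 < p) (hx : 0 ≤ x) :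
    (x ^ (p / 2)) ^ (2 - 4 / p) = x ^ (p - 2) := by
  rw [← Real.rpow_mul hx]
  congr 1
  field_simp
  ring

/-- The factor `Q = 1 + 2 γ / t^{p/2}` in the condition number. -/
lemma kappa_eq (p : ℝ) (n : ℕ) :
    kappa p n = 4 * p ^ 2 / (p - 1) *
      (3 + 2 * (p ^ 3 / (p - 1) * √(n : ℝ) * stepH p)) ^ |2 - 4 / p| := by
  unfold kappa
  congr 2
  ring

lemma kappa_mul_weight_eq {p : ℝ} (hp : 1 < p) (n : ℕ) (Y : ℝ) :
    kappa p n * ((p - 1) / 2 * Y) =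
      2 * p ^ 2 * ((3 + 2 * (p ^ 3 / (p - 1) * √(n : ℝ) * stepH p)) ^ |2 - 4 / p| * Y) := by
  rw [kappa_eq]
  have : p - 1 ≠ 0 := by linarith
  field_simp
  ring

lemma two_sub_nonneg {p : ℝ} (hp : 2 ≤ p) : 0 ≤ 2 - 4 / p := by
  rw [sub_nonneg, div_le_iff₀ (by linarith)]; linarith

lemma two_sub_nonpos {p : ℝ} (hp1 : 1 < p) (hp : p ≤ 2) : 2 - 4 / p ≤ 0 := by
  rw [sub_nonpos, le_div_iff₀ (by linarith)]; linarith

lemma abs_rpow_mem_of_box {p γ s x : ℝ} (hp : 1 < p)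
    (hx : |spow x (p / 2) - spow s (p / 2)| ≤ γ) :
    |s| ^ (p / 2) - γ ≤ |x| ^ (p / 2) ∧ |x| ^ (p / 2) ≤ |s| ^ (p / 2) + γ := by
  have hr : p / 2 ≠ 0 := by positivity
  rw [← abs_spow hr, ← abs_spow hr]
  have h1 := abs_sub_abs_le_abs_sub (spow x (p / 2)) (spow s (p / 2))
  have h2 := abs_sub_abs_le_abs_sub (spow s (p / 2)) (spow x (p / 2))
  rw [abs_sub_comm] at h2
  constructor <;> linarith

/-- On the box `|x|^{p/2}` stays within `γ` of `|s_i|^{p/2}`. The weight evaluates the curvature at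
the end where it is smallest: the upper end for `p ≤ 2`, the lower end, cut off at `t^{p/2}`, for `p
≥ 2`. Passing from `t` to `(1-h)t` costs at most a factor `2`, which the factor `1/2` in the weight
pays for. -/
lemma weight_le_of_box {n : ℕ} {p t x : ℝ} (hp : 1 < p) (ht : 0 < t) (s : Fin n → ℝ) (i : Fin n)
    (hx : |spow x (p / 2) - spow (s i) (p / 2)| ≤ radius p n t) :
    weight p t s i ≤ p * min 1 (p - 1) * max ((1 - stepH p) * t) |x| ^ (p - 2) := by
  obtain ⟨hx1, hx2⟩ := abs_rpow_mem_of_box hp hx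
  have ht' := shrink_pos hp ht
  have hmax : 0 < max ((1 - stepH p) * t) |x| := lt_max_of_lt_left ht'
  have hY : 0 < max ((1 - stepH p) * t) |x| ^ (p - 2) := Real.rpow_pos_of_pos hmax _
  rcases le_total p 2 with h2 | h2
  · rw [weight_of_le_two hp ht h2, min_eq_right (by linarith)]
    have : (|s i| ^ (p / 2) + radius p n t) ^ (2 - 4 / p) ≤
        max ((1 - stepH p) * t) |x| ^ (p - 2) := by
      rw [← rpow_half_rpow hp hmax.le]
      refine Real.rpow_le_rpow_of_nonpos (Real.rpow_pos_of_pos hmax _) ?_ (two_sub_nonpos hp h2)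
      rcases max_choice ((1 - stepH p) * t) |x| with h | h <;> rw [h]
      · have h1 := Real.rpow_le_rpow ht'.le (shrink_le hp ht) (show 0 ≤ p / 2 by linarith)
        have := le_radius hp n ht
        have := Real.rpow_nonneg (abs_nonneg (s i)) (p / 2)
        linarith
      · exact hx2
    calc (p - 1) / 2 * (|s i| ^ (p / 2) + radius p n t) ^ (2 - 4 / p)
        ≤ (p - 1) / 2 * max ((1 - stepH p) * t) |x| ^ (p - 2) := by gcongr
      _ ≤ _ := by gcongr; nlinarith
  · rw [weight_of_two_le h2, min_eq_left (by linarith)]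
    have : max (t ^ (p / 2)) (|s i| ^ (p / 2) - radius p n t) ^ (2 - 4 / p) ≤
        2 * max ((1 - stepH p) * t) |x| ^ (p - 2) := by
      rcases max_choice (t ^ (p / 2)) (|s i| ^ (p / 2) - radius p n t) with h | h
      · rw [h, rpow_half_rpow hp ht.le]
        have h3 : ((1 - stepH p) * t) ^ (p - 2) ≤ max ((1 - stepH p) * t) |x| ^ (p - 2) :=
          Real.rpow_le_rpow ht'.le (le_max_left _ _) (by linarith)
        have h4 : 1 / 2 * t ^ (p - 2) ≤ ((1 - stepH p) * t) ^ (p - 2) := by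
          rw [Real.mul_rpow (by linarith [stepH_le hp]) ht.le]
          have : (1 - stepH p) ^ p ≤ (1 - stepH p) ^ (p - 2) :=
            Real.rpow_le_rpow_of_exponent_ge (by linarith [stepH_le hp])
              (by linarith [stepH_pos hp]) (by linarith)
          have := half_le_rpow hp
          have : 0 < t ^ (p - 2) := Real.rpow_pos_of_pos ht _
          gcongr
          linarith
        linarith
      · have h0 : 0 ≤ |s i| ^ (p / 2) - radius p n t := by
          rw [← h]
          exact (Real.rpow_pos_of_pos ht _).le.trans (le_max_left _ _)
        rw [h]
        have h3 : (|s i| ^ (p / 2) - radius p n t) ^ (2 - 4 / p) ≤ |x| ^ (p - 2) := by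
          rw [← rpow_half_rpow hp (abs_nonneg x)]
          exact Real.rpow_le_rpow h0 hx1 (two_sub_nonneg h2)
        have h4 : |x| ^ (p - 2) ≤ max ((1 - stepH p) * t) |x| ^ (p - 2) :=
          Real.rpow_le_rpow (abs_nonneg x) (le_max_right _ _) (by linarith)
        linarith
    nlinarith

/-- The curvature at the two ends of the box differs by at most the ratio of the ends, in `p/2`-th
powers, raised to `|2 - 4/p|`. This power is the second factor of `κ`; its first factor absorbs `p
max(1, p-1)`, the normalization of the weight and the change from `t` to `(1-h)t`. -/
lemma le_kappa_mul_weight_of_box {n : ℕ} {p t x : ℝ} (hp : 1 < p) (ht : 0 < t) (s : Fin n → ℝ)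
    (i : Fin n) (hx : |spow x (p / 2) - spow (s i) (p / 2)| ≤ radius p n t) :
    p * max 1 (p - 1) * max ((1 - stepH p) * t) |x| ^ (p - 2) ≤ kappa p n * weight p t s i := by
  obtain ⟨hx1, hx2⟩ := abs_rpow_mem_of_box hp hx
  have ht' := shrink_pos hp ht
  have hmax : 0 < max ((1 - stepH p) * t) |x| := lt_max_of_lt_left ht'
  have hY : 0 < max ((1 - stepH p) * t) |x| ^ (p - 2) := Real.rpow_pos_of_pos hmax _
  have hτ : 0 < t ^ (p / 2) := Real.rpow_pos_of_pos ht _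
  have hγ := radius_eq p n t
  set B := p ^ 3 / (p - 1) * √(n : ℝ) * stepH p with hBdef
  have hB : 0 ≤ B := drift_nonneg hp n
  -- With `L` the maximum on the right, the left side is at most `L + 2γ = L + 2(1 + B) t^{p/2}`,
  -- and `t^{p/2} ≤ L`.
  have hratio : |s i| ^ (p / 2) + radius p n t ≤
      (3 + 2 * B) * max (t ^ (p / 2)) (|s i| ^ (p / 2) - radius p n t) := by
    have h1 := le_max_left (t ^ (p / 2)) (|s i| ^ (p / 2) - radius p n t)
    have h2 := le_max_right (t ^ (p / 2)) (|s i| ^ (p / 2) - radius p n t)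
    nlinarith
  rcases le_total p 2 with h2 | h2
  · rw [weight_of_le_two hp ht h2, max_eq_left (by linarith), kappa_mul_weight_eq hp,
      abs_of_nonpos (two_sub_nonpos hp h2), ← hBdef]
    set w := |s i| ^ (p / 2) + radius p n t with hw
    have hw0 : 0 < w := by
      have := le_radius hp n ht
      have := Real.rpow_nonneg (abs_nonneg (s i)) (p / 2)
      linarith
    have hQ : (3 + 2 * B) ^ (-(2 - 4 / p)) * w ^ (2 - 4 / p) = (w / (3 + 2 * B)) ^ (2 - 4 / p) := by
      rw [Real.div_rpow hw0.le (by positivity), Real.rpow_neg (by positivity)]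
      field_simp
    rw [hQ]
    have hw1 : w / (3 + 2 * B) ≤ max (t ^ (p / 2)) (|s i| ^ (p / 2) - radius p n t) := by
      rw [div_le_iff₀ (by positivity)]; linarith
    have hw2 : 0 < w / (3 + 2 * B) := by positivity
    have : max ((1 - stepH p) * t) |x| ^ (p - 2) ≤ 2 * (w / (3 + 2 * B)) ^ (2 - 4 / p) := by
      rcases max_choice (t ^ (p / 2)) (|s i| ^ (p / 2) - radius p n t) with h | h
      · rw [h] at hw1
        have h3 : max ((1 - stepH p) * t) |x| ^ (p - 2) ≤ ((1 - stepH p) * t) ^ (p - 2) :=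
          Real.rpow_le_rpow_of_nonpos ht' (le_max_left _ _) (by linarith)
        have h4 : ((1 - stepH p) * t) ^ (p - 2) ≤ 2 * t ^ (p - 2) := by
          rw [Real.mul_rpow (by linarith [stepH_le hp]) ht.le]
          have h5 : (1 - stepH p) ^ (p - 2) ≤ (1 - stepH p) ^ (-1 : ℝ) :=
            Real.rpow_le_rpow_of_exponent_ge (by linarith [stepH_le hp])
              (by linarith [stepH_pos hp]) (by linarith)
          have h6 : (1 - stepH p) ^ (-1 : ℝ) ≤ 2 := by
            rw [Real.rpow_neg_one, inv_le_comm₀ (by linarith [stepH_le hp]) (by norm_num)]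
            linarith [stepH_le hp]
          have : 0 < t ^ (p - 2) := Real.rpow_pos_of_pos ht _
          gcongr
          linarith
        have h5 : t ^ (p - 2) ≤ (w / (3 + 2 * B)) ^ (2 - 4 / p) := by
          rw [← rpow_half_rpow hp ht.le]
          exact Real.rpow_le_rpow_of_nonpos hw2 hw1 (two_sub_nonpos hp h2)
        linarith
      · rw [h] at hw1
        have h3 : max ((1 - stepH p) * t) |x| ^ (p - 2) ≤ (w / (3 + 2 * B)) ^ (2 - 4 / p) := by
          rw [← rpow_half_rpow hp hmax.le]
          refine Real.rpow_le_rpow_of_nonpos hw2 (hw1.trans (hx1.trans ?_)) (two_sub_nonpos hp h2)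
          exact Real.rpow_le_rpow (abs_nonneg x) (le_max_right _ _) (by linarith)
        have : 0 < (w / (3 + 2 * B)) ^ (2 - 4 / p) := Real.rpow_pos_of_pos hw2 _
        linarith
    calc p * 1 * max ((1 - stepH p) * t) |x| ^ (p - 2)
        ≤ p * 1 * (2 * (w / (3 + 2 * B)) ^ (2 - 4 / p)) := by gcongr
      _ ≤ _ := by
        have : 0 < (w / (3 + 2 * B)) ^ (2 - 4 / p) := Real.rpow_pos_of_pos hw2 _
        nlinarith [mul_pos (show 0 < p * (p - 1) by nlinarith) this]
  · rw [weight_of_two_le h2, max_eq_right (by linarith), kappa_mul_weight_eq hp,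
      abs_of_nonneg (two_sub_nonneg h2), ← hBdef]
    set Y := max (t ^ (p / 2)) (|s i| ^ (p / 2) - radius p n t) with hYdef
    have hY0 : 0 < Y := hτ.trans_le (le_max_left _ _)
    rw [← Real.mul_rpow (by positivity) hY0.le]
    have : max ((1 - stepH p) * t) |x| ^ (p - 2) ≤ ((3 + 2 * B) * Y) ^ (2 - 4 / p) := by
      rw [← rpow_half_rpow hp hmax.le]
      refine Real.rpow_le_rpow (Real.rpow_nonneg hmax.le _) ?_ (two_sub_nonneg h2)
      rcases max_choice ((1 - stepH p) * t) |x| with h | h <;> rw [h]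
      · have h1 := Real.rpow_le_rpow ht'.le (shrink_le hp ht) (show 0 ≤ p / 2 by linarith)
        have := le_max_left (t ^ (p / 2)) (|s i| ^ (p / 2) - radius p n t)
        nlinarith
      · linarith
    calc p * (p - 1) * max ((1 - stepH p) * t) |x| ^ (p - 2)
        ≤ p * (p - 1) * ((3 + 2 * B) * Y) ^ (2 - 4 / p) := by gcongr
      _ ≤ _ := mul_le_mul_of_nonneg_right (by nlinarith) (by positivity)

/-- Points of the box at distance `γ` in the `p/2`-th powers are close in the weighted norm. -/
lemma weight_mul_sq_le {n : ℕ} {p t x : ℝ} (hp : 1 < p) (ht : 0 < t) (s : Fin n → ℝ) (i : Fin n)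
    (hx : |spow x (p / 2) - spow (s i) (p / 2)| ≤ radius p n t) :
    weight p t s i * (s i - x) ^ 2 ≤ 2 * (p - 1) * radius p n t ^ 2 := by
  obtain ⟨hx1, hx2⟩ := abs_rpow_mem_of_box hp hx
  have hγ := le_radius hp n ht
  have hτ : 0 < t ^ (p / 2) := Real.rpow_pos_of_pos ht _
  have hτ2 : (t ^ (p / 2)) ^ 2 = t ^ p := by
    rw [← Real.rpow_natCast, ← Real.rpow_mul ht.le]; congr 1; push_cast; ring
  have hlow := le_abs_spow_sub (r := p / 2) (by linarith) (s i) x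
  rw [abs_sub_comm (spow (s i) _)] at hlow
  set M := max |s i| |x| with hM
  have hM0 : 0 ≤ M := (abs_nonneg _).trans (le_max_left _ _)
  rcases hM0.eq_or_lt with h0 | hMpos
  · have h1 : |s i| ≤ 0 := h0 ▸ le_max_left _ _
    have h2 : |x| ≤ 0 := h0 ▸ le_max_right _ _
    rw [abs_nonpos_iff.1 h1, abs_nonpos_iff.1 h2]
    simp
    nlinarith [sq_nonneg (radius p n t)]
  have hMp : (M ^ (p / 2 - 1)) ^ 2 = M ^ (p - 2) := by
    rw [← Real.rpow_natCast, ← Real.rpow_mul hM0]; congr 1; push_cast; ring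
  have hE : M ^ (p - 2) * (s i - x) ^ 2 ≤ 4 * radius p n t ^ 2 := by
    have h1 : M ^ (p / 2 - 1) * |s i - x| ≤ 2 * radius p n t := by linarith
    have h2 : 0 ≤ M ^ (p / 2 - 1) * |s i - x| :=
      mul_nonneg (Real.rpow_nonneg hM0 _) (abs_nonneg _)
    have h3 := pow_le_pow_left₀ h2 h1 2
    rw [mul_pow, hMp, sq_abs] at h3
    linarith
  -- The exception occurs for `p ≥ 2` when both points lie in `[-t, t]`: then `M^{p-2}` may be far
  -- below the weight, but `|s_i - x| ≤ 2t` and `t^p ≤ γ²` suffice.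
  have main : weight p t s i ≤ (p - 1) / 2 * M ^ (p - 2) ∨
      (M ≤ t ∧ weight p t s i ≤ (p - 1) / 2 * t ^ (p - 2)) := by
    rcases le_total p 2 with h2 | h2
    · left
      rw [weight_of_le_two hp ht h2, ← rpow_half_rpow hp hM0]
      refine mul_le_mul_of_nonneg_left (Real.rpow_le_rpow_of_nonpos
        (Real.rpow_pos_of_pos hMpos _) ?_ (two_sub_nonpos hp h2)) (by linarith)
      rcases max_choice |s i| |x| with h | h <;> rw [hM, h]
      · linarith
      · exact hx2
    · rw [weight_of_two_le h2]
      rcases le_total t M with hMt | hMt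
      · left
        rw [← rpow_half_rpow hp hM0]
        refine mul_le_mul_of_nonneg_left (Real.rpow_le_rpow (hτ.le.trans (le_max_left _ _)) ?_
          (two_sub_nonneg h2)) (by linarith)
        refine max_le (Real.rpow_le_rpow ht.le hMt (by linarith)) ?_
        have : |s i| ^ (p / 2) ≤ M ^ (p / 2) :=
          Real.rpow_le_rpow (abs_nonneg _) (le_max_left _ _) (by linarith)
        linarith
      · right
        refine ⟨hMt, ?_⟩
        rw [← rpow_half_rpow hp ht.le]
        refine mul_le_mul_of_nonneg_left (Real.rpow_le_rpow (hτ.le.trans (le_max_left _ _)) ?_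
          (two_sub_nonneg h2)) (by linarith)
        refine max_le le_rfl ?_
        have : |s i| ^ (p / 2) ≤ t ^ (p / 2) :=
          Real.rpow_le_rpow (abs_nonneg _) ((le_max_left _ _).trans hMt) (by linarith)
        linarith
  rcases main with h | ⟨hMt, h⟩
  · calc weight p t s i * (s i - x) ^ 2 ≤ (p - 1) / 2 * M ^ (p - 2) * (s i - x) ^ 2 := by gcongr
      _ = (p - 1) / 2 * (M ^ (p - 2) * (s i - x) ^ 2) := by ring
      _ ≤ (p - 1) / 2 * (4 * radius p n t ^ 2) := by gcongr
      _ = _ := by ring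
  · have h1 : |s i - x| ≤ 2 * t := by
      have := abs_sub (s i) x
      have h3 := (le_max_left |s i| |x|).trans hMt
      have h4 := (le_max_right |s i| |x|).trans hMt
      linarith
    have h2 : (s i - x) ^ 2 ≤ 4 * t ^ 2 := by
      have := pow_le_pow_left₀ (abs_nonneg _) h1 2
      rw [sq_abs] at this; linarith
    have h3 : t ^ (p - 2) * t ^ 2 = t ^ p := by
      rw [← Real.rpow_natCast, ← Real.rpow_add ht]; congr 1; push_cast; ring
    calc weight p t s i * (s i - x) ^ 2 ≤ (p - 1) / 2 * t ^ (p - 2) * (4 * t ^ 2) := by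
          have := Real.rpow_pos_of_pos ht (p - 2)
          have := weight_pos hp ht s i
          gcongr
      _ = 2 * (p - 1) * t ^ p := by rw [← h3]; ring
      _ ≤ _ := by
        rw [← hτ2]
        have : 0 ≤ 2 * (p - 1) := by linarith
        gcongr

/-- Points of the box that are far apart in the `p/2`-th powers are far apart in the weighted
norm. -/
lemma le_weight_mul_sq {n : ℕ} {p t a b : ℝ} (hp : 1 < p) (ht : 0 < t) (s : Fin n → ℝ) (i : Fin n)
    (ha : |spow a (p / 2) - spow (s i) (p / 2)| ≤ radius p n t)
    (hb : |spow b (p / 2) - spow (s i) (p / 2)| ≤ radius p n t)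
    (hab : ((1 - stepH p) * t) ^ (p / 2) / 2 ≤ |spow a (p / 2) - spow b (p / 2)|) :
    ((1 - stepH p) * t) ^ p ≤ 256 * p ^ 2 * (kappa p n * weight p t s i) * (a - b) ^ 2 := by
  set t' := (1 - stepH p) * t with ht'def
  have ht' : 0 < t' := shrink_pos hp ht
  have hτ' : 0 < t' ^ (p / 2) := Real.rpow_pos_of_pos ht' _
  have hτ2 : (t' ^ (p / 2)) ^ 2 = t' ^ p := by
    rw [← Real.rpow_natCast, ← Real.rpow_mul ht'.le]; congr 1; push_cast; ring
  set M := max |a| |b| with hM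
  have hM0 : 0 ≤ M := (abs_nonneg _).trans (le_max_left _ _)
  have hMp : (M ^ (p / 2 - 1)) ^ 2 = M ^ (p - 2) := by
    rw [← Real.rpow_natCast, ← Real.rpow_mul hM0]; congr 1; push_cast; ring
  have hup := abs_spow_sub_le (r := p / 2) (by linarith) a b
  rw [← hM] at hup
  have hmax2 : max 2 (p / 2) ≤ 2 * p := max_le (by linarith) (by linarith)
  have hMbox : p * max 1 (p - 1) * max t' M ^ (p - 2) ≤ kappa p n * weight p t s i := by
    rcases max_choice |a| |b| with h | h <;> rw [hM, h]
    · exact le_kappa_mul_weight_of_box hp ht s i ha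
    · exact le_kappa_mul_weight_of_box hp ht s i hb
  -- Two powers at distance at least `t'^{p/2}/2` cannot both be below `t'^{p/2}/4`. For `p < 2`,
  -- where `M^{p-2}` grows as `M → 0`, this bounds it by `4^{4/p-2} ≤ 16` times `t'^{p-2}` when `M ≤
  -- t'`.
  have hMr : t' ^ (p / 2) / 4 ≤ M ^ (p / 2) := by
    have h1 := abs_sub (spow a (p / 2)) (spow b (p / 2))
    rw [abs_spow (by positivity), abs_spow (by positivity)] at h1
    have h2 : |a| ^ (p / 2) ≤ M ^ (p / 2) :=
      Real.rpow_le_rpow (abs_nonneg _) (le_max_left _ _) (by linarith)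
    have h3 : |b| ^ (p / 2) ≤ M ^ (p / 2) :=
      Real.rpow_le_rpow (abs_nonneg _) (le_max_right _ _) (by linarith)
    linarith
  have hY : 0 < max t' M ^ (p - 2) := Real.rpow_pos_of_pos (lt_max_of_lt_left ht') _
  have hkey : M ^ (p - 2) ≤ 16 * max t' M ^ (p - 2) := by
    rcases le_total t' M with h | h
    · rw [max_eq_right h] at hY ⊢; linarith
    · rw [max_eq_left h] at hY ⊢
      rcases le_total p 2 with h2 | h2
      · rw [← rpow_half_rpow hp hM0, ← rpow_half_rpow hp ht'.le]
        calc (M ^ (p / 2)) ^ (2 - 4 / p) ≤ (t' ^ (p / 2) / 4) ^ (2 - 4 / p) :=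
              Real.rpow_le_rpow_of_nonpos (by positivity) hMr (two_sub_nonpos hp h2)
          _ = (4 : ℝ) ^ (-(2 - 4 / p)) * (t' ^ (p / 2)) ^ (2 - 4 / p) := by
              rw [Real.div_rpow hτ'.le (by norm_num), Real.rpow_neg (by norm_num)]
              field_simp
          _ ≤ 16 * (t' ^ (p / 2)) ^ (2 - 4 / p) := by
              have h4 : (4 : ℝ) ^ (-(2 - 4 / p)) ≤ (4 : ℝ) ^ (2 : ℝ) := by
                refine Real.rpow_le_rpow_of_exponent_le (by norm_num) ?_
                have : 4 / p ≤ 4 := by rw [div_le_iff₀ (by linarith)]; linarith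
                linarith
              have h5 : (4 : ℝ) ^ (2 : ℝ) = 16 := by norm_num
              rw [h5] at h4
              gcongr
      · have : M ^ (p - 2) ≤ t' ^ (p - 2) := Real.rpow_le_rpow hM0 h (by linarith)
        linarith
  have hMK : M ^ (p - 2) ≤ 16 * (kappa p n * weight p t s i) := by
    have h1 : 1 ≤ p * max 1 (p - 1) := by nlinarith [le_max_left 1 (p - 1)]
    nlinarith
  have h1 : t' ^ (p / 2) / 2 ≤ 2 * p * (M ^ (p / 2 - 1) * |a - b|) := by
    refine hab.trans (hup.trans ?_)
    rw [mul_assoc]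
    have : 0 ≤ M ^ (p / 2 - 1) := Real.rpow_nonneg hM0 _
    gcongr
  have h2 := pow_le_pow_left₀ (by positivity) h1 2
  rw [mul_pow, mul_pow, mul_pow, hMp, sq_abs, div_pow, hτ2] at h2
  have h3 : M ^ (p - 2) * (a - b) ^ 2 ≤ 16 * (kappa p n * weight p t s i) * (a - b) ^ 2 := by gcongr
  nlinarith [mul_le_mul_of_nonneg_left h3 (show 0 ≤ 16 * p ^ 2 by positivity)]

/-! ### Pseudoinverses and preconditioners -/

/-- A finite spectrum makes every function admissible for the functional calculus, even the inverse
at the eigenvalue `0`. -/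
lemma continuousOn_spectrum {d : ℕ} (M : Matrix (Fin d) (Fin d) ℝ) (f : ℝ → ℝ) :
    ContinuousOn f (spectrum ℝ M) :=
  (Matrix.finite_spectrum M).continuousOn f

lemma pinv_transpose {d : ℕ} (M : Matrix (Fin d) (Fin d) ℝ) : (pinv M)ᵀ = pinv M := by
  have h : IsSelfAdjoint (pinv M) := cfc_predicate (fun x : ℝ => x⁻¹) M
  rw [← conjTranspose_eq_transpose_of_trivial]
  exact h

lemma pinvSqrt_transpose {d : ℕ} (M : Matrix (Fin d) (Fin d) ℝ) : (pinvSqrt M)ᵀ = pinvSqrt M := by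
  have h : IsSelfAdjoint (pinvSqrt M) := cfc_predicate (fun x : ℝ => √(x⁻¹)) M
  rw [← conjTranspose_eq_transpose_of_trivial]
  exact h

lemma isSelfAdjoint_of_transpose {d : ℕ} {M : Matrix (Fin d) (Fin d) ℝ} (hM : Mᵀ = M) :
    IsSelfAdjoint M := by
  rw [isSelfAdjoint_iff, star_eq_conjTranspose, conjTranspose_eq_transpose_of_trivial, hM]

/-- The functional calculus reduces this and the next two identities to scalar ones, which also hold
at the eigenvalue `0` because `0⁻¹ = 0`. -/
lemma pinv_mul_self_mul_pinv {d : ℕ} {M : Matrix (Fin d) (Fin d) ℝ} (hM : Mᵀ = M) :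
    pinv M * M * pinv M = pinv M := by
  have hM' := isSelfAdjoint_of_transpose hM
  have hid : M = cfc (fun x : ℝ => x) M := (cfc_id' ℝ M).symm
  have h1 := cfc_mul (fun x : ℝ => x⁻¹) (fun x : ℝ => x) M (continuousOn_spectrum _ _)
    (continuousOn_spectrum _ _)
  have h2 := cfc_mul (fun x : ℝ => x⁻¹ * x) (fun x : ℝ => x⁻¹) M (continuousOn_spectrum _ _)
    (continuousOn_spectrum _ _)
  rw [h1, ← hid] at h2
  unfold pinv
  rw [← h2]
  congr 1
  ext x
  rcases eq_or_ne x 0 with rfl | hx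
  · simp
  · field_simp

lemma self_mul_pinv_mul_self {d : ℕ} {M : Matrix (Fin d) (Fin d) ℝ} (hM : Mᵀ = M) :
    M * pinv M * M = M := by
  have hM' := isSelfAdjoint_of_transpose hM
  have hid : M = cfc (fun x : ℝ => x) M := (cfc_id' ℝ M).symm
  have h1 := cfc_mul (fun x : ℝ => x) (fun x : ℝ => x⁻¹) M (continuousOn_spectrum _ _)
    (continuousOn_spectrum _ _)
  have h2 := cfc_mul (fun x : ℝ => x * x⁻¹) (fun x : ℝ => x) M (continuousOn_spectrum _ _)
    (continuousOn_spectrum _ _)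
  rw [h1, ← hid] at h2
  unfold pinv
  rw [← h2]
  nth_rewrite 2 [hid]
  congr 1
  ext x
  rcases eq_or_ne x 0 with rfl | hx
  · simp
  · field_simp

lemma pinv_mul_comm {d : ℕ} (M : Matrix (Fin d) (Fin d) ℝ) (hM : Mᵀ = M) :
    pinv M * M = M * pinv M := by
  have hM' := isSelfAdjoint_of_transpose hM
  have hid : M = cfc (fun x : ℝ => x) M := (cfc_id' ℝ M).symm
  have h1 := cfc_mul (fun x : ℝ => x) (fun x : ℝ => x⁻¹) M (continuousOn_spectrum _ _)
    (continuousOn_spectrum _ _)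
  have h2 := cfc_mul (fun x : ℝ => x⁻¹) (fun x : ℝ => x) M (continuousOn_spectrum _ _)
    (continuousOn_spectrum _ _)
  rw [← hid] at h1 h2
  unfold pinv
  rw [← h1, ← h2]
  simp_rw [mul_comm]

lemma pinvSqrt_mul_pinvSqrt {d : ℕ} {M : Matrix (Fin d) (Fin d) ℝ} (hM : M.PosSemidef) :
    pinvSqrt M * pinvSqrt M = pinv M := by
  unfold pinvSqrt pinv
  rw [← cfc_mul _ _ M (continuousOn_spectrum _ _) (continuousOn_spectrum _ _)]
  refine cfc_congr fun x hx => ?_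
  have hx0 : 0 ≤ x := by
    rw [hM.1.spectrum_real_eq_range_eigenvalues] at hx
    obtain ⟨i, rfl⟩ := hx
    exact hM.eigenvalues_nonneg i
  exact Real.mul_self_sqrt (inv_nonneg.2 hx0)

lemma transpose_mulVec_dotProduct {k l : ℕ} (B : Matrix (Fin k) (Fin l) ℝ) (u : Fin k → ℝ)
    (v : Fin l → ℝ) : (Bᵀ *ᵥ u) ⬝ᵥ v = u ⬝ᵥ (B *ᵥ v) := by
  rw [mulVec_transpose, dotProduct_mulVec]

section Weighted

variable {n d : ℕ} (A : Matrix (Fin n) (Fin d) ℝ) (D : Fin n → ℝ)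

lemma weighted_transpose : (Aᵀ * diagonal D * A)ᵀ = Aᵀ * diagonal D * A := by
  simp [Matrix.mul_assoc]

lemma dotProduct_weighted (v w : Fin d → ℝ) :
    v ⬝ᵥ ((Aᵀ * diagonal D * A) *ᵥ w) = ∑ i, D i * (A *ᵥ v) i * (A *ᵥ w) i := by
  rw [← mulVec_mulVec, ← mulVec_mulVec, dotProduct_mulVec, vecMul_transpose, dotProduct]
  refine Finset.sum_congr rfl fun i _ => ?_
  rw [mulVec_diagonal]
  ring

variable {A D}

lemma weighted_posSemidef (hD : ∀ i, 0 < D i) : (Aᵀ * diagonal D * A).PosSemidef := by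
  refine PosSemidef.of_dotProduct_mulVec_nonneg ?_ fun x => ?_
  · rw [IsHermitian, conjTranspose_eq_transpose_of_trivial, weighted_transpose]
  · rw [star_trivial, dotProduct_weighted]
    refine Finset.sum_nonneg fun i _ => ?_
    have := hD i
    nlinarith [mul_nonneg this.le (mul_self_nonneg ((A *ᵥ x) i))]

lemma kerOrth_transpose_mulVec (u : Fin n → ℝ) : KerOrth A (Aᵀ *ᵥ u) := by
  intro w hw
  rw [dotProduct_comm, dotProduct_mulVec, vecMul_transpose, hw, zero_dotProduct]

lemma KerOrth.add {v w : Fin d → ℝ} (hv : KerOrth A v) (hw : KerOrth A w) : KerOrth A (v + w) := by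
  intro u hu
  rw [add_dotProduct, hv u hu, hw u hu, add_zero]

lemma KerOrth.sub {v w : Fin d → ℝ} (hv : KerOrth A v) (hw : KerOrth A w) : KerOrth A (v - w) := by
  intro u hu
  rw [sub_dotProduct, hv u hu, hw u hu, sub_zero]

lemma KerOrth.smul {v : Fin d → ℝ} (a : ℝ) (hv : KerOrth A v) : KerOrth A (a • v) := by
  intro u hu
  rw [smul_dotProduct, hv u hu, smul_zero]

lemma KerOrth.eq_of_mulVec_eq {v w : Fin d → ℝ} (hv : KerOrth A v) (hw : KerOrth A w)
    (h : A *ᵥ v = A *ᵥ w) : v = w := by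
  have h1 := hv.sub hw (v - w) (by rw [mulVec_sub, h, sub_self])
  exact sub_eq_zero.1 (dotProduct_self_eq_zero.1 h1)

/-- Since `M† = M† M M† = M M† M†`, the range of `M†` lies in that of `M`, hence in that of `Aᵀ`. -/
lemma kerOrth_pinv_mulVec (w : Fin d → ℝ) :
    KerOrth A (pinv (Aᵀ * diagonal D * A) *ᵥ w) := by
  have hs := weighted_transpose A D
  rw [← pinv_mul_self_mul_pinv hs, pinv_mul_comm _ hs, ← mulVec_mulVec, ← mulVec_mulVec,
    ← mulVec_mulVec, ← mulVec_mulVec]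
  exact kerOrth_transpose_mulVec _

/-- The difference `v = M† M x - x` satisfies `M v = 0`, and `vᵀ M v = Σ D_i (A v)_i²` with positive
`D` forces `A v = 0`. -/
lemma mulVec_pinv_mulVec (hD : ∀ i, 0 < D i) (x : Fin d → ℝ) :
    A *ᵥ (pinv (Aᵀ * diagonal D * A) *ᵥ ((Aᵀ * diagonal D * A) *ᵥ x)) = A *ᵥ x := by
  set M := Aᵀ * diagonal D * A with hM
  set v := pinv M *ᵥ (M *ᵥ x) - x with hv
  have hMv : M *ᵥ v = 0 := by
    rw [hv, mulVec_sub, mulVec_mulVec, mulVec_mulVec,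
      self_mul_pinv_mul_self (weighted_transpose A D), sub_self]
  have h0 : v ⬝ᵥ (M *ᵥ v) = 0 := by rw [hMv, dotProduct_zero]
  rw [hM, dotProduct_weighted, Finset.sum_eq_zero_iff_of_nonneg] at h0
  · have : A *ᵥ v = 0 := by
      ext i
      have := h0 i (Finset.mem_univ i)
      simpa [(hD i).ne', mul_assoc] using this
    rw [hv, mulVec_sub, sub_eq_zero] at this
    exact this
  · intro i _
    nlinarith [mul_nonneg (hD i).le (mul_self_nonneg ((A *ᵥ v) i))]

lemma pinv_mulVec_of_kerOrth (hD : ∀ i, 0 < D i) {x : Fin d → ℝ} (hx : KerOrth A x) :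
    pinv (Aᵀ * diagonal D * A) *ᵥ ((Aᵀ * diagonal D * A) *ᵥ x) = x :=
  (kerOrth_pinv_mulVec _).eq_of_mulVec_eq hx (mulVec_pinv_mulVec hD x)

lemma mulVec_pinv_of_kerOrth (hD : ∀ i, 0 < D i) {x : Fin d → ℝ} (hx : KerOrth A x) :
    (Aᵀ * diagonal D * A) *ᵥ (pinv (Aᵀ * diagonal D * A) *ᵥ x) = x := by
  have := pinv_mulVec_of_kerOrth hD hx
  rwa [mulVec_mulVec, pinv_mul_comm _ (weighted_transpose A D), ← mulVec_mulVec] at this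

end Weighted

section Precond

variable {n d m : ℕ} {A : Matrix (Fin n) (Fin d) ℝ} {b : Fin n → ℝ} {p t : ℝ} {x : Fin d → ℝ}

/-- The identity `P Pᵀ = (Aᵀ D_t A)†` is all that the analysis of a phase uses about the
preconditioner, so both choices are treated at once. -/
lemma precond_mul_transpose (hp : 1 < p) (ht : 0 < t) :
    precond A b p t x * (precond A b p t x)ᵀ = pinv (gram A b p t x) := by
  unfold precond
  rw [pinvSqrt_transpose, pinvSqrt_mul_pinvSqrt]
  exact weighted_posSemidef fun i => weight_pos hp ht _ i

lemma precond'_mul_transpose (hp : 1 < p) (ht : 0 < t) :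
    precond' A b p t x * (precond' A b p t x)ᵀ = pinv (gram A b p t x) := by
  unfold precond'
  rw [transpose_mul, transpose_mul, pinv_transpose, transpose_transpose, diagonal_transpose]
  have h1 : diagonal (fun i => √(weight p t (residual A b x) i)) *
      diagonal (fun i => √(weight p t (residual A b x) i)) =
      diagonal (weight p t (residual A b x)) := by
    rw [diagonal_mul_diagonal]
    congr 1
    ext i
    exact Real.mul_self_sqrt (weight_pos hp ht _ i).le
  have h2 := pinv_mul_self_mul_pinv (M := gram A b p t x) (weighted_transpose _ _)
  nth_rewrite 3 [← h2]
  nth_rewrite 4 [gram]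
  rw [← h1]
  simp only [Matrix.mul_assoc]

/-- The range of `Pᵀ`, in which the iterates of accelerated gradient descent stay. -/
def iterSpace (P : Matrix (Fin d) (Fin m) ℝ) : Submodule ℝ (EuclideanSpace ℝ (Fin m)) where
  carrier := {y | ∃ w, y.ofLp = Pᵀ *ᵥ w}
  add_mem' := by
    rintro a b ⟨v, hv⟩ ⟨w, hw⟩
    exact ⟨v + w, by rw [WithLp.ofLp_add, hv, hw, mulVec_add]⟩
  zero_mem' := ⟨0, by simp⟩
  smul_mem' := by
    rintro r a ⟨v, hv⟩
    exact ⟨r • v, by rw [WithLp.ofLp_smul, hv, mulVec_smul]⟩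

variable {P : Matrix (Fin d) (Fin m) ℝ}

lemma kerOrth_of_mem_iterSpace (hP : P * Pᵀ = pinv (gram A b p t x))
    {y : EuclideanSpace ℝ (Fin m)} (hy : y ∈ iterSpace P) : KerOrth A (P *ᵥ y.ofLp) := by
  obtain ⟨w, hw⟩ := hy
  rw [hw, mulVec_mulVec, hP]
  exact kerOrth_pinv_mulVec w

/-- For `y = Pᵀ w` both sides equal `wᵀ M† w`, by `M† M M† = M†`. Outside the range of `Pᵀ` this may
fail, as `P` may have a kernel; hence strong convexity is claimed only on this subspace. -/
lemma norm_sq_of_mem_iterSpace (hP : P * Pᵀ = pinv (gram A b p t x))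
    {y : EuclideanSpace ℝ (Fin m)} (hy : y ∈ iterSpace P) :
    ‖y‖ ^ 2 = ∑ i, weight p t (residual A b x) i * (A *ᵥ (P *ᵥ y.ofLp)) i ^ 2 := by
  have hs : (gram A b p t x)ᵀ = gram A b p t x := weighted_transpose _ _
  have h1 := dotProduct_weighted A (weight p t (residual A b x)) (P *ᵥ y.ofLp) (P *ᵥ y.ofLp)
  have h2 : ‖y‖ ^ 2 = y.ofLp ⬝ᵥ y.ofLp := by
    rw [EuclideanSpace.norm_sq_eq]
    simp [dotProduct, pow_two]
  obtain ⟨w, hw⟩ := hy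
  have h3 : (P *ᵥ y.ofLp) ⬝ᵥ (gram A b p t x *ᵥ (P *ᵥ y.ofLp)) = y.ofLp ⬝ᵥ y.ofLp := by
    have h4 : Pᵀ *ᵥ (gram A b p t x *ᵥ (P *ᵥ (Pᵀ *ᵥ w))) ⬝ᵥ Pᵀ *ᵥ w = Pᵀ *ᵥ w ⬝ᵥ Pᵀ *ᵥ w := by
      have h5 : ∀ u v : Fin d → ℝ, Pᵀ *ᵥ u ⬝ᵥ Pᵀ *ᵥ v = u ⬝ᵥ ((P * Pᵀ) *ᵥ v) := by
        intro u v
        rw [← mulVec_mulVec, dotProduct_mulVec u, ← mulVec_transpose]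
      rw [h5, h5, mulVec_mulVec w P, hP, dotProduct_mulVec, ← mulVec_transpose, pinv_transpose,
        mulVec_mulVec, mulVec_mulVec, pinv_mul_self_mul_pinv hs, dotProduct_comm]
    rw [hw, dotProduct_comm, dotProduct_mulVec, ← mulVec_transpose, h4]
  rw [h2, ← h3]
  unfold gram
  rw [h1]
  exact Finset.sum_congr rfl fun i _ => by ring

/-- The preimage `Pᵀ Aᵀ D A x'` of a point `x'`. -/
def preimage (A : Matrix (Fin n) (Fin d) ℝ) (b : Fin n → ℝ) (p t : ℝ) (x : Fin d → ℝ)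
    (P : Matrix (Fin d) (Fin m) ℝ) (x' : Fin d → ℝ) : EuclideanSpace ℝ (Fin m) :=
  WithLp.toLp 2 (Pᵀ *ᵥ (gram A b p t x *ᵥ x'))

lemma preimage_mem (x' : Fin d → ℝ) : preimage A b p t x P x' ∈ iterSpace P := ⟨_, rfl⟩

lemma mulVec_preimage (hp : 1 < p) (ht : 0 < t) (hP : P * Pᵀ = pinv (gram A b p t x))
    {x' : Fin d → ℝ} (hx' : KerOrth A x') : P *ᵥ (preimage A b p t x P x').ofLp = x' := by
  unfold preimage
  rw [mulVec_mulVec, hP]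
  exact pinv_mulVec_of_kerOrth (fun i => weight_pos hp ht _ i) hx'

end Precond

/-! ### The gradient of the preconditioned objective -/

section Gradient

variable {n d m : ℕ} (A : Matrix (Fin n) (Fin d) ℝ) (b : Fin n → ℝ) (c : Fin d → ℝ) {p t : ℝ}
  (x : Fin d → ℝ) (P : Matrix (Fin d) (Fin m) ℝ)

/-- The vector of derivatives `f̃_i'` at the residual of the point `x'`, for the box at `x`. -/
def extendGrad (p t : ℝ) (x' : Fin d → ℝ) (i : Fin n) : ℝ :=
  extend' p ((1 - stepH p) * t) (lower p (radius p n t) (residual A b x i))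
    (upper p (radius p n t) (residual A b x i)) (residual A b x' i)

/-- The chain rule. The gradient has the form `Pᵀ v`, so iterates that start in `iterSpace P` remain
there. -/
lemma hasGradientAt_precondObjective (hp : 1 < p) (ht : 0 < t) (y : EuclideanSpace ℝ (Fin m)) :
    HasGradientAt (precondObjective A b c p t x P)
      (WithLp.toLp 2 (Pᵀ *ᵥ (c + Aᵀ *ᵥ extendGrad A b x p t (P *ᵥ y.ofLp)))) y := by
  rw [hasGradientAt_iff_hasFDerivAt]
  let LP : EuclideanSpace ℝ (Fin m) →L[ℝ] (Fin d → ℝ) :=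
    LinearMap.toContinuousLinearMap
      ((Matrix.mulVecLin P).comp (WithLp.linearEquiv 2 ℝ (Fin m → ℝ)).toLinearMap)
  have hLP : ∀ y, LP y = P *ᵥ y.ofLp := fun y => rfl
  let ev : (i : Fin n) → (EuclideanSpace ℝ (Fin m) →L[ℝ] ℝ) := fun i =>
    LinearMap.toContinuousLinearMap
      ((LinearMap.proj i).comp ((Matrix.mulVecLin A).comp LP.toLinearMap))
  have hev : ∀ i y, ev i y = (A *ᵥ (P *ᵥ y.ofLp)) i := fun i y => rfl
  let cv : EuclideanSpace ℝ (Fin m) →L[ℝ] ℝ :=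
    LinearMap.toContinuousLinearMap ((dotProductBilin ℝ ℝ c).comp LP.toLinearMap)
  have hcv : ∀ y, cv y = c ⬝ᵥ (P *ᵥ y.ofLp) := fun y => rfl
  have h1 : ∀ i, HasFDerivAt (fun y : EuclideanSpace ℝ (Fin m) =>
      extend p ((1 - stepH p) * t) (lower p (radius p n t) (residual A b x i))
        (upper p (radius p n t) (residual A b x i)) (residual A b (P *ᵥ y.ofLp) i))
      (extendGrad A b x p t (P *ᵥ y.ofLp) i • ev i) y := by
    intro i
    have hd := hasDerivAt_extend hp (shrink_pos hp ht)
      (lower_le_upper (γ := radius p n t) (s := residual A b x i) hp (radius_pos hp n ht).le)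
      (residual A b (P *ᵥ y.ofLp) i)
    have he : HasFDerivAt (fun y : EuclideanSpace ℝ (Fin m) => residual A b (P *ᵥ y.ofLp) i)
        (ev i) y := (ev i).hasFDerivAt.sub_const (b i)
    exact hd.comp_hasFDerivAt y he
  have h2 := cv.hasFDerivAt.add (HasFDerivAt.fun_sum (u := Finset.univ) fun i _ => h1 i)
  refine HasFDerivAt.congr_fderiv (f' := _) h2 ?_
  ext v
  simp only [_root_.add_apply, _root_.sum_apply, _root_.smul_apply,
    InnerProductSpace.toDual_apply_apply, hev, hcv, smul_eq_mul]
  rw [EuclideanSpace.inner_eq_star_dotProduct]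
  simp only [star_trivial]
  rw [dotProduct_comm v.ofLp, transpose_mulVec_dotProduct, add_dotProduct,
    transpose_mulVec_dotProduct]
  rfl

end Gradient

/-! ### The homotopy path -/

section Path

variable {n d : ℕ} {A : Matrix (Fin n) (Fin d) ℝ} {b : Fin n → ℝ} {c : Fin d → ℝ} {p t : ℝ}

/-- The vector `f_t'(s(x))`. -/
def smoothGrad (A : Matrix (Fin n) (Fin d) ℝ) (b : Fin n → ℝ) (p t : ℝ) (x : Fin d → ℝ)
    (i : Fin n) : ℝ :=
  smooth' p t (residual A b x i)

lemma residual_sub_residual (x x' : Fin d → ℝ) (i : Fin n) :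
    residual A b x' i - residual A b x i = (A *ᵥ (x' - x)) i := by
  simp [residual, mulVec_sub]

lemma smoothObjective_le_of_stationary (hp : 1 < p) (ht : 0 < t) {x : Fin d → ℝ}
    (h : c + Aᵀ *ᵥ smoothGrad A b p t x = 0) (x' : Fin d → ℝ) :
    smoothObjective A b c p t x ≤ smoothObjective A b c p t x' := by
  have h1 : ∀ i, smooth p t (residual A b x i) + smoothGrad A b p t x i * (A *ᵥ (x' - x)) i ≤
      smooth p t (residual A b x' i) := fun i => by
    rw [← residual_sub_residual (b := b)]
    exact smooth_convex hp ht _ _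
  have h2 := Finset.sum_le_sum fun i (_ : i ∈ Finset.univ) => h1 i
  rw [Finset.sum_add_distrib] at h2
  have h3 : ∑ i, smoothGrad A b p t x i * (A *ᵥ (x' - x)) i = -(c ⬝ᵥ (x' - x)) := by
    change smoothGrad A b p t x ⬝ᵥ (A *ᵥ (x' - x)) = _
    rw [← transpose_mulVec_dotProduct, eq_neg_of_add_eq_zero_right h, neg_dotProduct]
  rw [h3, dotProduct_sub] at h2
  unfold smoothObjective
  linarith

/-- The gradient `v = c + Aᵀ f_t'` itself lies in `ker(A)ᗮ`, since `c` does. Moving `x` along `v` is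
therefore allowed, and the derivative `v · v` in this direction must vanish. The converse is
convexity. -/
lemma isPathPoint_iff (hp : 1 < p) (ht : 0 < t) (hc : KerOrth A c) {x : Fin d → ℝ} :
    IsPathPoint A b c p t x ↔ KerOrth A x ∧ c + Aᵀ *ᵥ smoothGrad A b p t x = 0 := by
  refine ⟨fun ⟨hx, hmin⟩ => ⟨hx, ?_⟩, fun ⟨hx, h⟩ =>
    ⟨hx, fun x' _ => smoothObjective_le_of_stationary hp ht h x'⟩⟩
  set v := c + Aᵀ *ᵥ smoothGrad A b p t x with hv
  have hvk : KerOrth A v := hc.add (kerOrth_transpose_mulVec _)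
  have hloc : IsLocalMin (fun ε : ℝ => smoothObjective A b c p t (x + ε • v)) 0 := by
    refine Filter.Eventually.of_forall fun ε => ?_
    simpa using hmin _ (hx.add (hvk.smul ε))
  have hder : HasDerivAt (fun ε : ℝ => smoothObjective A b c p t (x + ε • v))
      (c ⬝ᵥ v + ∑ i, smoothGrad A b p t x i * (A *ᵥ v) i) 0 := by
    unfold smoothObjective
    refine HasDerivAt.add ?_ (HasDerivAt.fun_sum fun i _ => ?_)
    · have : (fun ε : ℝ => c ⬝ᵥ (x + ε • v)) = fun ε => c ⬝ᵥ x + ε * (c ⬝ᵥ v) := by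
        ext ε
        rw [dotProduct_add, dotProduct_smul, smul_eq_mul]
      rw [this]
      simpa using ((hasDerivAt_id (0 : ℝ)).mul_const (c ⬝ᵥ v)).const_add (c ⬝ᵥ x)
    · have hlin : HasDerivAt (fun ε : ℝ => residual A b (x + ε • v) i) ((A *ᵥ v) i) 0 := by
        have : (fun ε : ℝ => residual A b (x + ε • v) i) =
            fun ε => residual A b x i + ε * (A *ᵥ v) i := by
          ext ε
          simp [residual, mulVec_add, mulVec_smul]
          ring
        rw [this]
        simpa using ((hasDerivAt_id (0 : ℝ)).mul_const ((A *ᵥ v) i)).const_add (residual A b x i)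
      have h0 := hasDerivAt_smooth hp ht (residual A b (x + (0 : ℝ) • v) i)
      have := h0.comp (0 : ℝ) hlin
      rw [zero_smul, add_zero] at this
      exact this
  have h0 := hloc.hasDerivAt_eq_zero hder
  have h1 : ∑ i, smoothGrad A b p t x i * (A *ᵥ v) i = (Aᵀ *ᵥ smoothGrad A b p t x) ⬝ᵥ v := by
    rw [transpose_mulVec_dotProduct]; rfl
  rw [h1, ← add_dotProduct, ← hv] at h0
  exact dotProduct_self_eq_zero.1 h0

lemma smooth'_strictMono (hp : 1 < p) (ht : 0 < t) {a b : ℝ} (hab : a < b) :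
    smooth' p t a < smooth' p t b := by
  set K := max t (max |a| |b|) with hK
  have hK0 : 0 < K := lt_max_of_lt_left ht
  have hmin : 0 < min 1 (p - 1) := lt_min one_pos (by linarith)
  have hm : ∀ x ∈ Set.Icc a b, p * min 1 (p - 1) * min (K ^ (p - 2)) (t ^ (p - 2)) ≤
      p * min 1 (p - 1) * max t |x| ^ (p - 2) := by
    intro x hx
    have h1 : max t |x| ≤ K := max_le (le_max_left _ _)
      ((abs_le_max_abs_abs hx.1 hx.2).trans (le_max_right _ _))
    have h0 : 0 < max t |x| := lt_max_of_lt_left ht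
    refine mul_le_mul_of_nonneg_left ?_ (by positivity)
    rcases le_total p 2 with h2 | h2
    · exact (min_le_left _ _).trans (Real.rpow_le_rpow_of_nonpos h0 h1 (by linarith))
    · exact (min_le_right _ _).trans (Real.rpow_le_rpow ht.le (le_max_left _ _) (by linarith))
  have := le_smooth'_sub hp ht hab.le hm
  have hpos : 0 < p * min 1 (p - 1) * min (K ^ (p - 2)) (t ^ (p - 2)) * (b - a) := by
    have := Real.rpow_pos_of_pos hK0 (p - 2)
    have := Real.rpow_pos_of_pos ht (p - 2)
    have : 0 < b - a := by linarith
    positivity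
  linarith

/-- The orthogonality of the change of the gradient and the change of the residual. -/
lemma sum_grad_sub_mul_residual_sub {t' : ℝ} {x x' : Fin d → ℝ}
    (h : c + Aᵀ *ᵥ smoothGrad A b p t x = 0) (h' : c + Aᵀ *ᵥ smoothGrad A b p t' x' = 0) :
    ∑ i, (smooth' p t' (residual A b x' i) - smooth' p t (residual A b x i)) *
      (residual A b x' i - residual A b x i) = 0 := by
  have : (smoothGrad A b p t' x' - smoothGrad A b p t x) ⬝ᵥ (A *ᵥ (x' - x)) = 0 := by
    rw [← transpose_mulVec_dotProduct, mulVec_sub, eq_neg_of_add_eq_zero_right h,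
      eq_neg_of_add_eq_zero_right h', sub_self, zero_dotProduct]
  rw [← this, dotProduct]
  refine Finset.sum_congr rfl fun i _ => ?_
  rw [residual_sub_residual]
  rfl

/-- Strict monotonicity of `f_t'` makes every term of the orthogonality relation nonnegative, and
zero only for equal residuals; `A` is injective on `ker(A)ᗮ`. -/
lemma IsPathPoint.unique (hp : 1 < p) (ht : 0 < t) (hc : KerOrth A c) {x x' : Fin d → ℝ}
    (hx : IsPathPoint A b c p t x) (hx' : IsPathPoint A b c p t x') : x = x' := by
  obtain ⟨hk, h⟩ := (isPathPoint_iff hp ht hc).1 hx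
  obtain ⟨hk', h'⟩ := (isPathPoint_iff hp ht hc).1 hx'
  refine hk.eq_of_mulVec_eq hk' ?_
  have h0 := sum_grad_sub_mul_residual_sub h h'
  have hmono : ∀ a b : ℝ, a ≠ b → 0 < (smooth' p t b - smooth' p t a) * (b - a) := by
    intro a b hab
    rcases hab.lt_or_gt with hlt | hlt
    · exact mul_pos (sub_pos.2 (smooth'_strictMono hp ht hlt)) (by linarith)
    · exact mul_pos_of_neg_of_neg (sub_neg.2 (smooth'_strictMono hp ht hlt)) (by linarith)
  rw [Finset.sum_eq_zero_iff_of_nonneg] at h0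
  · ext i
    by_contra hne
    refine (hmono (residual A b x i) (residual A b x' i) fun heq => hne ?_).ne'
      (h0 i (Finset.mem_univ i))
    simpa [residual] using heq
  · intro i _
    rcases eq_or_ne (residual A b x i) (residual A b x' i) with heq | hne
    · simp [heq]
    · exact (hmono _ _ hne).le

lemma smooth_neg (s : ℝ) : smooth p t (-s) = smooth p t s := by
  unfold smooth
  rw [abs_neg, neg_sq]

/-- A tangent line of slope at least `K`, taken at a large point `a`, lies below the even convex
function `f_t`. -/
lemma smooth_coercive (hp : 1 < p) (ht : 0 < t) (K : ℝ) :
    ∃ B, ∀ s, K * |s| - B ≤ smooth p t s := by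
  obtain ⟨a, ha1, ha2⟩ : ∃ a, t ≤ a ∧ K ≤ p * a ^ (p - 1) := by
    have h1 := tendsto_rpow_atTop (show 0 < p - 1 by linarith)
    obtain ⟨a, ha1, ha2⟩ := ((Filter.eventually_ge_atTop t).and
      (h1.eventually_ge_atTop (|K|))).exists
    refine ⟨a, ha1, (le_abs_self K).trans ?_⟩
    nlinarith [abs_nonneg K]
  have ha0 : 0 < a := ht.trans_le ha1
  have hd : smooth' p t a = p * a ^ (p - 1) := by
    rw [smooth'_of_le (by rwa [abs_of_pos ha0]), abs_of_pos ha0, mul_assoc,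
      show p - 2 = p - 1 - 1 by ring, rpow_sub_one_mul (by linarith) ha0.le]
  refine ⟨smooth' p t a * a - smooth p t a, fun s => ?_⟩
  have hs : smooth p t |s| = smooth p t s := by
    rcases abs_choice s with h | h <;> rw [h]
    exact smooth_neg s
  have h1 := smooth_convex hp ht a |s|
  rw [hs] at h1
  rw [← hd] at ha2
  have := mul_le_mul_of_nonneg_right ha2 (abs_nonneg s)
  linarith

/-- Since `c = Aᵀ λ` with `λ = A (AᵀA)† c`, the objective is a function `Φ` of `u = A x` alone. `Φ`
is coercive on `ℝⁿ`, so it attains its minimum on the closed range of `A`; the projection `M† M`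
then moves a preimage into `ker(A)ᗮ` without changing `A x`. -/
lemma exists_isPathPoint (hp : 1 < p) (ht : 0 < t) (A : Matrix (Fin n) (Fin d) ℝ) (b : Fin n → ℝ)
    {c : Fin d → ℝ} (hc : KerOrth A c) : ∃ x, IsPathPoint A b c p t x := by
  have hone : ∀ i : Fin n, (0 : ℝ) < (fun _ => 1 : Fin n → ℝ) i := fun _ => one_pos
  set M := Aᵀ * diagonal (fun _ => 1 : Fin n → ℝ) * A with hM
  set lam := diagonal (fun _ => 1 : Fin n → ℝ) *ᵥ (A *ᵥ (pinv M *ᵥ c)) with hlam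
  have hcl : c = Aᵀ *ᵥ lam := by
    rw [hlam, mulVec_mulVec, mulVec_mulVec, ← hM, mulVec_pinv_of_kerOrth hone hc]
  set Φ : (Fin n → ℝ) → ℝ := fun u => ∑ i, (lam i * u i + smooth p t (u i - b i)) with hΦ
  have hobj : ∀ x, smoothObjective A b c p t x = Φ (A *ᵥ x) := by
    intro x
    rw [hΦ]
    simp only
    rw [Finset.sum_add_distrib, hcl, smoothObjective, transpose_mulVec_dotProduct]
    rfl
  have hcont : Continuous Φ := by
    have : Continuous (smooth p t) :=
      continuous_iff_continuousAt.2 fun s => (hasDerivAt_smooth hp ht s).continuousAt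
    fun_prop
  have hbound : ∃ B, ∀ u, ‖u‖ - B ≤ Φ u := by
    have h1 : ∀ i, ∃ B, ∀ u : ℝ, |u| - B ≤ lam i * u + smooth p t (u - b i) := by
      intro i
      -- Growth rate `|λ_i|` absorbs the linear term; the additional `1` leaves `|u|`.
      obtain ⟨B, hB⟩ := smooth_coercive hp ht (1 + |lam i|)
      refine ⟨B + (1 + |lam i|) * |b i|, fun u => ?_⟩
      have h2 := hB (u - b i)
      have h3 : |u| ≤ |u - b i| + |b i| := by
        have := abs_add_le (u - b i) (b i)
        rwa [sub_add_cancel] at this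
      have h4 : -(|lam i| * |u|) ≤ lam i * u := by
        rw [← abs_mul]; exact neg_abs_le _
      have h5 : (1 + |lam i|) * |u| ≤ (1 + |lam i|) * (|u - b i| + |b i|) := by gcongr
      linarith
    choose B hB using h1
    refine ⟨∑ i, B i, fun u => ?_⟩
    have h2 : ‖u‖ ≤ ∑ i, |u i| := by
      refine (pi_norm_le_iff_of_nonneg (Finset.sum_nonneg fun i _ => abs_nonneg _)).2 fun i => ?_
      exact Finset.single_le_sum (f := fun i => |u i|) (fun i _ => abs_nonneg _) (Finset.mem_univ i)
    have h3 := Finset.sum_le_sum fun i (_ : i ∈ Finset.univ) => hB i (u i)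
    rw [Finset.sum_sub_distrib] at h3
    simp only [hΦ]
    linarith
  obtain ⟨B, hB⟩ := hbound
  have hclosed : IsClosed (LinearMap.range A.mulVecLin : Set (Fin n → ℝ)) :=
    Submodule.closed_of_finiteDimensional _
  have htend : Filter.Tendsto Φ (Filter.cocompact (Fin n → ℝ)) Filter.atTop := by
    refine Filter.tendsto_atTop_mono hB ?_
    exact Filter.tendsto_atTop_add_const_right _ (-B) (tendsto_norm_cocompact_atTop)
  obtain ⟨u, ⟨x, hx⟩, hmin⟩ := hcont.continuousOn.exists_isMinOn' hclosed
    (show (0 : Fin n → ℝ) ∈ (LinearMap.range A.mulVecLin : Set (Fin n → ℝ)) from zero_mem _)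
    ((htend.eventually_ge_atTop (Φ 0)).filter_mono inf_le_left)
  refine ⟨pinv M *ᵥ (M *ᵥ x), kerOrth_pinv_mulVec _, fun x' _ => ?_⟩
  rw [hobj, hobj, mulVec_pinv_mulVec hone]
  have := hmin (show A *ᵥ x' ∈ _ from ⟨x', rfl⟩)
  rw [← hx] at this
  exact this

/-! ### The initial point -/

/-- If all residuals lie in `[-t, t]`, then `f_t'` is linear there and stationarity is a linear
system solved by the closed form. The residual is `e - k A M† c`, where `-e` is the part of `b`
orthogonal to the range of `A`. By Pythagoras `‖e‖ ≤ ‖b‖ ≤ t/2`, and `‖A M† c‖² = cᵀ M† c` bounds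
the other part by `t/2`. -/
lemma initialPoint_isPathPoint (hp : 1 < p) (ht : 0 < t) (hc : KerOrth A c)
    (hb : 2 * ‖WithLp.toLp 2 b‖ ≤ t)
    (hE : 1 / p * t ^ (2 - p) * √(costEnergy A c) ≤ t / 2) :
    IsPathPoint A b c p t (initialPoint A b c p t) := by
  have hM : Aᵀ * A = Aᵀ * diagonal (fun _ => 1 : Fin n → ℝ) * A := by simp
  have hone : ∀ i : Fin n, (0 : ℝ) < (fun _ => 1 : Fin n → ℝ) i := fun _ => one_pos
  set G := pinv (Aᵀ * A) with hG
  have hGk : ∀ w, KerOrth A (G *ᵥ w) := fun w => by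
    rw [hG, hM]; exact kerOrth_pinv_mulVec w
  have hMG : ∀ w, KerOrth A w → Aᵀ *ᵥ (A *ᵥ (G *ᵥ w)) = w := fun w hw => by
    have := mulVec_pinv_of_kerOrth hone hw
    rwa [← hM, ← hG, ← mulVec_mulVec] at this
  set k := 1 / p * t ^ (2 - p) with hk
  have hk0 : 0 < k := by have := Real.rpow_pos_of_pos ht (2 - p); positivity
  have hx : initialPoint A b c p t = G *ᵥ (Aᵀ *ᵥ b) - k • (G *ᵥ c) := rfl
  set e := A *ᵥ (G *ᵥ (Aᵀ *ᵥ b)) - b with he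
  have hs : ∀ i, residual A b (initialPoint A b c p t) i = e i - k * (A *ᵥ (G *ᵥ c)) i := by
    intro i
    rw [hx, residual, mulVec_sub, mulVec_smul, he]
    simp
    ring
  have hEn : (A *ᵥ (G *ᵥ c)) ⬝ᵥ (A *ᵥ (G *ᵥ c)) = costEnergy A c := by
    rw [← transpose_mulVec_dotProduct, hMG c hc]; rfl
  have hle_sum : ∀ (w : Fin n → ℝ) i, w i ^ 2 ≤ w ⬝ᵥ w := fun w i => by
    rw [pow_two]
    exact Finset.single_le_sum (f := fun i => w i * w i) (fun i _ => mul_self_nonneg _)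
      (Finset.mem_univ i)
  have hAe : Aᵀ *ᵥ e = 0 := by
    rw [he, mulVec_sub, hMG _ (kerOrth_transpose_mulVec b), sub_self]
  have hnb : ‖WithLp.toLp 2 b‖ ^ 2 = b ⬝ᵥ b := by
    rw [EuclideanSpace.norm_sq_eq]; simp [dotProduct, pow_two]
  have hee : e ⬝ᵥ e ≤ b ⬝ᵥ b := by
    have hpyth : ∀ u v : Fin n → ℝ, v ⬝ᵥ u = 0 → (u - v) ⬝ᵥ (u - v) = u ⬝ᵥ u + v ⬝ᵥ v := by
      intro u v h
      rw [sub_dotProduct, dotProduct_sub, dotProduct_sub, dotProduct_comm u v, h]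
      ring
    have h1 : e ⬝ᵥ (A *ᵥ (G *ᵥ (Aᵀ *ᵥ b))) = 0 := by
      rw [← transpose_mulVec_dotProduct, hAe, zero_dotProduct]
    have h2 : b = A *ᵥ (G *ᵥ (Aᵀ *ᵥ b)) - e := by rw [he]; abel
    have h3 : b ⬝ᵥ b = (A *ᵥ (G *ᵥ (Aᵀ *ᵥ b))) ⬝ᵥ (A *ᵥ (G *ᵥ (Aᵀ *ᵥ b))) + e ⬝ᵥ e := by
      calc b ⬝ᵥ b = (A *ᵥ (G *ᵥ (Aᵀ *ᵥ b)) - e) ⬝ᵥ (A *ᵥ (G *ᵥ (Aᵀ *ᵥ b)) - e) := by rw [← h2]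
        _ = _ := hpyth _ _ h1
    have h4 : 0 ≤ (A *ᵥ (G *ᵥ (Aᵀ *ᵥ b))) ⬝ᵥ (A *ᵥ (G *ᵥ (Aᵀ *ᵥ b))) :=
      Finset.sum_nonneg fun i _ => mul_self_nonneg _
    linarith
  have hbound : ∀ i, |residual A b (initialPoint A b c p t) i| ≤ t := by
    intro i
    have h1 : |e i| ≤ t / 2 := by
      have : |e i| ≤ ‖WithLp.toLp 2 b‖ :=
        abs_le_of_sq_le_sq (by rw [hnb]; exact (hle_sum e i).trans hee) (norm_nonneg _)
      linarith
    have h2 : |(A *ᵥ (G *ᵥ c)) i| ≤ √(costEnergy A c) := by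
      refine Real.abs_le_sqrt ?_
      rw [← hEn]
      exact hle_sum _ i
    rw [hs]
    have h3 := abs_sub (e i) (k * (A *ᵥ (G *ᵥ c)) i)
    rw [abs_mul, abs_of_pos hk0] at h3
    have h4 := mul_le_mul_of_nonneg_left h2 hk0.le
    linarith
  refine (isPathPoint_iff hp ht hc).2 ⟨hx ▸ (hGk _).sub ((hGk _).smul k), ?_⟩
  have hgrad : smoothGrad A b p t (initialPoint A b c p t) =
      (p * t ^ (p - 2)) • (e - k • (A *ᵥ (G *ᵥ c))) := by
    ext i
    have : smoothGrad A b p t (initialPoint A b c p t) i =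
        p * t ^ (p - 2) * residual A b (initialPoint A b c p t) i := if_pos (hbound i)
    rw [this, hs]
    simp
  rw [hgrad, mulVec_smul, mulVec_sub, mulVec_smul, hAe, hMG c hc, zero_sub, smul_neg, smul_smul]
  have : p * t ^ (p - 2) * k = 1 := by
    rw [hk, show p * t ^ (p - 2) * (1 / p * t ^ (2 - p)) = t ^ (p - 2) * t ^ (2 - p) by field_simp,
      ← Real.rpow_add ht]
    simp
  rw [this, one_smul, add_neg_cancel]

/-! ### Movement along the path -/

/-- Replace `f_{t'}'(b)` by the linear `p t^{p-2} b`. With `H = max(1, p-1) h` the error is at most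
`p H t^{p-1}`, so the product is at least `p t^{p-2} (δ² - H t δ)` for `δ = |b - a|`; complete the
square. -/
lemma smooth'_sub_mul_ge_of_small (hp : 1 < p) (ht : 0 < t) {a b : ℝ} (ha : |a| < t)
    (hb : |b| < t) :
    -(p * (max 1 (p - 1) * stepH p) ^ 2 * t ^ p / 4) ≤
      (smooth' p ((1 - stepH p) * t) b - smooth' p t a) * (b - a) := by
  set h := stepH p with hh
  set t' := (1 - h) * t with ht'def
  have ht' : 0 < t' := shrink_pos hp ht
  have ht'le : t' ≤ t := shrink_le hp ht
  have hk : 0 < t ^ (p - 2) := Real.rpow_pos_of_pos ht _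
  have h2 : t ^ p = t ^ (p - 2) * t ^ 2 := by
    rw [← Real.rpow_natCast, ← Real.rpow_add ht]; congr 1; push_cast; ring
  have herr : |b| * |max t' |b| ^ (p - 2) - t ^ (p - 2)| ≤
      max 1 (p - 1) * h * (t ^ (p - 2) * t) := by
    have hm1 : t' ≤ max t' |b| := le_max_left _ _
    have hm2 : max t' |b| ≤ t := max_le ht'le hb.le
    have hm0 : 0 < max t' |b| := ht'.trans_le hm1
    have hh0 : 0 < h := stepH_pos hp
    have hh1 : h ≤ 1 / 2 := stepH_le hp
    rcases le_total p 2 with hp2 | hp2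
    · have h3 : t ^ (p - 2) ≤ max t' |b| ^ (p - 2) :=
        Real.rpow_le_rpow_of_nonpos hm0 hm2 (by linarith)
      rw [abs_of_nonneg (sub_nonneg.2 h3), max_eq_left (show p - 1 ≤ 1 by linarith)]
      have h4 : max t' |b| * max t' |b| ^ (p - 2) ≤ t * t ^ (p - 2) := by
        rw [mul_comm, mul_comm t, show p - 2 = p - 1 - 1 by ring,
          rpow_sub_one_mul (by linarith) hm0.le, rpow_sub_one_mul (by linarith) ht.le]
        exact Real.rpow_le_rpow hm0.le hm2 (by linarith)
      have h5 : |b| * (max t' |b| ^ (p - 2) - t ^ (p - 2)) ≤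
          max t' |b| * (max t' |b| ^ (p - 2) - t ^ (p - 2)) :=
        mul_le_mul_of_nonneg_right (le_max_right _ _) (by linarith)
      have h6 : t' * t ^ (p - 2) ≤ max t' |b| * t ^ (p - 2) := by gcongr
      have h7 : t' * t ^ (p - 2) = t * t ^ (p - 2) - h * (t ^ (p - 2) * t) := by
        rw [ht'def]; ring
      linarith
    · have h3 : max t' |b| ^ (p - 2) ≤ t ^ (p - 2) :=
        Real.rpow_le_rpow hm0.le hm2 (by linarith)
      have h4 : t' ^ (p - 2) ≤ max t' |b| ^ (p - 2) :=
        Real.rpow_le_rpow ht'.le hm1 (by linarith)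
      rw [abs_of_nonpos (sub_nonpos.2 h3), max_eq_right (show 1 ≤ p - 1 by linarith)]
      have h5 : (1 - (p - 1) * h) * t ^ (p - 2) ≤ t' ^ (p - 2) := by
        rw [ht'def, Real.mul_rpow (by linarith) ht.le]
        have h6 := one_add_mul_self_le_rpow_one_add (s := -h) (p := p - 1) (by linarith)
          (by linarith)
        have h7 : (1 - h) ^ (p - 1) ≤ (1 - h) ^ (p - 2) :=
          Real.rpow_le_rpow_of_exponent_ge (by linarith) (by linarith) (by linarith)
        rw [← sub_eq_add_neg] at h6
        gcongr
        linarith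
      have h8 : |b| * (-(max t' |b| ^ (p - 2) - t ^ (p - 2))) ≤
          t * ((p - 1) * h * t ^ (p - 2)) := by
        refine mul_le_mul hb.le (by linarith) (by linarith) ht.le
      linarith
  have hlin : smooth' p t a = p * t ^ (p - 2) * a := if_pos ha.le
  rw [hlin, smooth'_eq]
  set X := max t' |b| ^ (p - 2) - t ^ (p - 2) with hX
  set H := max 1 (p - 1) * h with hH
  have e1 : (p * max t' |b| ^ (p - 2) * b - p * t ^ (p - 2) * a) * (b - a) =
      p * t ^ (p - 2) * (b - a) ^ 2 + p * (b * X * (b - a)) := by rw [hX]; ring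
  rw [e1, h2]
  have h3 : -(H * (t ^ (p - 2) * t) * |b - a|) ≤ b * X * (b - a) := by
    have := neg_abs_le (b * X * (b - a))
    rw [abs_mul, abs_mul] at this
    have := mul_le_mul_of_nonneg_right herr (abs_nonneg (b - a))
    linarith
  have h4 : p * -(H * (t ^ (p - 2) * t) * |b - a|) ≤ p * (b * X * (b - a)) := by gcongr
  rw [← sq_abs (b - a)]
  nlinarith [mul_nonneg (show 0 ≤ p * t ^ (p - 2) by positivity) (sq_nonneg (|b - a| - H * t / 2))]

/-- For `p ≤ 2` every slope on the interval is at least `p(p-1) M^{p-2}`. For `p ≥ 2` slopes near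
`0` can be much smaller, so the chord is used instead: with `|b| ≤ a` the coefficient of `b` in
`f_t'(b)` is at most `p a^{p-2}`, and opposite signs cost the factor `1/2` through `a - b ≤ 2a`. -/
lemma smooth'_sub_mul_ge (hp : 1 < p) (ht : 0 < t) (a b : ℝ) (hM : t ≤ max |a| |b|) :
    p * min (p - 1) (1 / 2) * (max |a| |b| ^ (p - 2) * (b - a) ^ 2) ≤
      (smooth' p t b - smooth' p t a) * (b - a) := by
  rcases le_total p 2 with hp2 | hp2
  · have key : ∀ a b : ℝ, t ≤ max |a| |b| → a ≤ b →
        p * min (p - 1) (1 / 2) * (max |a| |b| ^ (p - 2) * (b - a) ^ 2) ≤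
        (smooth' p t b - smooth' p t a) * (b - a) := by
      intro a b hM hab
      have hM0 := Real.rpow_pos_of_pos (ht.trans_le hM) (p - 2)
      have h1 := le_smooth'_sub (m := p * min (p - 1) (1 / 2) * max |a| |b| ^ (p - 2)) hp ht hab ?_
      · calc _ = p * min (p - 1) (1 / 2) * max |a| |b| ^ (p - 2) * (b - a) * (b - a) := by ring
          _ ≤ _ := mul_le_mul_of_nonneg_right h1 (by linarith)
      · intro x hx
        have h2 : max |a| |b| ^ (p - 2) ≤ max t |x| ^ (p - 2) :=
          Real.rpow_le_rpow_of_nonpos (lt_max_of_lt_left ht)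
            (max_le hM (abs_le_max_abs_abs hx.1 hx.2)) (by linarith)
        rw [min_eq_right (show p - 1 ≤ 1 by linarith)]
        have h3 : min (p - 1) (1 / 2) ≤ p - 1 := min_le_left _ _
        have h4 : 0 ≤ p - 1 := by linarith
        gcongr
    rcases le_total a b with hab | hab
    · exact key a b hM hab
    · have := key b a (by rwa [max_comm]) hab
      rw [max_comm] at this
      nlinarith
  · rw [min_eq_right (by linarith)]
    revert a b
    refine pair_induction (fun a b h hM => ?_) (fun a b h hM => ?_) fun a b h hM => ?_
    · rw [max_comm] at hM ⊢
      have := h hM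
      nlinarith
    · rw [abs_neg, abs_neg] at hM ⊢
      have := h hM
      rw [smooth'_eq, smooth'_eq, abs_neg, abs_neg]
      rw [smooth'_eq, smooth'_eq] at this
      nlinarith
    · have ha : 0 ≤ a := (abs_nonneg b).trans h
      rw [abs_of_nonneg ha, max_eq_left h] at hM ⊢
      rw [smooth'_eq, smooth'_eq, abs_of_nonneg ha, max_eq_right hM]
      have h1 : max t |b| ^ (p - 2) ≤ a ^ (p - 2) :=
        Real.rpow_le_rpow (ht.le.trans (le_max_left _ _)) (max_le hM h) (by linarith)
      have h0 : 0 < max t |b| ^ (p - 2) := Real.rpow_pos_of_pos (lt_max_of_lt_left ht) _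
      have hba := abs_le.1 h
      have hkey : a ^ (p - 2) / 2 * (a - b) ≤ a ^ (p - 2) * a - max t |b| ^ (p - 2) * b := by
        rcases le_total 0 b with hb | hb
        · nlinarith
        · nlinarith
      have := mul_le_mul_of_nonneg_left
        (mul_le_mul_of_nonneg_right hkey (show 0 ≤ a - b by linarith)) (show 0 ≤ p by linarith)
      linarith

lemma smooth'_congr_of_le {t' s : ℝ} (h : t ≤ |s|) (h' : t' ≤ |s|) :
    smooth' p t s = smooth' p t' s := by
  rw [smooth'_of_le h, smooth'_of_le h']

/-- Where `|s| ≥ t` the derivatives for both parameters coincide, so the two terms can be written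
with one common parameter. -/
lemma smooth'_sub_mul_ge_of_large (hp : 1 < p) (ht : 0 < t) {a b : ℝ}
    (hM : t ≤ |a| ∨ t ≤ |b|) :
    p * min (p - 1) (1 / 2) * (max |a| |b| ^ (p - 2) * (b - a) ^ 2) ≤
      (smooth' p ((1 - stepH p) * t) b - smooth' p t a) * (b - a) := by
  have ht' := shrink_pos hp ht
  have hle := shrink_le hp ht
  rcases hM with h | h
  · rw [smooth'_congr_of_le h (hle.trans h)]
    exact smooth'_sub_mul_ge hp ht' a b (hle.trans (h.trans (le_max_left _ _)))
  · rw [← smooth'_congr_of_le h (hle.trans h)]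
    exact smooth'_sub_mul_ge hp ht a b (h.trans (le_max_right _ _))

lemma four_le_ratio (hp : 1 < p) : 4 ≤ p ^ 2 / (p - 1) := by
  rw [le_div_iff₀ (by linarith)]
  nlinarith [sq_nonneg (p - 2)]

lemma drift_constant_le (hp : 1 < p) :
    (p - 1) ^ 2 * (max 2 (p / 2) ^ 2 * max 1 (p - 1) ^ 2) ≤ 4 * min (p - 1) (1 / 2) * p ^ 6 := by
  rcases le_total p 2 with h2 | h2
  · rw [max_eq_left (by linarith), max_eq_left (by linarith)]
    have hp6 : 1 ≤ p ^ 6 := one_le_pow₀ hp.le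
    rcases le_total (p - 1) (1 / 2) with h | h
    · rw [min_eq_left h]
      nlinarith
    · rw [min_eq_right h]
      have : (3 / 2 : ℝ) ^ 6 ≤ p ^ 6 := by gcongr; linarith
      nlinarith
  · rw [max_eq_right (show 1 ≤ p - 1 by linarith), min_eq_right (by linarith)]
    have h3 : max 2 (p / 2) ≤ p := max_le h2 (by linarith)
    have h4 : max 2 (p / 2) ^ 2 ≤ p ^ 2 := pow_le_pow_left₀ (by positivity) h3 2
    have h5 : (p - 1) ^ 2 ≤ p ^ 2 := pow_le_pow_left₀ (by linarith) (by linarith) 2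
    calc (p - 1) ^ 2 * (max 2 (p / 2) ^ 2 * (p - 1) ^ 2) ≤ p ^ 2 * (p ^ 2 * p ^ 2) := by gcongr
      _ ≤ _ := by nlinarith [show 0 ≤ p ^ 6 by positivity]

/-- In the vanishing sum of products the other terms are at least `-p H² t^p/4` each, so the `i`-th
is at most `n p H² t^p/4`. If the coordinate is large at one of the two times, this term controls
`M^{p-2}(s'_i - s_i)²`, hence the difference of the powers by `abs_spow_sub_le`; `drift_constant_le`
collects the constants. -/
lemma IsPathPoint.drift (hp : 1 < p) (ht : 0 < t) (hc : KerOrth A c) {x x' : Fin d → ℝ}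
    (hx : IsPathPoint A b c p t x) (hx' : IsPathPoint A b c p ((1 - stepH p) * t) x') (i : Fin n) :
    |spow (residual A b x' i) (p / 2) - spow (residual A b x i) (p / 2)| ≤
      p ^ 3 / (p - 1) * √(n : ℝ) * stepH p * t ^ (p / 2) := by
  have hτ : 0 < t ^ (p / 2) := Real.rpow_pos_of_pos ht _
  have hτ2 : (t ^ (p / 2)) ^ 2 = t ^ p := by
    rw [← Real.rpow_natCast, ← Real.rpow_mul ht.le]; congr 1; push_cast; ring
  have hp1 : 0 < p - 1 := by linarith
  have hh : 0 < stepH p := stepH_pos hp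
  have hn : (1 : ℝ) ≤ n := by exact_mod_cast (Fin.pos i)
  set s := residual A b x with hs
  set s' := residual A b x' with hs'
  have hsum := sum_grad_sub_mul_residual_sub ((isPathPoint_iff hp ht hc).1 hx).2
    ((isPathPoint_iff hp (shrink_pos hp ht) hc).1 hx').2
  rw [← hs, ← hs'] at hsum
  have hlow : ∀ j, -(p * (max 1 (p - 1) * stepH p) ^ 2 * t ^ p / 4) ≤
      (smooth' p ((1 - stepH p) * t) (s' j) - smooth' p t (s j)) * (s' j - s j) := by
    intro j
    by_cases hj : |s j| < t ∧ |s' j| < t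
    · exact smooth'_sub_mul_ge_of_small hp ht hj.1 hj.2
    · rw [not_and_or, not_lt, not_lt] at hj
      refine le_trans ?_ (smooth'_sub_mul_ge_of_large hp ht hj)
      have h1 : 0 ≤ p * (max 1 (p - 1) * stepH p) ^ 2 * t ^ p / 4 := by positivity
      have h2 : 0 ≤ p * min (p - 1) (1 / 2) * (max |s j| |s' j| ^ (p - 2) * (s' j - s j) ^ 2) := by
        positivity
      linarith
  -- If both values are small, the difference of the powers is trivially at most `2 t^{p/2}`, and
  -- the claimed bound is at least that because `p²/(p-1) ≥ 4` and `n ≥ 1`.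
  by_cases hi : |s i| < t ∧ |s' i| < t
  · have h1 := abs_sub (spow (s' i) (p / 2)) (spow (s i) (p / 2))
    rw [abs_spow (by positivity), abs_spow (by positivity)] at h1
    have h2 : |s i| ^ (p / 2) ≤ t ^ (p / 2) :=
      Real.rpow_le_rpow (abs_nonneg _) hi.1.le (by linarith)
    have h3 : |s' i| ^ (p / 2) ≤ t ^ (p / 2) :=
      Real.rpow_le_rpow (abs_nonneg _) hi.2.le (by linarith)
    have h4 : 2 ≤ p ^ 3 / (p - 1) * √(n : ℝ) * stepH p := by
      have e : p ^ 3 / (p - 1) * √(n : ℝ) * stepH p = p ^ 2 / (p - 1) / 2 * √(n : ℝ) := by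
        unfold stepH; field_simp
      rw [e]
      have h5 := four_le_ratio hp
      have h6 : 1 ≤ √(n : ℝ) := Real.one_le_sqrt.2 hn
      nlinarith
    nlinarith
  · rw [not_and_or, not_lt, not_lt] at hi
    have h1 := smooth'_sub_mul_ge_of_large hp ht hi
    set τ := t ^ (p / 2) with hτdef
    set H := max 1 (p - 1) * stepH p with hH
    set M := max |s i| |s' i| with hM
    have hM0 : 0 ≤ M := (abs_nonneg _).trans (le_max_left _ _)
    have hMp : (M ^ (p / 2 - 1)) ^ 2 = M ^ (p - 2) := by
      rw [← Real.rpow_natCast, ← Real.rpow_mul hM0]; congr 1; push_cast; ring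
    have h2 : (smooth' p ((1 - stepH p) * t) (s' i) - smooth' p t (s i)) * (s' i - s i) ≤
        n * (p * H ^ 2 * t ^ p / 4) := by
      rw [← Finset.add_sum_erase _ _ (Finset.mem_univ i)] at hsum
      have h3 := Finset.card_nsmul_le_sum (Finset.univ.erase i) _ _ fun j _ => hlow j
      have h4 : ((Finset.univ.erase i).card : ℝ) ≤ n := by
        exact_mod_cast (Finset.card_erase_le).trans (by simp)
      rw [nsmul_eq_mul] at h3
      have h5 : 0 ≤ p * H ^ 2 * t ^ p / 4 := by positivity
      nlinarith [mul_le_mul_of_nonneg_right h4 h5]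
    have hE : 4 * min (p - 1) (1 / 2) * (M ^ (p / 2 - 1) * |s' i - s i|) ^ 2 ≤
        n * H ^ 2 * t ^ p := by
      rw [mul_pow, hMp, sq_abs]
      have h3 := h1.trans h2
      have : p * (4 * min (p - 1) (1 / 2) * (M ^ (p - 2) * (s' i - s i) ^ 2)) ≤
          p * (n * H ^ 2 * t ^ p) := by linarith
      exact le_of_mul_le_mul_left this (by linarith)
    have hup := abs_spow_sub_le (r := p / 2) (by linarith) (s i) (s' i)
    rw [← hM, abs_sub_comm, abs_sub_comm (s i), mul_assoc] at hup
    refine hup.trans (abs_le_of_sq_le_sq' ?_ (by positivity)).2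
    set E := M ^ (p / 2 - 1) * |s' i - s i| with hEdef
    have hmin : 0 < min (p - 1) (1 / 2) := lt_min hp1 (by norm_num)
    have hfin : 4 * min (p - 1) (1 / 2) * (max 2 (p / 2) * E) ^ 2 ≤
        4 * min (p - 1) (1 / 2) * (p ^ 3 / (p - 1) * √(n : ℝ) * stepH p * τ) ^ 2 := by
      have hc1 := drift_constant_le hp
      have hc2 : max 2 (p / 2) ^ 2 * max 1 (p - 1) ^ 2 ≤
          4 * min (p - 1) (1 / 2) * (p ^ 3 / (p - 1)) ^ 2 := by
        rw [div_pow, ← mul_div_assoc, le_div_iff₀ (by positivity)]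
        nlinarith
      calc 4 * min (p - 1) (1 / 2) * (max 2 (p / 2) * E) ^ 2
          = max 2 (p / 2) ^ 2 * (4 * min (p - 1) (1 / 2) * E ^ 2) := by ring
        _ ≤ max 2 (p / 2) ^ 2 * (n * H ^ 2 * t ^ p) := by gcongr
        _ = max 2 (p / 2) ^ 2 * max 1 (p - 1) ^ 2 * (n * stepH p ^ 2 * t ^ p) := by rw [hH]; ring
        _ ≤ 4 * min (p - 1) (1 / 2) * (p ^ 3 / (p - 1)) ^ 2 * (n * stepH p ^ 2 * t ^ p) := by gcongr
        _ = _ := by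
          rw [← hτ2, mul_pow, mul_pow, mul_pow, Real.sq_sqrt (by linarith)]; ring
    exact le_of_mul_le_mul_left hfin (by linarith)

end Path

/-! ### One phase -/

lemma one_le_kappa {p : ℝ} (hp : 1 < p) (n : ℕ) : 1 ≤ kappa p n := by
  rw [kappa_eq]
  have h1 : 1 ≤ (3 + 2 * (p ^ 3 / (p - 1) * √(n : ℝ) * stepH p)) ^ |2 - 4 / p| :=
    Real.one_le_rpow (by linarith [drift_nonneg hp n]) (abs_nonneg _)
  have h2 : 1 ≤ 4 * p ^ 2 / (p - 1) := by
    rw [mul_div_assoc]; linarith [four_le_ratio hp]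
  nlinarith

section Phase

variable {n d m : ℕ} {A : Matrix (Fin n) (Fin d) ℝ} {b : Fin n → ℝ} {c : Fin d → ℝ} {p t : ℝ}
  {x : Fin d → ℝ} {P : Matrix (Fin d) (Fin m) ℝ}

lemma gradient_precondObjective (hp : 1 < p) (ht : 0 < t) (y : EuclideanSpace ℝ (Fin m)) :
    gradient (precondObjective A b c p t x P) y =
      WithLp.toLp 2 (Pᵀ *ᵥ (c + Aᵀ *ᵥ extendGrad A b x p t (P *ᵥ y.ofLp))) :=
  (hasGradientAt_precondObjective A b c x P hp ht y).gradient

lemma inner_gradient_precondObjective (hp : 1 < p) (ht : 0 < t)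
    (z v : EuclideanSpace ℝ (Fin m)) :
    inner ℝ (gradient (precondObjective A b c p t x P) z) v =
      c ⬝ᵥ (P *ᵥ v.ofLp) +
        ∑ i, extendGrad A b x p t (P *ᵥ z.ofLp) i * (A *ᵥ (P *ᵥ v.ofLp)) i := by
  rw [gradient_precondObjective hp ht, EuclideanSpace.inner_eq_star_dotProduct]
  simp only [star_trivial]
  rw [dotProduct_comm v.ofLp, transpose_mulVec_dotProduct, add_dotProduct,
    transpose_mulVec_dotProduct]
  rfl

/-- Sum over the coordinates the quadratic minorants with curvature `w_i`; by
`norm_sq_of_mem_iterSpace` the quadratic terms add up to the Euclidean norm. -/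
lemma precondObjective_ge (hp : 1 < p) (ht : 0 < t) (hP : P * Pᵀ = pinv (gram A b p t x))
    {z u : EuclideanSpace ℝ (Fin m)} (hz : z ∈ iterSpace P) (hu : u ∈ iterSpace P) :
    precondObjective A b c p t x P z +
      inner ℝ (gradient (precondObjective A b c p t x P) z) (u - z) + 1 / 2 * ‖u - z‖ ^ 2 ≤
      precondObjective A b c p t x P u := by
  rw [inner_gradient_precondObjective hp ht,
    norm_sq_of_mem_iterSpace hP ((iterSpace P).sub_mem hu hz)]
  have h1 := fun i => quadratic_le (hasDerivAt_extend hp (shrink_pos hp ht)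
      (lower_le_upper (γ := radius p n t) (s := residual A b x i) hp (radius_pos hp n ht).le))
    (le_extend'_sub (m := weight p t (residual A b x) i) hp (shrink_pos hp ht)
      (lower_le_upper hp (radius_pos hp n ht).le)
      fun y hy => weight_le_of_box hp ht _ i ((mem_box_iff hp).1 hy))
    (residual A b (P *ᵥ z.ofLp) i) (residual A b (P *ᵥ u.ofLp) i)
  have h2 := Finset.sum_le_sum fun i (_ : i ∈ Finset.univ) => h1 i
  simp only [residual_sub_residual, ← mulVec_sub] at h2
  rw [Finset.sum_add_distrib, Finset.sum_add_distrib] at h2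
  unfold precondObjective
  rw [WithLp.ofLp_sub, mulVec_sub, dotProduct_sub, ← mulVec_sub, Finset.mul_sum]
  have h3 : ∀ i, 1 / 2 * (weight p t (residual A b x) i *
      (A *ᵥ (P *ᵥ (u.ofLp - z.ofLp))) i ^ 2) =
      weight p t (residual A b x) i / 2 * (A *ᵥ (P *ᵥ (u.ofLp - z.ofLp))) i ^ 2 :=
    fun i => by ring
  simp only [h3]
  unfold extendGrad
  linarith

lemma precondObjective_le (hp : 1 < p) (ht : 0 < t) (hP : P * Pᵀ = pinv (gram A b p t x))
    {z u : EuclideanSpace ℝ (Fin m)} (hz : z ∈ iterSpace P) (hu : u ∈ iterSpace P) :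
    precondObjective A b c p t x P u ≤ precondObjective A b c p t x P z +
      inner ℝ (gradient (precondObjective A b c p t x P) z) (u - z) +
        kappa p n / 2 * ‖u - z‖ ^ 2 := by
  rw [inner_gradient_precondObjective hp ht,
    norm_sq_of_mem_iterSpace hP ((iterSpace P).sub_mem hu hz)]
  have h1 := fun i => le_quadratic (hasDerivAt_extend hp (shrink_pos hp ht)
      (lower_le_upper (γ := radius p n t) (s := residual A b x i) hp (radius_pos hp n ht).le))
    (extend'_sub_le (L := kappa p n * weight p t (residual A b x) i) hp (shrink_pos hp ht)
      (lower_le_upper hp (radius_pos hp n ht).le)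
      fun y hy => le_kappa_mul_weight_of_box hp ht _ i ((mem_box_iff hp).1 hy))
    (residual A b (P *ᵥ z.ofLp) i) (residual A b (P *ᵥ u.ofLp) i)
  have h2 := Finset.sum_le_sum fun i (_ : i ∈ Finset.univ) => h1 i
  simp only [residual_sub_residual, ← mulVec_sub] at h2
  rw [Finset.sum_add_distrib, Finset.sum_add_distrib] at h2
  unfold precondObjective
  rw [WithLp.ofLp_sub, mulVec_sub, dotProduct_sub, ← mulVec_sub, Finset.mul_sum]
  have h3 : ∀ i, kappa p n / 2 * (weight p t (residual A b x) i *
      (A *ᵥ (P *ᵥ (u.ofLp - z.ofLp))) i ^ 2) =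
      kappa p n * weight p t (residual A b x) i / 2 *
        (A *ᵥ (P *ᵥ (u.ofLp - z.ofLp))) i ^ 2 :=
    fun i => by ring
  simp only [h3]
  unfold extendGrad
  linarith

/-- A point at `p/2`-th power distance exactly `ρ`, on the way from `a` to `b`. -/
lemma exists_between_spow {a b ρ : ℝ} (hp : 1 < p) (hρ : 0 ≤ ρ)
    (h : ρ < |spow b (p / 2) - spow a (p / 2)|) :
    ∃ v, |spow v (p / 2) - spow a (p / 2)| = ρ ∧ (v - a) ^ 2 ≤ (b - a) ^ 2 := by
  have h2 : 2 / p * (p / 2) = 1 := by field_simp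
  have hr : 0 < p / 2 := by linarith
  have hlt : ∀ u v : ℝ, spow u (p / 2) < spow v (p / 2) → u < v := fun u v huv => by
    by_contra hle
    exact absurd (spow_mono hr (not_lt.1 hle)) (not_le.2 huv)
  have hle : ∀ u v : ℝ, spow u (p / 2) ≤ spow v (p / 2) → u ≤ v := fun u v huv => by
    have h1 : p / 2 * (2 / p) = 1 := by field_simp
    have := spow_mono (show 0 < 2 / p by positivity) huv
    rwa [spow_spow hr h1, spow_spow hr h1] at this
  rcases lt_abs.1 h with h | h
  · refine ⟨spow (spow a (p / 2) + ρ) (2 / p), ?_, ?_⟩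
    · rw [spow_spow (by positivity) h2, add_sub_cancel_left, abs_of_nonneg hρ]
    · have h3 := hlt (spow (spow a (p / 2) + ρ) (2 / p)) b
        (by rw [spow_spow (by positivity) h2]; linarith)
      have h4 := hle a (spow (spow a (p / 2) + ρ) (2 / p))
        (by rw [spow_spow (by positivity) h2]; linarith)
      nlinarith
  · refine ⟨spow (spow a (p / 2) - ρ) (2 / p), ?_, ?_⟩
    · rw [spow_spow (by positivity) h2, sub_sub_cancel_left, abs_neg, abs_of_nonneg hρ]
    · have h3 := hlt b (spow (spow a (p / 2) - ρ) (2 / p))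
        (by rw [spow_spow (by positivity) h2]; linarith)
      have h4 := hle (spow (spow a (p / 2) - ρ) (2 / p)) a
        (by rw [spow_spow (by positivity) h2]; linarith)
      nlinarith

/-- The preimage `w` of `x(t')` minimizes `g_t` on the range of `Pᵀ`. The initial gap is at most
`(κ/2)‖y₀ - w‖²`, which the box bounds; after `T` steps strong convexity turns the small gap into a
small weighted distance, hence into closeness of each coordinate. The margin `t^{p/2}/2` in `hclose`
keeps the result inside the box, where `g_t` equals the smoothed objective. -/
lemma phase_spec (hp : 1 < p) (ht : 0 < t) (hc : KerOrth A c) (hx : KerOrth A x)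
    (hP : P * Pᵀ = pinv (gram A b p t x)) {x' : Fin d → ℝ}
    (hx' : IsPathPoint A b c p ((1 - stepH p) * t) x')
    (hclose : ∀ i, |spow (residual A b x' i) (p / 2) - spow (residual A b x i) (p / 2)| ≤
      radius p n t - t ^ (p / 2) / 2) {T : ℕ}
    (hT : Real.exp (-(T / √(kappa p n))) * (2 * kappa p n * n * (p - 1) * radius p n t ^ 2) ≤
      ((1 - stepH p) * t) ^ p / (1024 * p ^ 2 * kappa p n)) :
    KerOrth A (phase A b c p t T P x) ∧
    (∀ i, |spow (residual A b (phase A b c p t T P x) i) (p / 2) -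
      spow (residual A b x' i) (p / 2)| ≤ ((1 - stepH p) * t) ^ (p / 2) / 2) ∧
    smoothObjective A b c p ((1 - stepH p) * t) (phase A b c p t T P x) ≤
      smoothObjective A b c p ((1 - stepH p) * t) x' +
        ((1 - stepH p) * t) ^ p / (1024 * p ^ 2 * kappa p n) := by
  obtain ⟨hk', hstat⟩ := (isPathPoint_iff hp (shrink_pos hp ht) hc).1 hx'
  have hκ := one_le_kappa hp n
  have hτ : 0 < t ^ (p / 2) := Real.rpow_pos_of_pos ht _
  set t' := (1 - stepH p) * t with ht'def
  have ht' : 0 < t' := shrink_pos hp ht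
  have hττ : t' ^ (p / 2) ≤ t ^ (p / 2) :=
    Real.rpow_le_rpow ht'.le (shrink_le hp ht) (by linarith)
  have hbox : ∀ i, |spow (residual A b x' i) (p / 2) - spow (residual A b x i) (p / 2)| ≤
      radius p n t := fun i => (hclose i).trans (by linarith)
  set g := precondObjective A b c p t x P with hg
  set w := preimage A b p t x P x' with hw
  set y₀ := preimage A b p t x P x with hy₀
  have hPw : P *ᵥ w.ofLp = x' := mulVec_preimage hp ht hP hk'
  have hPy₀ : P *ᵥ y₀.ofLp = x := mulVec_preimage hp ht hP hx
  have hwV : w ∈ iterSpace P := preimage_mem _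
  have hyV : y₀ ∈ iterSpace P := preimage_mem _
  -- The residual of `x(t')` lies in the box, where the extension and `f_{t'}` have the same
  -- derivative; stationarity of `x(t')` does the rest.
  have hgw : gradient g w = 0 := by
    rw [hg, gradient_precondObjective hp ht, hPw]
    have : extendGrad A b x p t x' = smoothGrad A b p t' x' := by
      ext i
      exact extend'_of_mem ((mem_box_iff hp).2 (hbox i))
    rw [this, hstat, mulVec_zero]
    rfl
  have hlow : ∀ u ∈ iterSpace P, 1 / 2 * ‖u - w‖ ^ 2 ≤ g u - g w := fun u hu => by
    have := precondObjective_ge (c := c) hp ht hP hwV hu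
    rw [← hg, hgw, inner_zero_left] at this
    linarith
  have hup : g y₀ - g w ≤ kappa p n / 2 * ‖y₀ - w‖ ^ 2 := by
    have := precondObjective_le (c := c) hp ht hP hwV hyV
    rw [← hg, hgw, inner_zero_left] at this
    linarith
  have hnorm : ∀ u ∈ iterSpace P, ‖u - w‖ ^ 2 = ∑ i, weight p t (residual A b x) i *
      (residual A b (P *ᵥ u.ofLp) i - residual A b x' i) ^ 2 := fun u hu => by
    rw [norm_sq_of_mem_iterSpace hP ((iterSpace P).sub_mem hu hwV)]
    refine Finset.sum_congr rfl fun i _ => ?_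
    rw [residual_sub_residual, WithLp.ofLp_sub, mulVec_sub P, hPw]
  have hstart : ‖y₀ - w‖ ^ 2 ≤ n * (2 * (p - 1) * radius p n t ^ 2) := by
    rw [hnorm _ hyV, hPy₀]
    have := Finset.sum_le_sum fun i (_ : i ∈ Finset.univ) => weight_mul_sq_le hp ht _ i (hbox i)
    simpa using this
  obtain ⟨hTV, hTle⟩ := agd_sub_le (g := g) hκ (iterSpace P)
    (fun z _ => by
      rw [hg, gradient_precondObjective hp ht]
      exact ⟨_, rfl⟩)
    (fun z hz u hu => precondObjective_ge (c := c) hp ht hP hz hu)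
    (fun z hz u hu => precondObjective_le (c := c) hp ht hP hz hu) hwV hyV
    (by have := hlow y₀ hyV; nlinarith [sq_nonneg ‖y₀ - w‖]) T
  have hphase : phase A b c p t T P x = P *ᵥ (agd g (kappa p n) T y₀).ofLp := rfl
  set yT := agd g (kappa p n) T y₀ with hyT
  have hgap : g yT - g w ≤ t' ^ p / (1024 * p ^ 2 * kappa p n) := by
    refine hTle.trans (le_trans ?_ hT)
    refine mul_le_mul_of_nonneg_left ?_ (Real.exp_pos _).le
    nlinarith [mul_le_mul_of_nonneg_left hstart (show 0 ≤ kappa p n by linarith),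
      mul_le_mul_of_nonneg_right hκ (sq_nonneg ‖y₀ - w‖)]
  have hcoord : ∀ i, |spow (residual A b (P *ᵥ yT.ofLp) i) (p / 2) -
      spow (residual A b x' i) (p / 2)| ≤ t' ^ (p / 2) / 2 := by
    intro i
    by_contra hcon
    rw [not_le] at hcon
    have hτ' : 0 < t' ^ (p / 2) := Real.rpow_pos_of_pos ht' _
    -- The output coordinate may lie outside the box, where the weights say nothing about powers.
    -- Stopping on the way to it at distance exactly `t'^{p/2}/2` gives a point of the box that is
    -- no farther from `s_i(x')`.
    obtain ⟨v, hv1, hv2⟩ := exists_between_spow hp (by positivity) hcon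
    have hvbox : |spow v (p / 2) - spow (residual A b x i) (p / 2)| ≤ radius p n t := by
      have := abs_sub_le (spow v (p / 2)) (spow (residual A b x' i) (p / 2))
        (spow (residual A b x i) (p / 2))
      linarith [hclose i]
    have h1 := le_weight_mul_sq hp ht (residual A b x) i hvbox (hbox i) hv1.ge
    have hwpos := weight_pos hp ht (residual A b x) i
    have h2 : weight p t (residual A b x) i *
        (residual A b (P *ᵥ yT.ofLp) i - residual A b x' i) ^ 2 ≤ ‖yT - w‖ ^ 2 := by
      rw [hnorm _ hTV]
      exact Finset.single_le_sum (f := fun i => weight p t (residual A b x) i *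
        (residual A b (P *ᵥ yT.ofLp) i - residual A b x' i) ^ 2)
        (fun j _ => mul_nonneg (weight_pos hp ht _ j).le (sq_nonneg _)) (Finset.mem_univ i)
    have h3 := hlow yT hTV
    have h4 : weight p t (residual A b x) i * (v - residual A b x' i) ^ 2 ≤
        2 * (t' ^ p / (1024 * p ^ 2 * kappa p n)) := by
      have := mul_le_mul_of_nonneg_left hv2 hwpos.le
      linarith
    have ht'p : 0 < t' ^ p := Real.rpow_pos_of_pos ht' _
    have h5 : t' ^ p ≤ t' ^ p / 2 := by
      calc t' ^ p ≤ 256 * p ^ 2 * kappa p n *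
            (weight p t (residual A b x) i * (v - residual A b x' i) ^ 2) := by
              rw [← ht'def] at h1; linarith
        _ ≤ 256 * p ^ 2 * kappa p n * (2 * (t' ^ p / (1024 * p ^ 2 * kappa p n))) := by gcongr
        _ = _ := by field_simp; norm_num
    linarith
  refine ⟨hphase ▸ kerOrth_of_mem_iterSpace hP hTV, hphase ▸ hcoord, ?_⟩
  have hval : ∀ u : EuclideanSpace ℝ (Fin m), (∀ i, |spow (residual A b (P *ᵥ u.ofLp) i) (p / 2) -
      spow (residual A b x i) (p / 2)| ≤ radius p n t) →
      g u = smoothObjective A b c p t' (P *ᵥ u.ofLp) := fun u hu => by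
    rw [hg]
    unfold precondObjective smoothObjective
    congr 1
    exact Finset.sum_congr rfl fun i _ => extend_of_mem ((mem_box_iff hp).2 (hu i))
  have hgT := hval yT fun i => by
    have := abs_sub_le (spow (residual A b (P *ᵥ yT.ofLp) i) (p / 2))
      (spow (residual A b x' i) (p / 2)) (spow (residual A b x i) (p / 2))
    linarith [hclose i, hcoord i]
  have hgw' := hval w (by rw [hPw]; exact hbox)
  rw [hPw] at hgw'
  rw [hphase, ← hgT, ← hgw']
  linarith

end Phase

/-! ### The number of iterations per phase -/

lemma le_ratio {p : ℝ} (hp : 1 < p) : p ≤ p ^ 2 / (p - 1) := by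
  rw [le_div_iff₀ (by linarith)]
  nlinarith

lemma drift_eq {p : ℝ} (hp : 1 < p) (n : ℕ) :
    p ^ 3 / (p - 1) * √(n : ℝ) * stepH p = p ^ 2 / (p - 1) / 2 * √(n : ℝ) := by
  have : p - 1 ≠ 0 := by linarith
  unfold stepH
  field_simp

lemma kappa_base_le {p : ℝ} (hp : 1 < p) {n : ℕ} (hn : 1 ≤ n) :
    1 ≤ 3 + 2 * (p ^ 3 / (p - 1) * √(n : ℝ) * stepH p) ∧
      3 + 2 * (p ^ 3 / (p - 1) * √(n : ℝ) * stepH p) ≤ 2 * (p ^ 2 / (p - 1)) * √(n : ℝ) := by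
  have hq := four_le_ratio hp
  have hn' : 1 ≤ √(n : ℝ) := Real.one_le_sqrt.2 (by exact_mod_cast hn)
  rw [drift_eq hp]
  constructor <;> nlinarith

lemma abs_exponent_le {p : ℝ} (hp : 1 < p) : |2 - 4 / p| ≤ 2 := by
  have h1 : 4 / p ≤ 4 := by rw [div_le_iff₀ (by linarith)]; linarith
  have h2 : 0 < 4 / p := by positivity
  rw [abs_le]
  constructor <;> linarith

/-- A crude polynomial bound; `κ` enters the required accuracy only through a logarithm. The precise
exponent of `n` matters for the contraction rate and is kept in `sqrt_kappa_le`. -/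
lemma kappa_le {p : ℝ} (hp : 1 < p) {n : ℕ} (hn : 1 ≤ n) :
    kappa p n ≤ 16 * (p ^ 2 / (p - 1)) ^ 3 * n := by
  obtain ⟨h1, h2⟩ := kappa_base_le hp hn
  have hq := four_le_ratio hp
  rw [kappa_eq, mul_div_assoc]
  calc 4 * (p ^ 2 / (p - 1)) * (3 + 2 * (p ^ 3 / (p - 1) * √(n : ℝ) * stepH p)) ^ |2 - 4 / p|
      ≤ 4 * (p ^ 2 / (p - 1)) * (3 + 2 * (p ^ 3 / (p - 1) * √(n : ℝ) * stepH p)) ^ (2 : ℝ) := by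
        gcongr
        exact abs_exponent_le hp
    _ ≤ 4 * (p ^ 2 / (p - 1)) * (2 * (p ^ 2 / (p - 1)) * √(n : ℝ)) ^ (2 : ℝ) := by
        gcongr
    _ = _ := by
        rw [Real.rpow_two, mul_pow, Real.sq_sqrt (by positivity)]; ring

lemma sqrt_kappa_le {p : ℝ} (hp : 1 < p) {n : ℕ} (hn : 1 ≤ n) :
    √(kappa p n) ≤ 4 * (p ^ 2 / (p - 1)) ^ 2 * (n : ℝ) ^ |1 / 2 - 1 / p| := by
  obtain ⟨h1, h2⟩ := kappa_base_le hp hn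
  have hq := four_le_ratio hp
  have hn0 : (0 : ℝ) ≤ n := Nat.cast_nonneg n
  refine Real.sqrt_le_iff.2 ⟨by positivity, ?_⟩
  set q := p ^ 2 / (p - 1) with hqdef
  have hN : √(n : ℝ) ^ |2 - 4 / p| = ((n : ℝ) ^ |1 / 2 - 1 / p|) ^ 2 := by
    rw [Real.sqrt_eq_rpow, ← Real.rpow_mul hn0, ← Real.rpow_natCast, ← Real.rpow_mul hn0]
    congr 1
    rw [show 2 - 4 / p = 4 * (1 / 2 - 1 / p) by ring, abs_mul]
    norm_num
    ring
  have h3 : (2 * q) ^ |2 - 4 / p| ≤ (2 * q) ^ 2 := by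
    rw [← Real.rpow_two]
    exact Real.rpow_le_rpow_of_exponent_le (by linarith) (abs_exponent_le hp)
  rw [kappa_eq, mul_div_assoc, ← hqdef]
  calc 4 * q * (3 + 2 * (p ^ 3 / (p - 1) * √(n : ℝ) * stepH p)) ^ |2 - 4 / p|
      ≤ 4 * q * (2 * q * √(n : ℝ)) ^ |2 - 4 / p| := by gcongr
    _ = 4 * q * ((2 * q) ^ |2 - 4 / p| * ((n : ℝ) ^ |1 / 2 - 1 / p|) ^ 2) := by
        rw [Real.mul_rpow (by positivity) (Real.sqrt_nonneg _), hN]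
    _ ≤ 4 * q * ((2 * q) ^ 2 * ((n : ℝ) ^ |1 / 2 - 1 / p|) ^ 2) := by gcongr
    _ ≤ q * (4 * q * ((2 * q) ^ 2 * ((n : ℝ) ^ |1 / 2 - 1 / p|) ^ 2)) := by
        exact le_mul_of_one_le_left (by positivity) (by linarith)
    _ = _ := by ring

lemma radius_sq_le {p t : ℝ} (hp : 1 < p) (ht : 0 < t) {n : ℕ} (hn : 1 ≤ n) :
    radius p n t ^ 2 ≤ 2 * (p ^ 2 / (p - 1)) ^ 2 * n * ((1 - stepH p) * t) ^ p := by
  have hq := four_le_ratio hp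
  have hn' : 1 ≤ √(n : ℝ) := Real.one_le_sqrt.2 (by exact_mod_cast hn)
  have hτ : 0 < t ^ (p / 2) := Real.rpow_pos_of_pos ht _
  have hτ2 : (t ^ (p / 2)) ^ 2 = t ^ p := by
    rw [← Real.rpow_natCast, ← Real.rpow_mul ht.le]; congr 1; push_cast; ring
  have h1 : radius p n t ≤ p ^ 2 / (p - 1) * √(n : ℝ) * t ^ (p / 2) := by
    unfold radius
    rw [drift_eq hp]
    gcongr
    nlinarith
  have h2 := pow_le_pow_left₀ (radius_pos hp n ht).le h1 2
  rw [mul_pow, mul_pow, Real.sq_sqrt (by positivity), hτ2] at h2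
  have h3 := half_mul_rpow_le hp ht
  have h4 : 0 ≤ (p ^ 2 / (p - 1)) ^ 2 * n := by positivity
  nlinarith [mul_le_mul_of_nonneg_left h3 h4]

lemma iterations_suffice {p t : ℝ} (hp : 1 < p) (ht : 0 < t) {n : ℕ} (hn : 1 ≤ n) {T : ℕ}
    (hT : 132 * (p ^ 2 / (p - 1)) ^ 3 * (n : ℝ) ^ |1 / 2 - 1 / p| * Real.log (n + 1) ≤ T) :
    Real.exp (-(T / √(kappa p n))) * (2 * kappa p n * n * (p - 1) * radius p n t ^ 2) ≤
      ((1 - stepH p) * t) ^ p / (1024 * p ^ 2 * kappa p n) := by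
  have hq := four_le_ratio hp
  have hpq := le_ratio hp
  have hκ1 := one_le_kappa hp n
  have hκ := kappa_le hp hn
  have hsq := sqrt_kappa_le hp hn
  have hγ := radius_sq_le hp ht hn
  have hn1 : (1 : ℝ) ≤ n := by exact_mod_cast hn
  set q := p ^ 2 / (p - 1) with hqdef
  set κ := kappa p n with hκdef
  set L := Real.log (n + 1) with hL
  have ht'p : 0 < ((1 - stepH p) * t) ^ p := Real.rpow_pos_of_pos (shrink_pos hp ht) _
  set Θ := ((1 - stepH p) * t) ^ p with hΘ
  have hp1 : 0 < p - 1 := by linarith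
  have hL2 : Real.log 2 ≤ L := Real.log_le_log (by norm_num) (by linarith)
  have hlog2 : (1 / 2 : ℝ) ≤ Real.log 2 := by linarith [Real.log_two_gt_d9]
  -- The required gain. Its logarithm is at most `33 q L`, since `log q ≤ q - 1` and `L ≥ 1/2`;
  -- multiplied by `√κ ≤ 4 q² n^{|1/2-1/p|}` this gives the constant `132` and the exponent `3`.
  have hX : 2048 * p ^ 2 * κ ^ 2 * n * (p - 1) * radius p n t ^ 2 ≤
      2 ^ 20 * q ^ 11 * n ^ 4 * Θ := by
    calc 2048 * p ^ 2 * κ ^ 2 * n * (p - 1) * radius p n t ^ 2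
        ≤ 2048 * q ^ 2 * (16 * q ^ 3 * n) ^ 2 * n * q * (2 * q ^ 2 * n * Θ) := by
          gcongr
          linarith
      _ = _ := by ring
  have hlog : Real.log (2 ^ 20 * q ^ 11 * n ^ 4) ≤ 33 * q * L := by
    rw [Real.log_mul (by positivity) (by positivity), Real.log_mul (by positivity) (by positivity),
      Real.log_pow, Real.log_pow, Real.log_pow]
    have h1 : Real.log q ≤ q - 1 := Real.log_le_sub_one_of_pos (by linarith)
    have h2 : Real.log n ≤ L := Real.log_le_log (by linarith) (by linarith)
    push_cast
    nlinarith
  have hexp : 2 ^ 20 * q ^ 11 * (n : ℝ) ^ 4 ≤ Real.exp (T / √κ) := by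
    rw [← Real.log_le_iff_le_exp (by positivity)]
    refine hlog.trans ?_
    have hs : 0 < √κ := Real.sqrt_pos.2 (by linarith)
    rw [le_div_iff₀ hs]
    have hL0 : 0 ≤ 33 * q * L := by
      have : 0 ≤ L := by linarith
      positivity
    have := mul_le_mul_of_nonneg_left hsq hL0
    refine this.trans (le_trans (le_of_eq ?_) hT)
    ring
  rw [Real.exp_neg, inv_mul_le_iff₀ (Real.exp_pos _), ← mul_div_assoc, le_div_iff₀ (by positivity)]
  have := mul_le_mul_of_nonneg_right hexp ht'p.le
  nlinarith

/-! ### Optimality for the original problem -/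

/-- The difference is even, monotone on `[0, t]` from `0` to `(p/2 - 1) t^p`, and constant beyond.
Its oscillation is `|p/2 - 1| t^p`, which is at most `(p/2) t^p` for `p ≥ 1`. -/
lemma smooth_sub_rpow_mem {p t : ℝ} (hp : 1 < p) (ht : 0 < t) :
    ∃ B, ∀ s, B - p / 2 * t ^ p ≤ smooth p t s - |s| ^ p ∧ smooth p t s - |s| ^ p ≤ B := by
  have htp : 0 < t ^ p := Real.rpow_pos_of_pos ht _
  have hder : ∀ s, HasDerivAt (fun s => smooth p t s - |s| ^ p)
      (p * (max t |s| ^ (p - 2) - |s| ^ (p - 2)) * s) s := fun s =>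
    ((hasDerivAt_smooth hp ht s).sub (hasDerivAt_abs_rpow s hp)).congr_deriv (by
      rw [smooth'_eq]; ring)
  have h0 : smooth p t 0 - |(0 : ℝ)| ^ p = 0 := by
    simp [smooth, ht.le, Real.zero_rpow (show p ≠ 0 by linarith)]
  have ht0 : ∀ s, t ≤ |s| → smooth p t s - |s| ^ p = (p / 2 - 1) * t ^ p := fun s hs => by
    rw [smooth_of_le ht hs]; ring
  have hin : ∀ s, |s| < t →
      smooth p t s - |s| ^ p = smooth p t |s| - |(|s|)| ^ p := fun s _ => by
    rw [abs_abs]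
    rcases abs_choice s with h | h <;> rw [h]
    rw [smooth_neg]
  have hc : Continuous (fun s => smooth p t s - |s| ^ p) :=
    continuous_iff_continuousAt.2 fun s => (hder s).continuousAt
  have htt := ht0 t (le_abs_self t)
  rcases le_total p 2 with h2 | h2
  · have hanti : AntitoneOn (fun s => smooth p t s - |s| ^ p) (Set.Icc 0 t) := by
      refine antitoneOn_of_deriv_nonpos (convex_Icc 0 t) hc.continuousOn
        (fun s _ => (hder s).differentiableAt.differentiableWithinAt) fun s hs => ?_
      rw [interior_Icc] at hs
      rw [(hder s).deriv, abs_of_pos hs.1, max_eq_left hs.2.le]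
      have : t ^ (p - 2) ≤ s ^ (p - 2) :=
        Real.rpow_le_rpow_of_nonpos hs.1 hs.2.le (by linarith)
      exact mul_nonpos_of_nonpos_of_nonneg
        (mul_nonpos_of_nonneg_of_nonpos (by linarith) (by linarith)) hs.1.le
    refine ⟨0, fun s => ?_⟩
    rcases lt_or_ge |s| t with h | h
    · rw [hin s h]
      have h3 := hanti (Set.left_mem_Icc.2 ht.le) ⟨abs_nonneg s, h.le⟩ (abs_nonneg s)
      have h4 := hanti ⟨abs_nonneg s, h.le⟩ (Set.right_mem_Icc.2 ht.le) h.le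
      simp only at h3 h4
      rw [h0] at h3
      rw [htt] at h4
      constructor <;> nlinarith
    · rw [ht0 s h]
      constructor <;> nlinarith
  · have hmono : MonotoneOn (fun s => smooth p t s - |s| ^ p) (Set.Icc 0 t) := by
      refine monotoneOn_of_deriv_nonneg (convex_Icc 0 t) hc.continuousOn
        (fun s _ => (hder s).differentiableAt.differentiableWithinAt) fun s hs => ?_
      rw [interior_Icc] at hs
      rw [(hder s).deriv, abs_of_pos hs.1, max_eq_left hs.2.le]
      have : s ^ (p - 2) ≤ t ^ (p - 2) :=
        Real.rpow_le_rpow hs.1.le hs.2.le (by linarith)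
      exact mul_nonneg (mul_nonneg (by linarith) (by linarith)) hs.1.le
    refine ⟨(p / 2 - 1) * t ^ p, fun s => ?_⟩
    rcases lt_or_ge |s| t with h | h
    · rw [hin s h]
      have h3 := hmono (Set.left_mem_Icc.2 ht.le) ⟨abs_nonneg s, h.le⟩ (abs_nonneg s)
      have h4 := hmono ⟨abs_nonneg s, h.le⟩ (Set.right_mem_Icc.2 ht.le) h.le
      simp only at h3 h4
      rw [h0] at h3
      rw [htt] at h4
      constructor <;> nlinarith
    · rw [ht0 s h]
      constructor <;> nlinarith

/-- Half of the budget `n p t^p` pays for the gap in the smoothed problem, half for the oscillation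
of `f_t - |·|^p`; constant offsets cancel. -/
lemma isEpsOptimal_of_smooth_gap {n d : ℕ} {A : Matrix (Fin n) (Fin d) ℝ} {b : Fin n → ℝ}
    {c : Fin d → ℝ} {p t ε : ℝ} (hp : 1 < p) (ht : 0 < t) (hc : KerOrth A c) {x y : Fin d → ℝ}
    (hx : IsPathPoint A b c p t x)
    (hy : smoothObjective A b c p t y ≤ smoothObjective A b c p t x + n * p / 2 * t ^ p)
    (hε : n * p * t ^ p ≤ ε) : IsEpsOptimal A b c p ε y := by
  intro z
  have hxz := smoothObjective_le_of_stationary hp ht ((isPathPoint_iff hp ht hc).1 hx).2 z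
  obtain ⟨B, hB⟩ := smooth_sub_rpow_mem hp ht
  have h1 := Finset.sum_le_sum fun i (_ : i ∈ Finset.univ) => (hB (residual A b y i)).1
  have h2 := Finset.sum_le_sum fun i (_ : i ∈ Finset.univ) => (hB (residual A b z i)).2
  simp only [Finset.sum_sub_distrib, Finset.sum_const, Finset.card_univ, Fintype.card_fin,
    nsmul_eq_mul] at h1 h2
  unfold smoothObjective at hy hxz
  unfold objective
  linarith

/-! ### Straight-line programs from expressions -/

section Compiler

variable {n d m : ℕ}

/-- Arithmetic expressions over the memory cells. -/
inductive Arith (n d m : ℕ) : Type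
  | cell (c : Cell n d m)
  | const (q : ℚ)
  | op (o : BinOp) (a b : Arith n d m)
  | ite (a b u v : Arith n d m)

/-- The value of an expression. -/
def Arith.value (mem : Cell n d m → ℝ) : Arith n d m → ℝ
  | .cell c => mem c
  | .const q => (q : ℝ)
  | .op o a b => o.eval (a.value mem) (b.value mem)
  | .ite a b u v => if a.value mem ≤ b.value mem then u.value mem else v.value mem

/-- Every cell read by the expression satisfies `Q`. -/
def Arith.AllCells (Q : Cell n d m → Prop) : Arith n d m → Prop
  | .cell c => Q c
  | .const _ => True
  | .op _ a b => a.AllCells Q ∧ b.AllCells Q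
  | .ite a b u v => a.AllCells Q ∧ b.AllCells Q ∧ u.AllCells Q ∧ v.AllCells Q

/-- The number of nodes of an expression. -/
def Arith.size : Arith n d m → ℕ
  | .cell _ => 1
  | .const _ => 1
  | .op _ a b => a.size + b.size + 1
  | .ite a b u v => a.size + b.size + u.size + v.size + 1

lemma Arith.AllCells.mono {Q Q' : Cell n d m → Prop} (h : ∀ c, Q c → Q' c) {e : Arith n d m}
    (he : e.AllCells Q) : e.AllCells Q' := by
  induction e with
  | cell c => exact h c he
  | const q => trivial
  | op o a b iha ihb => exact ⟨iha he.1, ihb he.2⟩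
  | ite a b u v iha ihb ihu ihv => exact ⟨iha he.1, ihb he.2.1, ihu he.2.2.1, ihv he.2.2.2⟩

lemma Arith.value_congr {mem mem' : Cell n d m → ℝ} {e : Arith n d m}
    (he : e.AllCells fun c => mem c = mem' c) : e.value mem = e.value mem' := by
  induction e with
  | cell c => exact he
  | const q => rfl
  | op o a b iha ihb => simp only [Arith.value, iha he.1, ihb he.2]
  | ite a b u v iha ihb ihu ihv =>
    simp only [Arith.value, iha he.1, ihb he.2.1, ihu he.2.2.1, ihv he.2.2.2]

/-- The row of the work memory reserved for intermediate results. -/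
def scratchRow : ℕ := 7

/-- The `k`-th cell of the scratch row. -/
def scratch (k : ℕ) : Cell n d m := .work scratchRow k

/-- The cell is outside the scratch row. -/
def NotScratch (c : Cell n d m) : Prop := ∀ k, c ≠ scratch k

/-- Code that puts the value of an expression into the `k`-th scratch cell. -/
def Arith.compile : Arith n d m → ℕ → List (Instr n d m)
  -- There is no move instruction; a selection with equal branches copies a cell.
  | .cell c, k => [.select (scratch k) c c c c]
  | .const q, k => [.const (scratch k) q]
  | .op o a b, k =>
    a.compile k ++ b.compile (k + 1) ++ [.op o (scratch k) (scratch k) (scratch (k + 1))]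
  | .ite a b u v, k =>
    a.compile k ++ b.compile (k + 1) ++ u.compile (k + 2) ++ v.compile (k + 3) ++
      [.select (scratch k) (scratch k) (scratch (k + 1)) (scratch (k + 2)) (scratch (k + 3))]

lemma run_append (P : Matrix (Fin d) (Fin m) ℝ) (prog prog' : List (Instr n d m))
    (mem : Cell n d m → ℝ) : run P (prog ++ prog') mem = run P prog' (run P prog mem) :=
  List.foldl_append

lemma run_singleton (P : Matrix (Fin d) (Fin m) ℝ) (i : Instr n d m) (mem : Cell n d m → ℝ) :
    run P [i] mem = i.exec P mem := rfl

lemma scratch_injective : Function.Injective (scratch : ℕ → Cell n d m) := by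
  intro a b h
  simpa [scratch] using h

/-- Stack discipline: code compiled at level `k` writes only scratch cells from `k` on, so later
operands leave earlier results intact, and no code changes the cells that expressions read. -/
lemma Arith.run_compile (P : Matrix (Fin d) (Fin m) ℝ) {e : Arith n d m}
    (he : e.AllCells NotScratch) (k : ℕ) (mem : Cell n d m → ℝ) :
    run P (e.compile k) mem (scratch k) = e.value mem ∧
      ∀ c, (∀ j, k ≤ j → c ≠ scratch j) → run P (e.compile k) mem c = mem c := by
  have hne : ∀ {i j : ℕ}, i ≠ j → (scratch i : Cell n d m) ≠ scratch j := fun h h' =>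
    h (scratch_injective h')
  have hkeep : ∀ (a : Arith n d m) (mem mem' : Cell n d m → ℝ), a.AllCells NotScratch →
      (∀ c, NotScratch c → mem' c = mem c) → a.value mem' = a.value mem := fun a mem mem' ha h =>
    Arith.value_congr (ha.mono h)
  induction e generalizing k mem with
  | cell c =>
    refine ⟨?_, fun c' hc' => ?_⟩
    · simp [Arith.compile, run_singleton, Instr.exec, Arith.value]
    · simp [Arith.compile, run_singleton, Instr.exec, Function.update_of_ne (hc' k le_rfl)]
  | const q =>
    refine ⟨?_, fun c' hc' => ?_⟩
    · simp [Arith.compile, run_singleton, Instr.exec, Arith.value]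
    · simp [Arith.compile, run_singleton, Instr.exec, Function.update_of_ne (hc' k le_rfl)]
  | op o a b iha ihb =>
    obtain ⟨a1, a2⟩ := iha he.1 k mem
    obtain ⟨b1, b2⟩ := ihb he.2 (k + 1) (run P (a.compile k) mem)
    have hb : b.value (run P (a.compile k) mem) = b.value mem :=
      hkeep b _ _ he.2 fun c hc => a2 c fun j _ => hc j
    refine ⟨?_, fun c hc => ?_⟩
    · rw [Arith.compile, run_append, run_append, run_singleton, Instr.exec, Function.update_self,
        b1, hb, b2 _ fun j hj => hne (by omega), a1]
      rfl
    · rw [Arith.compile, run_append, run_append, run_singleton, Instr.exec,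
        Function.update_of_ne (hc k le_rfl), b2 c fun j hj => hc j (by omega), a2 c hc]
  | ite a b u v iha ihb ihu ihv =>
    obtain ⟨a1, a2⟩ := iha he.1 k mem
    set mem1 := run P (a.compile k) mem with hmem1
    obtain ⟨b1, b2⟩ := ihb he.2.1 (k + 1) mem1
    set mem2 := run P (b.compile (k + 1)) mem1 with hmem2
    obtain ⟨u1, u2⟩ := ihu he.2.2.1 (k + 2) mem2
    set mem3 := run P (u.compile (k + 2)) mem2 with hmem3
    obtain ⟨v1, v2⟩ := ihv he.2.2.2 (k + 3) mem3
    have hb : b.value mem1 = b.value mem := hkeep b _ _ he.2.1 fun c hc => a2 c fun j _ => hc j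
    have hu : u.value mem2 = u.value mem := hkeep u _ _ he.2.2.1 fun c hc => by
      rw [b2 c fun j _ => hc j, a2 c fun j _ => hc j]
    have hv : v.value mem3 = v.value mem := hkeep v _ _ he.2.2.2 fun c hc => by
      rw [u2 c fun j _ => hc j, b2 c fun j _ => hc j, a2 c fun j _ => hc j]
    refine ⟨?_, fun c hc => ?_⟩
    · rw [Arith.compile, run_append, run_append, run_append, run_append, run_singleton, Instr.exec,
        Function.update_self, ← hmem1, ← hmem2, ← hmem3, v1, hv,
        v2 (scratch k) fun j hj => hne (by omega), u2 (scratch k) fun j hj => hne (by omega),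
        b2 (scratch k) fun j hj => hne (by omega), a1,
        v2 (scratch (k + 1)) fun j hj => hne (by omega),
        u2 (scratch (k + 1)) fun j hj => hne (by omega), b1, hb,
        v2 (scratch (k + 2)) fun j hj => hne (by omega), u1, hu]
      rfl
    · rw [Arith.compile, run_append, run_append, run_append, run_append, run_singleton, Instr.exec,
        Function.update_of_ne (hc k le_rfl), ← hmem1, ← hmem2, ← hmem3,
        v2 c fun j hj => hc j (by omega), u2 c fun j hj => hc j (by omega),
        b2 c fun j hj => hc j (by omega), a2 c hc]

lemma Arith.length_compile (e : Arith n d m) (k : ℕ) : (e.compile k).length = e.size := by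
  induction e generalizing k with
  | cell c => rfl
  | const q => rfl
  | op o a b iha ihb => simp [Arith.compile, Arith.size, iha, ihb]; omega
  | ite a b u v iha ihb ihu ihv => simp [Arith.compile, Arith.size, iha, ihb, ihu, ihv]; omega

lemma applyCount_append (prog prog' : List (Instr n d m)) :
    applyCount (prog ++ prog') = applyCount prog + applyCount prog' := List.countP_append

lemma elemCount_append (prog prog' : List (Instr n d m)) :
    elemCount (prog ++ prog') = elemCount prog + elemCount prog' := List.countP_append

lemma Arith.applyCount_compile (e : Arith n d m) (k : ℕ) : applyCount (e.compile k) = 0 := by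
  induction e generalizing k with
  | cell c => rfl
  | const q => rfl
  | op o a b iha ihb =>
    rw [Arith.compile, applyCount_append, applyCount_append, iha, ihb]; rfl
  | ite a b u v iha ihb ihu ihv =>
    rw [Arith.compile, applyCount_append, applyCount_append, applyCount_append, applyCount_append,
      iha, ihb, ihu, ihv]; rfl

/-- Assignment of the value of an expression to a cell. -/
def assign (dst : Cell n d m) (e : Arith n d m) : List (Instr n d m) :=
  e.compile 0 ++ [.select dst (scratch 0) (scratch 0) (scratch 0) (scratch 0)]

lemma run_assign (P : Matrix (Fin d) (Fin m) ℝ) (dst : Cell n d m) {e : Arith n d m}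
    (he : e.AllCells NotScratch) (mem : Cell n d m → ℝ) {c : Cell n d m} (hc : NotScratch c) :
    run P (assign dst e) mem c = if c = dst then e.value mem else mem c := by
  obtain ⟨h1, h2⟩ := Arith.run_compile P he 0 mem
  rw [assign, run_append, run_singleton, Instr.exec, Function.update_apply]
  split_ifs with h h'
  · exact h1
  · exact absurd le_rfl h'
  · exact h2 c fun j _ => hc j

/-- Assignments to the cells `dst i`, for the indices `i` of a list. -/
def loop {ι : Type*} (idx : List ι) (dst : ι → Cell n d m) (e : ι → Arith n d m) :
    List (Instr n d m) :=
  idx.flatMap fun i => assign (dst i) (e i)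

/-- No expression reads a destination, so all of them see the initial memory, in any order and with
repeated indices. -/
lemma run_loop {ι : Type*} (P : Matrix (Fin d) (Fin m) ℝ) (idx : List ι) {dst : ι → Cell n d m}
    {e : ι → Arith n d m} (hdst : Function.Injective dst)
    (he : ∀ i, (e i).AllCells fun c => NotScratch c ∧ ∀ j, c ≠ dst j) (mem : Cell n d m → ℝ) :
    (∀ i ∈ idx, NotScratch (dst i) → run P (loop idx dst e) mem (dst i) = (e i).value mem) ∧
      ∀ c, NotScratch c → (∀ i, c ≠ dst i) → run P (loop idx dst e) mem c = mem c := by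
  induction idx generalizing mem with
  | nil => exact ⟨fun i hi => by simp at hi, fun c _ _ => rfl⟩
  | cons i idx ih =>
    obtain ⟨h1, h2⟩ := ih (run P (assign (dst i) (e i)) mem)
    have hrun : run P (loop (i :: idx) dst e) mem =
        run P (loop idx dst e) (run P (assign (dst i) (e i)) mem) := by
      rw [← run_append]; rfl
    have hei := (he i).mono fun c hc => hc.1
    have hsame : ∀ j, (e j).value (run P (assign (dst i) (e i)) mem) = (e j).value mem := fun j =>
      Arith.value_congr ((he j).mono fun c hc => by
        rw [run_assign P _ hei mem hc.1, if_neg (hc.2 i)])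
    rw [hrun]
    refine ⟨fun j hj hjs => ?_, fun c hc hc' => ?_⟩
    · by_cases hmem : j ∈ idx
      · rw [h1 j hmem hjs, hsame]
      · have hji : j = i := by
          rcases List.mem_cons.1 hj with h | h
          · exact h
          · exact absurd h hmem
        subst hji
        have : ∀ l : List ι, j ∉ l → ∀ mem', run P (loop l dst e) mem' (dst j) = mem' (dst j) := by
          intro l
          induction l with
          | nil => intro _ _; rfl
          | cons a l ihl =>
            intro hl mem'
            have : run P (loop (a :: l) dst e) mem' =
                run P (loop l dst e) (run P (assign (dst a) (e a)) mem') := by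
              rw [← run_append]; rfl
            rw [this, ihl (fun h => hl (List.mem_cons_of_mem _ h)),
              run_assign P _ ((he a).mono fun c hc => hc.1) mem' hjs, if_neg]
            exact fun h => hl (hdst h ▸ List.mem_cons_self)
        rw [this idx hmem, run_assign P _ hei mem hjs, if_pos rfl]
    · rw [h2 c hc hc', run_assign P _ hei mem hc, if_neg (hc' i)]

/-- Accumulation of products: `dst a += s₁ a * s₂ a`, for the indices `a` of a list. -/
def accumulate {ι : Type*} (idx : List ι) (dst s₁ s₂ : ι → Cell n d m) : List (Instr n d m) :=
  loop idx dst fun a => .op .add (.cell (dst a)) (.op .mul (.cell (s₁ a)) (.cell (s₂ a)))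

/-- Here destinations are read, and many indices share one (all entries in a row or column of `A`),
so `run_loop` does not apply; only the factors must stay untouched. -/
lemma run_accumulate {ι : Type*} (P : Matrix (Fin d) (Fin m) ℝ) (idx : List ι)
    {dst s₁ s₂ : ι → Cell n d m} (h0 : ∀ a, NotScratch (dst a))
    (h1 : ∀ a, NotScratch (s₁ a) ∧ ∀ b, s₁ a ≠ dst b)
    (h2 : ∀ a, NotScratch (s₂ a) ∧ ∀ b, s₂ a ≠ dst b) (mem : Cell n d m → ℝ)
    {c : Cell n d m} (hc : NotScratch c) :
    run P (accumulate idx dst s₁ s₂) mem c =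
      mem c + (idx.map fun a => if c = dst a then mem (s₁ a) * mem (s₂ a) else 0).sum := by
  induction idx generalizing mem with
  | nil => simp [accumulate, loop, run]
  | cons i idx ih =>
    have hrun : run P (accumulate (i :: idx) dst s₁ s₂) mem =
        run P (accumulate idx dst s₁ s₂) (run P (assign (dst i)
          (.op .add (.cell (dst i)) (.op .mul (.cell (s₁ i)) (.cell (s₂ i))))) mem) := by
      rw [← run_append]; rfl
    have hA : ∀ c, NotScratch c → run P (assign (dst i)
        (.op .add (.cell (dst i)) (.op .mul (.cell (s₁ i)) (.cell (s₂ i))))) mem c =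
        if c = dst i then mem (dst i) + mem (s₁ i) * mem (s₂ i) else mem c := fun c hc =>
      run_assign P _ (by exact ⟨h0 i, (h1 i).1, (h2 i).1⟩) mem hc
    rw [hrun, ih]
    simp only [hA c hc, hA _ (h1 _).1, hA _ (h2 _).1, if_neg ((h1 _).2 _), if_neg ((h2 _).2 _),
      List.map_cons, List.sum_cons]
    split_ifs with h
    · rw [h]; ring
    · ring

lemma applyCount_loop {ι : Type*} (idx : List ι) (dst : ι → Cell n d m) (e : ι → Arith n d m) :
    applyCount (loop idx dst e) = 0 := by
  induction idx with
  | nil => rfl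
  | cons i idx ih =>
    have : loop (i :: idx) dst e = (e i).compile 0 ++
        [.select (dst i) (scratch 0) (scratch 0) (scratch 0) (scratch 0)] ++ loop idx dst e := rfl
    rw [this, applyCount_append, applyCount_append, ih, Arith.applyCount_compile]
    rfl

lemma elemCount_loop_le {ι : Type*} (idx : List ι) (dst : ι → Cell n d m) {e : ι → Arith n d m}
    {N : ℕ} (he : ∀ i, (e i).size + 1 ≤ N) : elemCount (loop idx dst e) ≤ N * idx.length := by
  induction idx with
  | nil => simp [loop, elemCount]
  | cons i idx ih =>
    have : loop (i :: idx) dst e = assign (dst i) (e i) ++ loop idx dst e := rfl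
    rw [this, elemCount_append]
    have h1 : elemCount (assign (dst i) (e i)) ≤ (assign (dst i) (e i)).length :=
      List.countP_le_length
    have h2 : (assign (dst i) (e i)).length = (e i).size + 1 := by
      simp [assign, Arith.length_compile]
    have := he i
    rw [List.length_cons, mul_add, mul_one]
    omega

end Compiler

/-! ### The program for one step -/

section Program

variable {n d m : ℕ}

/-- `|a|` -/
def Arith.abs (a : Arith n d m) : Arith n d m := .ite (.const 0) a a (.op .sub (.const 0) a)

lemma Arith.value_abs (mem : Cell n d m → ℝ) (a : Arith n d m) :
    a.abs.value mem = |a.value mem| := by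
  simp only [Arith.abs, Arith.value, BinOp.eval, Rat.cast_zero, zero_sub]
  split_ifs with h
  · rw [abs_of_nonneg h]
  · rw [abs_of_neg (not_le.1 h)]

/-- The expression for the nearest point of `[ℓ_i, u_i]` to the residual. -/
def clampTerm (i : Fin n) : Arith n d m :=
  .ite (.cell (.work 2 i)) (.cell (.lo i)) (.cell (.lo i))
    (.ite (.cell (.hi i)) (.cell (.work 2 i)) (.cell (.hi i)) (.cell (.work 2 i)))

/-- `p - 2` -/
def expoSubTwo : Arith n d m := .op .sub (.cell .expo) (.const 2)

/-- The expression for `f̃_i'`, given the residual and its nearest point in the box. -/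
def slopeTerm (i : Fin n) : Arith n d m :=
  .op .add
    (.ite (Arith.abs (.cell (.work 3 i))) (.cell .smoothing)
      (.op .mul (.op .mul (.cell .expo) (.op .pow (.cell .smoothing) expoSubTwo))
        (.cell (.work 3 i)))
      (.op .mul (.op .mul (.cell .expo) (.op .pow (Arith.abs (.cell (.work 3 i))) expoSubTwo))
        (.cell (.work 3 i))))
    (.op .mul
      (.ite (Arith.abs (.cell (.work 3 i))) (.cell .smoothing)
        (.op .mul (.cell .expo) (.op .pow (.cell .smoothing) expoSubTwo))
        (.op .mul (.op .mul (.cell .expo) (.op .sub (.cell .expo) (.const 1)))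
          (.op .pow (Arith.abs (.cell (.work 3 i))) expoSubTwo)))
      (.op .sub (.cell (.work 2 i)) (.cell (.work 3 i))))

/-- The expression for the gradient step. -/
def gradStepTerm (k : Fin m) : Arith n d m :=
  .op .sub (.cell (.z k)) (.op .mul (.op .div (.const 1) (.cell .cond)) (.cell (.work 6 k)))

/-- `√κ` -/
def sqrtCondTerm : Arith n d m := .op .pow (.cell .cond) (.const (1 / 2))

/-- The expression for the extrapolation step. -/
def momentumTerm (k : Fin m) : Arith n d m :=
  .op .add (.cell (.work 0 k))
    (.op .mul (.op .div (.op .sub sqrtCondTerm (.const 1)) (.op .add sqrtCondTerm (.const 1)))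
      (.op .sub (.cell (.work 0 k)) (.cell (.y k))))

/-- The part of the program up to the gradient, which writes only work arrays. -/
def gradProgram (S : Finset (Fin n × Fin d)) : List (Instr n d m) :=
  -- Work rows: `0` holds `z`, `1` holds `P z`, `2` the residual, `3` its nearest point in the box,
  -- `4` the derivatives, `5` the vector `c + Aᵀ f̃'`, `6` the gradient.
  loop (List.finRange m) (fun k => .work 0 k) (fun k => .cell (.z k)) ++
  [.applyP 1 0] ++
  loop (List.finRange n) (fun i => .work 2 i) (fun i => .op .sub (.const 0) (.cell (.vecB i))) ++
  accumulate S.toList (fun a => .work 2 a.1) (fun a => .matA a.1 a.2) (fun a => .work 1 a.2) ++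
  loop (List.finRange n) (fun i => .work 3 i) clampTerm ++
  loop (List.finRange n) (fun i => .work 4 i) slopeTerm ++
  loop (List.finRange d) (fun j => .work 5 j) (fun j => .cell (.vecC j)) ++
  accumulate S.toList (fun a => .work 5 a.2) (fun a => .matA a.1 a.2) (fun a => .work 4 a.1) ++
  [.applyPT 6 5]

/-- The update of the state from the gradient. -/
def updateProgram : List (Instr n d m) :=
  loop (List.finRange m) (fun k => .work 0 k) gradStepTerm ++
  -- The extrapolation needs the old `y`, so the new one waits in row `0` until `z` has been
  -- updated.
  loop (List.finRange m) (fun k => .z k) momentumTerm ++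
  loop (List.finRange m) (fun k => .y k) (fun k => .cell (.work 0 k))

lemma applyCount_program (S : Finset (Fin n × Fin d)) :
    applyCount (gradProgram S ++ updateProgram : List (Instr n d m)) = 2 := by
  simp only [gradProgram, updateProgram, accumulate, applyCount_append, applyCount_loop]
  rfl

/-- Each loop costs at most `50` operations per index (`80` for the derivatives); four loops run
over `m`, whence `200`. -/
lemma elemCount_program_le (S : Finset (Fin n × Fin d)) :
    elemCount (gradProgram S ++ updateProgram : List (Instr n d m)) ≤
      200 * (S.card + n + d + m) := by
  simp only [gradProgram, updateProgram, accumulate, elemCount_append]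
  have h1 := elemCount_loop_le (N := 50) (List.finRange m) (fun k => (.work 0 k : Cell n d m))
    (e := fun k => .cell (.z k)) fun i => by simp [Arith.size]
  have h2 := elemCount_loop_le (N := 50) (List.finRange n) (fun i => (.work 2 i : Cell n d m))
    (e := fun i => .op .sub (.const 0) (.cell (.vecB i))) fun i => by simp [Arith.size]
  have h3 := elemCount_loop_le (N := 50) S.toList (fun a => (.work 2 a.1 : Cell n d m))
    (e := fun a => .op .add (.cell (.work 2 a.1))
      (.op .mul (.cell (.matA a.1 a.2)) (.cell (.work 1 a.2)))) fun i => by simp [Arith.size]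
  have h4 := elemCount_loop_le (N := 50) (List.finRange n) (fun i => (.work 3 i : Cell n d m))
    (e := clampTerm) fun i => by simp [Arith.size, clampTerm]
  have h5 := elemCount_loop_le (N := 80) (List.finRange n) (fun i => (.work 4 i : Cell n d m))
    (e := slopeTerm) fun i => by simp [Arith.size, slopeTerm, Arith.abs, expoSubTwo]
  have h6 := elemCount_loop_le (N := 50) (List.finRange d) (fun j => (.work 5 j : Cell n d m))
    (e := fun j => .cell (.vecC j)) fun i => by simp [Arith.size]
  have h7 := elemCount_loop_le (N := 50) S.toList (fun a => (.work 5 a.2 : Cell n d m))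
    (e := fun a => .op .add (.cell (.work 5 a.2))
      (.op .mul (.cell (.matA a.1 a.2)) (.cell (.work 4 a.1)))) fun i => by simp [Arith.size]
  have h8 := elemCount_loop_le (N := 50) (List.finRange m) (fun k => (.work 0 k : Cell n d m))
    (e := gradStepTerm) fun i => by simp [Arith.size, gradStepTerm]
  have h9 := elemCount_loop_le (N := 50) (List.finRange m) (fun k => (.z k : Cell n d m))
    (e := momentumTerm) fun i => by simp [Arith.size, momentumTerm, sqrtCondTerm]
  have h10 := elemCount_loop_le (N := 50) (List.finRange m) (fun k => (.y k : Cell n d m))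
    (e := fun k => .cell (.work 0 k)) fun i => by simp [Arith.size]
  have h11 : elemCount [(.applyP 1 0 : Instr n d m)] = 0 := rfl
  have h12 : elemCount [(.applyPT 6 5 : Instr n d m)] = 0 := rfl
  simp only [List.length_finRange, Finset.length_toList] at *
  omega

/-- A cell outside the work arrays. -/
def NotWork (c : Cell n d m) : Prop := ∀ r i, c ≠ .work r i

lemma NotWork.notScratch {c : Cell n d m} (h : NotWork c) : NotScratch c := fun k => h _ k

lemma notScratch_work {r i : ℕ} (h : r ≠ 7) : NotScratch (.work r i : Cell n d m) := fun k => by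
  simp [scratch, scratchRow, h]

lemma work_injective {k : ℕ} (r : ℕ) :
    Function.Injective (fun i : Fin k => (.work r i : Cell n d m)) := fun a b h => by
  simpa [Fin.ext_iff] using h

lemma writeArray_of_ne {k : ℕ} (mem : Cell n d m → ℝ) (dst : ℕ) (v : Fin k → ℝ) {c : Cell n d m}
    (h : ∀ i, c ≠ .work dst i) : writeArray mem dst v c = mem c := by
  cases c with
  | work r i =>
    have : r ≠ dst := fun h' => h i (by rw [h'])
    simp [writeArray, this]
  | _ => rfl

lemma writeArray_self {k : ℕ} (mem : Cell n d m → ℝ) (dst : ℕ) (v : Fin k → ℝ) (i : Fin k) :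
    writeArray mem dst v (.work dst i : Cell n d m) = v i := by
  simp [writeArray]

lemma sum_pairs_row {A : Matrix (Fin n) (Fin d) ℝ} {S : Finset (Fin n × Fin d)}
    (hS : ∀ i j, A i j ≠ 0 → (i, j) ∈ S) (v : Fin d → ℝ) (i : Fin n) :
    ∑ a ∈ S, (if i = a.1 then A a.1 a.2 * v a.2 else 0) = (A *ᵥ v) i := by
  have h1 : ∑ a ∈ S, (if i = a.1 then A a.1 a.2 * v a.2 else 0) =
      ∑ a : Fin n × Fin d, (if i = a.1 then A a.1 a.2 * v a.2 else 0) := by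
    refine Finset.sum_subset (Finset.subset_univ S) fun a _ ha => ?_
    have : A a.1 a.2 = 0 := by
      by_contra h
      exact ha (hS _ _ h)
    simp [this]
  rw [h1, Fintype.sum_prod_type, Finset.sum_eq_single i]
  · simp [mulVec, dotProduct]
  · intro j _ hj
    simp [hj.symm]
  · simp

lemma sum_pairs_col {A : Matrix (Fin n) (Fin d) ℝ} {S : Finset (Fin n × Fin d)}
    (hS : ∀ i j, A i j ≠ 0 → (i, j) ∈ S) (v : Fin n → ℝ) (j : Fin d) :
    ∑ a ∈ S, (if j = a.2 then A a.1 a.2 * v a.1 else 0) = (Aᵀ *ᵥ v) j := by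
  have h1 : ∑ a ∈ S, (if j = a.2 then A a.1 a.2 * v a.1 else 0) =
      ∑ a : Fin n × Fin d, (if j = a.2 then A a.1 a.2 * v a.1 else 0) := by
    refine Finset.sum_subset (Finset.subset_univ S) fun a _ ha => ?_
    have : A a.1 a.2 = 0 := by
      by_contra h
      exact ha (hS _ _ h)
    simp [this]
  rw [h1, Fintype.sum_prod_type]
  simp [mulVec, dotProduct]

lemma value_clampTerm (mem : Cell n d m → ℝ) (i : Fin n) :
    (clampTerm i : Arith n d m).value mem = clamp (mem (.lo i)) (mem (.hi i)) (mem (.work 2 i)) :=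
  rfl

lemma value_slopeTerm (mem : Cell n d m → ℝ) (i : Fin n) :
    (slopeTerm i : Arith n d m).value mem =
      smooth' (mem .expo) (mem .smoothing) (mem (.work 3 i)) +
        smooth'' (mem .expo) (mem .smoothing) (mem (.work 3 i)) *
          (mem (.work 2 i) - mem (.work 3 i)) := by
  simp [slopeTerm, expoSubTwo, Arith.value, Arith.value_abs, BinOp.eval, smooth', smooth'']

lemma run_gradProgram {A : Matrix (Fin n) (Fin d) ℝ} {S : Finset (Fin n × Fin d)}
    (hS : ∀ i j, A i j ≠ 0 → (i, j) ∈ S) {b : Fin n → ℝ} {c : Fin d → ℝ} {p t : ℝ}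
    {x : Fin d → ℝ} (P : Matrix (Fin d) (Fin m) ℝ)
    {yz : EuclideanSpace ℝ (Fin m) × EuclideanSpace ℝ (Fin m)} {mem : Cell n d m → ℝ}
    (h : Holds A b c p t x yz mem) :
    (∀ k : Fin m, run P (gradProgram S) mem (.work 6 k) =
      (Pᵀ *ᵥ (c + Aᵀ *ᵥ extendGrad A b x p t (P *ᵥ yz.2.ofLp))) k) ∧
    ∀ cell, NotWork cell → run P (gradProgram S) mem cell = mem cell := by
  unfold gradProgram
  simp only [run_append, run_singleton]
  -- copy of `z`
  obtain ⟨v1, k1⟩ := run_loop P (List.finRange m) (work_injective 0)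
    (e := fun k => (.cell (.z k) : Arith n d m)) (fun k => ⟨by simp [NotScratch, scratch], by simp⟩)
    mem
  set m1 := run P (loop (List.finRange m) (fun k => .work 0 k) fun k => .cell (.z k)) mem
  have n1 : ∀ cell, NotWork cell → m1 cell = mem cell := fun cell hc =>
    k1 cell hc.notScratch fun i => hc _ _
  -- multiplication by `P`
  set m2 := (Instr.applyP 1 0).exec P m1 with hm2
  have v2 : ∀ j : Fin d, m2 (.work 1 j) = (P *ᵥ yz.2.ofLp) j := fun j => by
    rw [hm2, Instr.exec, writeArray_self]
    congr 1
    ext k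
    rw [v1 k (List.mem_finRange k) (notScratch_work (by norm_num))]
    exact h.z k
  have n2 : ∀ cell, NotWork cell → m2 cell = mem cell := fun cell hc => by
    rw [hm2, Instr.exec, writeArray_of_ne _ _ _ fun i => hc _ _, n1 cell hc]
  -- residual
  obtain ⟨v3, k3⟩ := run_loop P (List.finRange n) (work_injective 2)
    (e := fun i => (.op .sub (.const 0) (.cell (.vecB i)) : Arith n d m))
    (fun k => ⟨trivial, by simp [NotScratch, scratch], by simp⟩) m2
  set m3 := run P (loop (List.finRange n) (fun i => .work 2 i)
    fun i => .op .sub (.const 0) (.cell (.vecB i))) m2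
  have n3 : ∀ cell, NotWork cell → m3 cell = mem cell := fun cell hc => by
    rw [k3 cell hc.notScratch fun i => hc _ _, n2 cell hc]
  have k4 := fun (cell : Cell n d m) (hc : NotScratch cell) =>
    run_accumulate P S.toList (dst := fun a : Fin n × Fin d => (.work 2 a.1 : Cell n d m))
      (s₁ := fun a => .matA a.1 a.2) (s₂ := fun a => .work 1 a.2)
      (fun a => notScratch_work (by norm_num))
      (fun a => ⟨by simp [NotScratch, scratch], by simp⟩)
      (fun a => ⟨notScratch_work (by norm_num), by simp⟩) m3 hc
  set m4 := run P (accumulate S.toList (fun a => .work 2 a.1) (fun a => .matA a.1 a.2)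
    fun a => .work 1 a.2) m3
  have n4 : ∀ cell, NotWork cell → m4 cell = mem cell := fun cell hc => by
    rw [k4 cell hc.notScratch, n3 cell hc]
    simp [hc 2 _]
  have v4 : ∀ i : Fin n, m4 (.work 2 i) = residual A b (P *ᵥ yz.2.ofLp) i := fun i => by
    rw [k4 _ (notScratch_work (by norm_num)), v3 i (List.mem_finRange i)
      (notScratch_work (by norm_num)), Finset.sum_map_toList]
    have e1 : ∀ a : Fin n × Fin d, m3 (.matA a.1 a.2) = A a.1 a.2 := fun a => by
      rw [n3 _ (by simp [NotWork]), h.matA]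
    have e2 : ∀ a : Fin n × Fin d, m3 (.work 1 a.2) = (P *ᵥ yz.2.ofLp) a.2 := fun a => by
      rw [k3 _ (notScratch_work (by norm_num)) (by simp), v2]
    have e3 : m2 (.vecB i) = b i := by rw [n2 _ (by simp [NotWork]), h.vecB]
    have e4 : ∀ a : Fin n × Fin d, ((Cell.work 2 ↑i : Cell n d m) = .work 2 ↑a.1) ↔ i = a.1 :=
      fun a => by simp [Fin.ext_iff]
    simp only [e1, e2, e4, Arith.value, BinOp.eval, e3]
    rw [sum_pairs_row hS]
    simp [residual]
    ring
  -- nearest points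
  obtain ⟨v5, k5⟩ := run_loop P (List.finRange n) (work_injective 3)
    (e := fun i => (clampTerm i : Arith n d m))
    (fun k => by simp [clampTerm, Arith.AllCells, NotScratch, scratch, scratchRow]) m4
  set m5 := run P (loop (List.finRange n) (fun i => .work 3 i) clampTerm) m4
  have n5 : ∀ cell, NotWork cell → m5 cell = mem cell := fun cell hc => by
    rw [k5 cell hc.notScratch fun i => hc _ _, n4 cell hc]
  -- derivatives
  obtain ⟨v6, k6⟩ := run_loop P (List.finRange n) (work_injective 4)
    (e := fun i => (slopeTerm i : Arith n d m))
    (fun k => by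
      simp [slopeTerm, Arith.abs, expoSubTwo, Arith.AllCells, NotScratch, scratch, scratchRow]) m5
  set m6 := run P (loop (List.finRange n) (fun i => .work 4 i) slopeTerm) m5
  have n6 : ∀ cell, NotWork cell → m6 cell = mem cell := fun cell hc => by
    rw [k6 cell hc.notScratch fun i => hc _ _, n5 cell hc]
  have w6 : ∀ i : Fin n, m6 (.work 4 i) = extendGrad A b x p t (P *ᵥ yz.2.ofLp) i := fun i => by
    rw [v6 i (List.mem_finRange i) (notScratch_work (by norm_num)), value_slopeTerm,
      v5 i (List.mem_finRange i) (notScratch_work (by norm_num)), value_clampTerm,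
      k5 (.work 2 i) (notScratch_work (by norm_num)) (by simp), v4, n5 _ (by simp [NotWork]),
      n5 _ (by simp [NotWork]), n4 _ (by simp [NotWork]), n4 _ (by simp [NotWork]), h.expo,
      h.smoothing, h.lo, h.hi]
    rfl
  -- accumulation of `c + Aᵀ f̃'`
  obtain ⟨v7, k7⟩ := run_loop P (List.finRange d) (work_injective 5)
    (e := fun j => (.cell (.vecC j) : Arith n d m))
    (fun k => ⟨by simp [NotScratch, scratch], by simp⟩) m6
  set m7 := run P (loop (List.finRange d) (fun j => .work 5 j) fun j => .cell (.vecC j)) m6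
  have n7 : ∀ cell, NotWork cell → m7 cell = mem cell := fun cell hc => by
    rw [k7 cell hc.notScratch fun i => hc _ _, n6 cell hc]
  have k8 := fun (cell : Cell n d m) (hc : NotScratch cell) =>
    run_accumulate P S.toList (dst := fun a : Fin n × Fin d => (.work 5 a.2 : Cell n d m))
      (s₁ := fun a => .matA a.1 a.2) (s₂ := fun a => .work 4 a.1)
      (fun a => notScratch_work (by norm_num))
      (fun a => ⟨by simp [NotScratch, scratch], by simp⟩)
      (fun a => ⟨notScratch_work (by norm_num), by simp⟩) m7 hc
  set m8 := run P (accumulate S.toList (fun a => .work 5 a.2) (fun a => .matA a.1 a.2)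
    fun a => .work 4 a.1) m7
  have v8 : ∀ j : Fin d, m8 (.work 5 j) =
      (c + Aᵀ *ᵥ extendGrad A b x p t (P *ᵥ yz.2.ofLp)) j := fun j => by
    rw [k8 _ (notScratch_work (by norm_num)), v7 j (List.mem_finRange j)
      (notScratch_work (by norm_num)), Finset.sum_map_toList]
    have e1 : ∀ a : Fin n × Fin d, m7 (.matA a.1 a.2) = A a.1 a.2 := fun a => by
      rw [n7 _ (by simp [NotWork]), h.matA]
    have e2 : ∀ a : Fin n × Fin d, m7 (.work 4 a.1) =
        extendGrad A b x p t (P *ᵥ yz.2.ofLp) a.1 := fun a => by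
      rw [k7 _ (notScratch_work (by norm_num)) (by simp), w6]
    have e3 : m6 (.vecC j) = c j := by rw [n6 _ (by simp [NotWork]), h.vecC]
    have e4 : ∀ a : Fin n × Fin d, ((Cell.work 5 ↑j : Cell n d m) = .work 5 ↑a.2) ↔ j = a.2 :=
      fun a => by simp [Fin.ext_iff]
    simp only [e1, e2, e4, Arith.value, e3]
    rw [sum_pairs_col hS]
    rfl
  -- multiplication by `Pᵀ`
  refine ⟨fun k => ?_, fun cell hc => ?_⟩
  · rw [Instr.exec, writeArray_self]
    simp only [v8]
  · rw [Instr.exec, writeArray_of_ne _ _ _ fun i => hc _ _, k8 cell hc.notScratch, n7 cell hc]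
    simp [hc 5 _]

lemma implementsStep_program (S : Finset (Fin n × Fin d)) :
    ImplementsStep S (gradProgram S ++ updateProgram : List (Instr n d m)) := by
  intro A hS b c p t hp ht x P yz mem h
  obtain ⟨vg, ng⟩ := run_gradProgram hS P h
  rw [run_append]
  set m0 := run P (gradProgram S) mem
  unfold updateProgram
  simp only [run_append]
  obtain ⟨v1, k1⟩ := run_loop P (List.finRange m) (work_injective 0)
    (e := fun k => (gradStepTerm k : Arith n d m))
    (fun k => by simp [gradStepTerm, Arith.AllCells, NotScratch, scratch, scratchRow]) m0
  set m1 := run P (loop (List.finRange m) (fun k => .work 0 k) gradStepTerm) m0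
  have n1 : ∀ cell, NotWork cell → m1 cell = mem cell := fun cell hc => by
    rw [k1 cell hc.notScratch fun i => hc _ _, ng cell hc]
  have w1 : ∀ k : Fin m, m1 (.work 0 k) =
      (agdStep (precondObjective A b c p t x P) (kappa p n) yz).1 k := fun k => by
    rw [v1 k (List.mem_finRange k) (notScratch_work (by norm_num))]
    simp only [gradStepTerm, Arith.value, BinOp.eval, vg]
    rw [ng _ (by simp [NotWork]), ng _ (by simp [NotWork]), h.z, h.cond]
    simp [agdStep, gradient_precondObjective hp ht]
  obtain ⟨v2, k2⟩ := run_loop P (List.finRange m) (dst := fun k => (.z k : Cell n d m))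
    (e := fun k => (momentumTerm k : Arith n d m)) (fun a b hab => by simpa using hab)
    (fun k => by
      simp [momentumTerm, sqrtCondTerm, Arith.AllCells, NotScratch, scratch, scratchRow]) m1
  set m2 := run P (loop (List.finRange m) (fun k => .z k) momentumTerm) m1
  have w2 : ∀ k : Fin m, m2 (.z k) =
      (agdStep (precondObjective A b c p t x P) (kappa p n) yz).2 k := fun k => by
    rw [v2 k (List.mem_finRange k) (by simp [NotScratch, scratch])]
    simp only [momentumTerm, sqrtCondTerm, Arith.value, BinOp.eval, w1]
    rw [n1 _ (by simp [NotWork]), n1 _ (by simp [NotWork]), h.y, h.cond]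
    simp [agdStep, Real.sqrt_eq_rpow]
  obtain ⟨v3, k3⟩ := run_loop P (List.finRange m) (dst := fun k => (.y k : Cell n d m))
    (e := fun k => (.cell (.work 0 k) : Arith n d m)) (fun a b hab => by simpa using hab)
    (fun k => by simp [Arith.AllCells, NotScratch, scratch, scratchRow]) m2
  set m3 := run P (loop (List.finRange m) (fun k => .y k) fun k => .cell (.work 0 k)) m2
  have n3 : ∀ cell, NotWork cell → (∀ k, cell ≠ .y k) → (∀ k, cell ≠ .z k) →
      m3 cell = mem cell := fun cell hc hy hz => by
    rw [k3 cell hc.notScratch hy, k2 cell hc.notScratch hz, n1 cell hc]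
  refine ⟨fun i j => ?_, fun i => ?_, fun j => ?_, fun i => ?_, fun i => ?_, ?_, ?_, ?_,
    fun k => ?_, fun k => ?_⟩
  · rw [n3 _ (by simp [NotWork]) (by simp) (by simp), h.matA]
  · rw [n3 _ (by simp [NotWork]) (by simp) (by simp), h.vecB]
  · rw [n3 _ (by simp [NotWork]) (by simp) (by simp), h.vecC]
  · rw [n3 _ (by simp [NotWork]) (by simp) (by simp), h.lo]
  · rw [n3 _ (by simp [NotWork]) (by simp) (by simp), h.hi]
  · rw [n3 _ (by simp [NotWork]) (by simp) (by simp), h.expo]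
  · rw [n3 _ (by simp [NotWork]) (by simp) (by simp), h.smoothing]
  · rw [n3 _ (by simp [NotWork]) (by simp) (by simp), h.cond]
  · rw [v3 k (List.mem_finRange k) (by simp [NotScratch, scratch])]
    change m2 (.work 0 k) = _
    rw [k2 _ (notScratch_work (by norm_num)) (by simp), w1]
  · rw [k3 _ (by simp [NotScratch, scratch]) (by simp), w2]

end Program

/-! ### The homotopy method -/

section Homotopy

variable {n d m : ℕ} {A : Matrix (Fin n) (Fin d) ℝ} {b : Fin n → ℝ} {c : Fin d → ℝ} {p t₀ : ℝ}

lemma tSeq_pos (hp : 1 < p) (ht : 0 < t₀) (k : ℕ) : 0 < tSeq p t₀ k :=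
  mul_pos (pow_pos (by linarith [stepH_le hp]) k) ht

lemma tSeq_succ (k : ℕ) : tSeq p t₀ (k + 1) = (1 - stepH p) * tSeq p t₀ k := by
  unfold tSeq
  rw [pow_succ']
  ring

/-- The invariant of the homotopy method. -/
lemma homotopy_invariant (hp : 1 < p) (ht : 0 < t₀) (hc : KerOrth A c) (hn : 1 ≤ n)
    {pre : ℝ → (Fin d → ℝ) → Matrix (Fin d) (Fin m) ℝ}
    (hpre : ∀ t x, 0 < t → pre t x * (pre t x)ᵀ = pinv (gram A b p t x)) {T : ℕ}
    (hT : 132 * (p ^ 2 / (p - 1)) ^ 3 * (n : ℝ) ^ |1 / 2 - 1 / p| * Real.log (n + 1) ≤ T)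
    {x₀ : Fin d → ℝ} (hx₀ : IsPathPoint A b c p t₀ x₀) (k : ℕ) (x : Fin d → ℝ)
    (hx : IsPathPoint A b c p (tSeq p t₀ k) x) :
    KerOrth A (homotopy A b c p t₀ pre T x₀ k) ∧
    (∀ i, |spow (residual A b (homotopy A b c p t₀ pre T x₀ k) i) (p / 2) -
      spow (residual A b x i) (p / 2)| ≤ tSeq p t₀ k ^ (p / 2) / 2) ∧
    smoothObjective A b c p (tSeq p t₀ k) (homotopy A b c p t₀ pre T x₀ k) ≤
      smoothObjective A b c p (tSeq p t₀ k) x + n * p / 2 * tSeq p t₀ k ^ p := by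
  induction k generalizing x with
  | zero =>
    have h0 : tSeq p t₀ 0 = t₀ := by simp [tSeq]
    rw [h0] at hx ⊢
    obtain rfl := hx.unique hp ht hc hx₀
    have h1 := Real.rpow_pos_of_pos ht (p / 2)
    have h2 := Real.rpow_pos_of_pos ht p
    refine ⟨hx.1, fun i => ?_, ?_⟩
    · simp only [homotopy, sub_self, abs_zero]
      positivity
    · simp only [homotopy]
      have : 0 ≤ n * p / 2 * t₀ ^ p := by positivity
      linarith
  | succ k ih =>
    have htk := tSeq_pos hp ht k
    obtain ⟨z, hz⟩ := exists_isPathPoint hp htk A b hc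
    obtain ⟨hk, hbox, -⟩ := ih z hz
    rw [tSeq_succ] at hx ⊢
    set t := tSeq p t₀ k with htdef
    set y := homotopy A b c p t₀ pre T x₀ k with hy
    have hstep : homotopy A b c p t₀ pre T x₀ (k + 1) = phase A b c p t T (pre t y) y := rfl
    -- Error `t^{p/2}/2` of the current point plus drift of the path: exactly the radius minus the
    -- margin that `phase_spec` requires.
    have hclose : ∀ i, |spow (residual A b x i) (p / 2) - spow (residual A b y i) (p / 2)| ≤
        radius p n t - t ^ (p / 2) / 2 := fun i => by
      have h1 := abs_sub_le (spow (residual A b x i) (p / 2)) (spow (residual A b z i) (p / 2))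
        (spow (residual A b y i) (p / 2))
      have h2 := hz.drift hp htk hc hx i
      have h3 := hbox i
      rw [abs_sub_comm] at h3
      rw [radius_eq]
      linarith
    obtain ⟨g1, g2, g3⟩ := phase_spec hp htk hc hk (hpre t y htk) hx hclose
      (iterations_suffice hp htk hn hT)
    rw [hstep]
    refine ⟨g1, g2, g3.trans ?_⟩
    have ht' := Real.rpow_pos_of_pos (shrink_pos hp htk) p
    have hκ := one_le_kappa hp n
    have hn1 : (1 : ℝ) ≤ n := by exact_mod_cast hn
    have h1 : ((1 - stepH p) * t) ^ p / (1024 * p ^ 2 * kappa p n) ≤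
        ((1 - stepH p) * t) ^ p / 2 := by
      refine div_le_div_of_nonneg_left ht'.le (by norm_num) ?_
      have : 1 ≤ p ^ 2 := one_le_pow₀ hp.le
      nlinarith
    have h2 : 1 / 2 * ((1 - stepH p) * t) ^ p ≤ n * p / 2 * ((1 - stepH p) * t) ^ p := by
      gcongr
      nlinarith
    linarith

lemma tSeq_rpow_le (hp : 1 < p) (ht : 0 < t₀) (K : ℕ) :
    tSeq p t₀ K ^ p ≤ Real.exp (-(K / 2)) * t₀ ^ p := by
  have hh := stepH_le hp
  unfold tSeq
  rw [Real.mul_rpow (pow_nonneg (by linarith) K) ht.le]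
  have h1 : (1 - stepH p) ^ K ≤ Real.exp (-(K * stepH p)) := by
    have h2 : 1 - stepH p ≤ Real.exp (-stepH p) := by
      linarith [Real.add_one_le_exp (-stepH p)]
    calc (1 - stepH p) ^ K ≤ Real.exp (-stepH p) ^ K := pow_le_pow_left₀ (by linarith) h2 K
      _ = _ := by rw [← Real.exp_nat_mul]; congr 1; ring
  have h3 : ((1 - stepH p) ^ K) ^ p ≤ Real.exp (-(K / 2)) := by
    calc ((1 - stepH p) ^ K) ^ p ≤ Real.exp (-(K * stepH p)) ^ p :=
          Real.rpow_le_rpow (pow_nonneg (by linarith) K) h1 (by linarith)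
      _ = _ := by
          rw [← Real.exp_mul]
          congr 1
          unfold stepH
          field_simp
  have := Real.rpow_pos_of_pos ht p
  gcongr

lemma phases_suffice (hp : 1 < p) (ht : 0 < t₀) (hn : 1 ≤ n) {ε C : ℝ} (hε : 0 < ε) (hC : 2 ≤ C)
    {K : ℕ} (hK : C * Real.log (n * p / ε * t₀ ^ p) ≤ K) : n * p * tSeq p t₀ K ^ p ≤ ε := by
  have h1 := tSeq_rpow_le hp ht K
  have htp := Real.rpow_pos_of_pos ht p
  have hn1 : (1 : ℝ) ≤ n := by exact_mod_cast hn
  have hnp : 0 < n * p := by positivity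
  set R := n * p / ε * t₀ ^ p with hR
  have hR0 : 0 < R := by positivity
  have hlog : Real.log R ≤ K / 2 := by
    -- A negative logarithm is possible for large `ε`; then `K ≥ 0` is enough.
    rcases le_total 0 (Real.log R) with h | h
    · nlinarith
    · have : (0 : ℝ) ≤ K / 2 := by positivity
      linarith
  have h2 : R ≤ Real.exp (K / 2) := by
    rwa [← Real.log_le_iff_le_exp hR0]
  have h3 : R * Real.exp (-(K / 2)) ≤ 1 := by
    rw [Real.exp_neg]
    exact mul_inv_le_one_of_le₀ h2 (Real.exp_pos _).le
  calc n * p * tSeq p t₀ K ^ p ≤ n * p * (Real.exp (-(K / 2)) * t₀ ^ p) := by gcongr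
    _ = ε * (R * Real.exp (-(K / 2))) := by rw [hR]; field_simp
    _ ≤ ε * 1 := by gcongr
    _ = ε := mul_one ε

/-- Without rows the kernel is the whole space, so `c = 0` and the objective is constant. -/
lemma isEpsOptimal_of_isEmpty (hn : n = 0) (hc : KerOrth A c) {ε : ℝ} (hε : 0 < ε)
    (x : Fin d → ℝ) : IsEpsOptimal A b c p ε x := by
  subst hn
  have hc0 : c = 0 := dotProduct_self_eq_zero.1 (hc c (Subsingleton.elim _ _))
  intro x'
  simp [objective, hc0, hε.le]

lemma initial_bound (hp : 1 < p) (ht : 0 < t₀) {r : ℝ} (hr : 0 ≤ r)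
    (h : (2 * r) ^ (1 / (p - 1)) ≤ t₀) : t₀ ^ (2 - p) * r ≤ t₀ / 2 := by
  have hp1 : 0 < p - 1 := by linarith
  have h1 : 2 * r ≤ t₀ ^ (p - 1) := by
    have := Real.rpow_le_rpow (Real.rpow_nonneg (by positivity) _) h hp1.le
    rwa [← Real.rpow_mul (by positivity), one_div_mul_cancel hp1.ne', Real.rpow_one] at this
  have h2 : t₀ ^ (2 - p) * t₀ ^ (p - 1) = t₀ := by
    rw [← Real.rpow_add ht]
    norm_num
  have h3 := mul_le_mul_of_nonneg_left h1 (Real.rpow_pos_of_pos ht (2 - p)).le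
  rw [h2] at h3
  linarith

end Homotopy

lemma costEnergy_nonneg {n d : ℕ} {A : Matrix (Fin n) (Fin d) ℝ} {c : Fin d → ℝ}
    (hc : KerOrth A c) : 0 ≤ costEnergy A c := by
  have hM : Aᵀ * A = Aᵀ * diagonal (fun _ => 1 : Fin n → ℝ) * A := by simp
  have h := mulVec_pinv_of_kerOrth (D := fun _ => (1 : ℝ)) (fun _ => one_pos) hc
  rw [← hM, ← mulVec_mulVec] at h
  unfold costEnergy
  nth_rewrite 1 [← h]
  rw [transpose_mulVec_dotProduct]
  exact Finset.sum_nonneg fun i _ => mul_self_nonneg _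

end LpHomotopy

end

/-! ### Assembly of the theorem -/

theorem theorem1 :
    ∃ (C : ℝ) (a : ℕ), 0 < C ∧
      -- correctness of the method, and the numbers of phases and iterations
      (∀ (p : ℝ), 1 < p → ∀ (n d : ℕ) (A : Matrix (Fin n) (Fin d) ℝ) (b : Fin n → ℝ)
        (c : Fin d → ℝ), LpHomotopy.KerOrth A c → ∀ (t₀ : ℝ), 0 < t₀ →
        ∃ x₀ : Fin d → ℝ,
          (∀ x : Fin d → ℝ, LpHomotopy.IsPathPoint A b c p t₀ x ↔ x = x₀) ∧
          (t₀ = max ((2 * √(LpHomotopy.costEnergy A c)) ^ (1 / (p - 1))) (2 * ‖WithLp.toLp 2 b‖) →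
            x₀ = LpHomotopy.initialPoint A b c p t₀) ∧
          (t₀ = max ((2 * LpHomotopy.costEnergy A c) ^ (1 / (p - 1))) (2 * ‖WithLp.toLp 2 b‖) →
            1 ≤ p ^ 2 * LpHomotopy.costEnergy A c →
            x₀ = LpHomotopy.initialPoint A b c p t₀) ∧
          ∀ (T : ℕ), C * (p ^ 2 / (p - 1)) ^ a * (n : ℝ) ^ |1 / 2 - 1 / p| * Real.log (n + 1) ≤ T →
            (∀ (k : ℕ) (x : Fin d → ℝ),
              LpHomotopy.IsPathPoint A b c p (LpHomotopy.tSeq p t₀ k) x →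
              LpHomotopy.residual A b
                  (LpHomotopy.homotopy A b c p t₀ (LpHomotopy.precond A b p) T x₀ k) ∈
                LpHomotopy.Nbhd p (LpHomotopy.residual A b x)
                  (LpHomotopy.radius p n (LpHomotopy.tSeq p t₀ k)) ∧
              LpHomotopy.residual A b
                  (LpHomotopy.homotopy A b c p t₀ (LpHomotopy.precond' A b p) T x₀ k) ∈
                LpHomotopy.Nbhd p (LpHomotopy.residual A b x)
                  (LpHomotopy.radius p n (LpHomotopy.tSeq p t₀ k))) ∧
            ∀ (ε : ℝ), 0 < ε → ∀ (K : ℕ), C * Real.log (n * p / ε * t₀ ^ p) ≤ K →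
              (∀ x : Fin d → ℝ, LpHomotopy.IsPathPoint A b c p (LpHomotopy.tSeq p t₀ K) x →
                LpHomotopy.IsEpsOptimal A b c p ε x) ∧
              LpHomotopy.IsEpsOptimal A b c p ε
                (LpHomotopy.homotopy A b c p t₀ (LpHomotopy.precond A b p) T x₀ K) ∧
              LpHomotopy.IsEpsOptimal A b c p ε
                (LpHomotopy.homotopy A b c p t₀ (LpHomotopy.precond' A b p) T x₀ K)) ∧
      -- cost of one iteration
      (∀ (n d m : ℕ) (S : Finset (Fin n × Fin d)),
        ∃ prog : List (LpHomotopy.Instr n d m),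
          LpHomotopy.ImplementsStep S prog ∧
          (LpHomotopy.applyCount prog : ℝ) ≤ C ∧
          (LpHomotopy.elemCount prog : ℝ) ≤ C * (S.card + n + d + m + 1)) := by
  open LpHomotopy in
  -- The operation count dictates `200`; the iterations need `132` and the phases `2`.
  refine ⟨200, 3, by norm_num, fun p hp n d A b c hc t₀ ht => ?_, fun n d m S => ?_⟩
  · obtain ⟨x₀, hx₀⟩ := exists_isPathPoint hp ht A b hc
    have hE := costEnergy_nonneg hc
    have hpath : 1 / p * t₀ ^ (2 - p) * √(costEnergy A c) ≤ t₀ / 2 →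
        2 * ‖WithLp.toLp 2 b‖ ≤ t₀ → x₀ = initialPoint A b c p t₀ := fun h1 h2 =>
      hx₀.unique hp ht hc (initialPoint_isPathPoint hp ht hc h2 h1)
    have htp := Real.rpow_pos_of_pos ht (2 - p)
    refine ⟨x₀, fun x => ⟨fun hx => hx.unique hp ht hc hx₀, fun hx => hx ▸ hx₀⟩,
      fun h0 => hpath ?_ (h0 ▸ le_max_right _ _), fun h0 h1 => hpath ?_ (h0 ▸ le_max_right _ _),
      fun T hT => ?_⟩
    · have h1 := initial_bound hp ht (Real.sqrt_nonneg (costEnergy A c)) (h0 ▸ le_max_left _ _)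
      have h2 : 1 / p ≤ 1 := by rw [div_le_one (by linarith)]; exact hp.le
      have h3 : 0 ≤ t₀ ^ (2 - p) * √(costEnergy A c) := by positivity
      nlinarith
    · have h2 := initial_bound hp ht hE (h0 ▸ le_max_left _ _)
      -- Here `p² cᵀ(AᵀA)†c ≥ 1` enters: it makes the bound without the square root imply the
      -- condition with it.
      have h3 : 1 / p * √(costEnergy A c) ≤ costEnergy A c := by
        have h4 : 1 ≤ p * √(costEnergy A c) := by
          rw [← Real.sqrt_one]
          refine (Real.sqrt_le_sqrt h1).trans (le_of_eq ?_)
          rw [Real.sqrt_mul (by positivity), Real.sqrt_sq (by linarith)]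
        have h5 := Real.mul_self_sqrt hE
        rw [one_div, inv_mul_le_iff₀ (by linarith)]
        nlinarith [Real.sqrt_nonneg (costEnergy A c)]
      have h4 := mul_le_mul_of_nonneg_left h3 htp.le
      linarith
    · rcases Nat.eq_zero_or_pos n with hn | hn
      · have hNb : ∀ (s s' : Fin n → ℝ) γ, s ∈ Nbhd p s' γ := fun s s' γ i =>
          absurd i.2 (by omega)
        exact ⟨fun k x _ => ⟨hNb _ _ _, hNb _ _ _⟩, fun ε hε K _ =>
          ⟨fun x _ => isEpsOptimal_of_isEmpty hn hc hε x, isEpsOptimal_of_isEmpty hn hc hε _,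
            isEpsOptimal_of_isEmpty hn hc hε _⟩⟩
      · have hT' : 132 * (p ^ 2 / (p - 1)) ^ 3 * (n : ℝ) ^ |1 / 2 - 1 / p| * Real.log (n + 1) ≤
            T := by
          refine le_trans ?_ hT
          have h1 := four_le_ratio hp
          have h2 : 0 ≤ Real.log ((n : ℝ) + 1) :=
            Real.log_nonneg (by linarith [Nat.cast_nonneg (α := ℝ) n])
          gcongr
          norm_num
        have inv := fun k x hx => homotopy_invariant (b := b) hp ht hc hn
          (pre := precond A b p) (fun t x ht => precond_mul_transpose hp ht) hT' hx₀ k x hx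
        have inv' := fun k x hx => homotopy_invariant (b := b) hp ht hc hn
          (pre := precond' A b p) (fun t x ht => precond'_mul_transpose hp ht) hT' hx₀ k x hx
        have hrad : ∀ k, tSeq p t₀ k ^ (p / 2) / 2 ≤ radius p n (tSeq p t₀ k) := fun k => by
          have h1 := le_radius hp n (tSeq_pos hp ht k)
          have h2 := Real.rpow_pos_of_pos (tSeq_pos hp ht k) (p / 2)
          linarith
        refine ⟨fun k x hx => ⟨fun i => ((inv k x hx).2.1 i).trans (hrad k),
          fun i => ((inv' k x hx).2.1 i).trans (hrad k)⟩, fun ε hε K hK => ?_⟩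
        have hsmall := phases_suffice hp ht hn hε (by norm_num) hK
        have htK := tSeq_pos hp ht K
        obtain ⟨z, hz⟩ := exists_isPathPoint hp htK A b hc
        refine ⟨fun x hx => isEpsOptimal_of_smooth_gap hp htK hc hx ?_ hsmall,
          isEpsOptimal_of_smooth_gap hp htK hc hz (inv K z hz).2.2 hsmall,
          isEpsOptimal_of_smooth_gap hp htK hc hz (inv' K z hz).2.2 hsmall⟩
        have := Real.rpow_pos_of_pos htK p
        have : 0 ≤ n * p / 2 * tSeq p t₀ K ^ p := by positivity
        linarith
  · refine ⟨gradProgram S ++ updateProgram, implementsStep_program S, ?_, ?_⟩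
    · rw [applyCount_program]
      norm_num
    · have h1 : (elemCount (gradProgram S ++ updateProgram : List (Instr n d m)) : ℝ) ≤
          200 * (S.card + n + d + m) := by exact_mod_cast elemCount_program_le S
      linarith
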